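/- Let $d\ge 1$ be an integer and let $\mathbb{X}^d$ be either the Euclidean space $\mathbb{R}^d$ or the hyperbolic space $\mathbb{H}^d$ of constant curvature $-1$, with Riemannian distance $d(\cdot,\cdot)$ and Riemannian volume $\mathrm{vol}$. Fix an origin $p\in\mathbb{X}^d$ and put $B(p,r)=\{y: d(p,y)\le r\}$, $B_r=B(p,r)$. Let $\eta$ be a stationary Poisson process on $\mathbb{X}^d$, that is, a Poisson process with intensity measure $\mathrm{vol}$, regarded as a random locally finite set of points. For $x\in\eta$ let $N(x,\eta)$ be the set of outgoing neighbours of $x$ in the nearest neighbour embracing graph: $x$ is connected to its nearest neighbour in $\eta\setminus\{x\}$, then to its second nearest neighbour, and so on, until $x$ lies in the (geodesic) convex hull of the points it is connected to; that is, $y\in\eta\setminus\{x\}$ belongs to $N(x,\eta)$ if and only if $x$ is not in the convex hull of the points of $\eta\setminus\{x\}$ which are closer to $x$ than $y$. Let $\tilde N(x,\eta)$ be the set of all $y\in\eta$ with $y\in N(x,\eta)$ or $x\in N(y,\eta)$. For $\alpha\ge 0$ and $t\ge 2$ let \[ F_t^{(\alpha)}=\frac12\sum_{x\in\eta\cap B_t}\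 \sum_{y\in\tilde N(x,\eta)} d(x,y)^\alpha . \] Let $\rho(r)=\kappa_d r^d$ in the Euclidean case, where $\kappa_d$ is the volume of the unit ball in $\mathbb{R}^d$, and $\rho(r)=\gamma_d e^{r(d-1)}\mathbf{1}\{r\ge 2\}$ in the hyperbolic case, where $\gamma_d=\inf_{r\ge 2} e^{-r(d-1)}\,\mathrm{vol}(B_r)$ is the largest constant such that $\gamma_d e^{r(d-1)}\le \mathrm{vol}(B_r)$ for all $r\ge 2$. Then for every $\alpha\ge 0$ there is a constant $c>0$, depending only on $\alpha$ and on the choice of $\mathbb{X}^d$, such that for all $t\ge 2$ the random variable $F_t^{(\alpha)}$ is almost surely finite and square-integrable, and \[ \operatorname{Var} F_t^{(\alpha)}\ \ge\ c\,\rho(t)\qquad\text{and}\qquad \operatorname{Var} F_t^{(\alpha)}\ \ge\ c\,\mathrm{vol}(B_t). \] -/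

import Mathlib

open MeasureTheory ProbabilityTheory
open scoped ENNReal

noncomputable section

namespace NNE

/-- The two families of spaces: `ℝ^d` and the hyperbolic space `ℍ^d` of curvature `-1`. -/
inductive SpaceForm where
  | euclidean
  | hyperbolic

/-- Points. A point of `ℝ^d` is given by its Cartesian coordinates. A point of `ℍ^d` is a point
`(√(1 + ‖x‖²), x)` of the upper sheet of the hyperboloid `x₀² - ‖x‖² = 1` in Minkowski space
`ℝ × ℝ^d`, given by its spatial part `x ∈ ℝ^d`, which is arbitrary. The apex of the hyperboloid
is `x = 0`. -/
abbrev Pt (d : ℕ) : Type := EuclideanSpace ℝ (Fin d)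

/-- The time coordinate of the point of the hyperboloid above `x`. -/
def height {d : ℕ} (x : Pt d) : ℝ := Real.sqrt (1 + ‖x‖ ^ 2)

/-- The hyperbolic distance in the hyperboloid model: `cosh d(x,y) = x₀ y₀ - ⟨x, y⟩`. -/
def hypDist {d : ℕ} (x y : Pt d) : ℝ := Real.arcosh (height x * height y - inner ℝ x y)

/-- The hyperbolic Riemannian volume in the hyperboloid model: `dx / x₀`. -/
def hypVol (d : ℕ) : Measure (Pt d) :=
  (volume : Measure (Pt d)).withDensity fun x => ENNReal.ofReal (1 / height x)

/-- The geodesic segment in hyperbolic space from `x` to `y`. -/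
def hypSegment {d : ℕ} (x y : Pt d) : Set (Pt d) :=
  {z | hypDist x z + hypDist z y = hypDist x y}

/-- Geodesic convexity in hyperbolic space. -/
def IsHypConvex {d : ℕ} (C : Set (Pt d)) : Prop :=
  ∀ x ∈ C, ∀ y ∈ C, hypSegment x y ⊆ C

/-- The geodesic convex hull in hyperbolic space. -/
def hypConvexHull {d : ℕ} (S : Set (Pt d)) : Set (Pt d) :=
  ⋂₀ {C | S ⊆ C ∧ IsHypConvex C}

namespace SpaceForm

variable (X : SpaceForm) {d : ℕ}

/-- The Riemannian distance. -/
def dist (x y : Pt d) : ℝ :=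
  match X with
  | euclidean => Dist.dist x y
  | hyperbolic => hypDist x y

/-- The Riemannian volume. -/
def vol (d : ℕ) : Measure (Pt d) :=
  match X with
  | euclidean => volume
  | hyperbolic => hypVol d

/-- The convex hull (geodesic convex hull in the hyperbolic case). -/
def hull (S : Set (Pt d)) : Set (Pt d) :=
  match X with
  | euclidean => convexHull ℝ S
  | hyperbolic => hypConvexHull S

/-- The closed ball `B(x, r)`. -/
def ball (x : Pt d) (r : ℝ) : Set (Pt d) := {y | X.dist x y ≤ r}

end SpaceForm

/-- The volume `κ_d` of the Euclidean unit ball. -/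
def kappa (d : ℕ) : ℝ := (SpaceForm.euclidean.vol d).real (SpaceForm.euclidean.ball 0 1)

/-- The largest `γ` with `γ * exp (r (d - 1)) ≤ vol (B_r)` in hyperbolic space for all `r ≥ 2`. -/
def gammaConst (d : ℕ) : ℝ :=
  ⨅ r : Set.Ici (2 : ℝ),
    (SpaceForm.hyperbolic.vol d).real (SpaceForm.hyperbolic.ball 0 (r : ℝ)) /
      Real.exp ((r : ℝ) * ((d : ℝ) - 1))

/-- The function `ρ`. -/
def rho (X : SpaceForm) (d : ℕ) (r : ℝ) : ℝ :=
  match X with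
  | .euclidean => kappa d * r ^ d
  | .hyperbolic => if 2 ≤ r then gammaConst d * Real.exp (r * ((d : ℝ) - 1)) else 0

/-- The number of points of the random set `η` in `B`. -/
def count {Ω : Type*} {d : ℕ} (η : Ω → Set (Pt d)) (B : Set (Pt d)) (ω : Ω) : ℕ∞ :=
  (η ω ∩ B).encard

/-- `η` is a stationary Poisson process under `P`, that is, a Poisson process
whose intensity measure is the Riemannian volume. As this measure has no atoms, the process is
simple and is regarded as a random locally finite set of points. -/
structure IsPoissonProcess (X : SpaceForm) (d : ℕ) {Ω : Type*} [MeasurableSpace Ω]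
    (P : Measure Ω) (η : Ω → Set (Pt d)) : Prop where
  locallyFinite : ∀ ω x r, (η ω ∩ X.ball x r).Finite
  measurable_count : ∀ B, MeasurableSet B → Measurable (count η B)
  map_count : ∀ B, MeasurableSet B → X.vol d B ≠ ∞ →
    P.map (count η B) = (poissonMeasure (X.vol d B).toNNReal).map (Nat.cast : ℕ → ℕ∞)
  indep_count : ∀ (n : ℕ) (B : Fin n → Set (Pt d)), (∀ i, MeasurableSet (B i)) →
    Pairwise (fun i j => Disjoint (B i) (B j)) → iIndepFun (fun i => count η (B i)) P

section Graph

variable (X : SpaceForm) {d : ℕ}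

/-- The set `N(x, φ)` of outgoing neighbours of `x` in the nearest neighbour embracing graph on
`φ`: going through the other points of `φ` in the order of their distance from `x`, the vertex `x`
is connected to `y` as long as `x` is not yet in the convex hull of the points closer to `x`
than `y`. -/
def outNbrs (φ : Set (Pt d)) (x : Pt d) : Set (Pt d) :=
  {y | y ∈ φ ∧ y ≠ x ∧ x ∉ X.hull {z | z ∈ φ ∧ z ≠ x ∧ X.dist x z < X.dist x y}}

/-- The set of all neighbours of a vertex `x ∈ φ`, outgoing or incoming. -/
def allNbrs (φ : Set (Pt d)) (x : Pt d) : Set (Pt d) :=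
  {y | y ∈ φ ∧ (y ∈ outNbrs X φ x ∨ x ∈ outNbrs X φ y)}

/-- The length-power functional
`F_t^(α) = 1/2 ∑_{x ∈ φ ∩ B(p,t)} ∑_{y neighbour of x} d(x,y)^α` as a sum in `[0, ∞]`. -/
def edgeSum (α : ℝ) (p : Pt d) (t : ℝ) (φ : Set (Pt d)) : ℝ≥0∞ :=
  2⁻¹ * ∑' x : ↥(φ ∩ X.ball p t), ∑' y : ↥(allNbrs X φ (x : Pt d)),
    ENNReal.ofReal (X.dist (x : Pt d) (y : Pt d) ^ α)

end Graph

end NNE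

end

/-!
The variance is bounded from below by testing the functional `F` against local random variables.

*A favourable configuration.* Place a small cluster of points around a point `x`, one in each of
finitely many tiny cells which surround `x` in all directions, and keep the rest of a ball of
radius `5` empty. Passing from the configuration without `x` to the one with `x` removes no edge
and creates an edge of length at least `δ` at `x`. Indeed, in a chart where geodesics are straight
lines (the identity, or the Klein model), every ray from `x` meets the hull of the cluster points
near its direction (`IsCluster.exists_smul_mem`). A far away vertex `u` which sees `x` before one
of its neighbours has therefore already seen points whose hull meets the segment from `x` to `u`,
and so the hull reaches `u` with `x` only if it does so without `x`; the vertices of the cluster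
itself are in convex position (`outNbrs_subset_insert_zero`). Such configurations are the gadgets
of `exists_isGadget`, and they can be transported by motions of the space.

*The test variables.* For a copy of the gadget with core `I`, let `Z` be the indicator of the
event that its cells are occupied as required, multiplied by a function of the number of points in
`I` which compares the values `1` and `0` and has expectation zero (`gadgetTest`). The number of
points in `I` is independent of the process outside `I` (`indep_outsideSigma`). Hence the test
variables of well separated copies are uncorrelated, and `Cov(F, Z)` is at least a positive constant
(`IsGadget.le_integral_mul_gadgetTest`). A maximal separated set of centres provides a number of
copies which is proportional to the volume of the window, and expanding `Var (F - l ∑ Z) ≥ 0` for a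
suitable `l` gives the bound (`card_mul_le_variance`).

*Square-integrability.* Close to a point at which all of the `2 ^ d` sectors of a ball of radius
`r` contain points, there are no out-edges of length much more than `r` (`dist_le_of_sectors`). The
probability that this fails somewhere in the part of the space which matters at scale `n` decays
exponentially in the volume of the ball of radius `n`. If it does not fail at any scale from `n`
on, then the functional is bounded through the number of points in a ball of radius comparable
to `n`, which has moments that are polynomial in the volume. Summation over `n` with the
Cauchy–Schwarz inequality gives a finite second moment (`lintegral_edgeSum_sq_ne_top`).

Both spaces are treated at once through the properties they share: a chart with straight
geodesics, volume-preserving motions which act transitively, and distances from the origin that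
are increasing functions of the norm. In the hyperboloid model the motions are Lorentz boosts.
-/

/-! ### The hyperboloid model -/

namespace NNE

variable {d : ℕ}

lemma height_sq (x : Pt d) : height x ^ 2 = 1 + ‖x‖ ^ 2 := by
  rw [height, Real.sq_sqrt (by positivity)]

lemma one_le_height (x : Pt d) : 1 ≤ height x := by
  rw [height]; exact Real.one_le_sqrt.2 (by nlinarith [sq_nonneg ‖x‖])

lemma height_pos (x : Pt d) : 0 < height x := lt_of_lt_of_le one_pos (one_le_height x)

@[simp] lemma height_zero : height (0 : Pt d) = 1 := by simp [height]

lemma norm_lt_height (x : Pt d) : ‖x‖ < height x := by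
  have := height_sq x
  have := height_pos x
  nlinarith [norm_nonneg x]

lemma height_eq_of_sq {x : Pt d} {a : ℝ} (ha : 0 ≤ a) (h : a ^ 2 = 1 + ‖x‖ ^ 2) :
    height x = a := by
  rw [height, ← h, Real.sqrt_sq ha]

lemma height_neg (x : Pt d) : height (-x) = height x := by simp [height]

lemma continuous_height : Continuous (height : Pt d → ℝ) := by
  unfold height; fun_prop

/-- The Minkowski product `x₀ y₀ - ⟨x, y⟩` of two points of the hyperboloid. -/
noncomputable def mink (x y : Pt d) : ℝ := height x * height y - inner ℝ x y

lemma hypDist_eq (x y : Pt d) : hypDist x y = Real.arcosh (mink x y) := rfl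

lemma mink_comm (x y : Pt d) : mink x y = mink y x := by
  rw [mink, mink, real_inner_comm, mul_comm]

@[simp] lemma mink_zero_right (x : Pt d) : mink x 0 = height x := by simp [mink]

@[simp] lemma mink_zero_left (x : Pt d) : mink 0 x = height x := by simp [mink]

/-- The hyperbolic isometry (Lorentz boost) moving the apex `0` to `p`. -/
noncomputable def boost (p x : Pt d) : Pt d :=
  x + (height x + inner ℝ p x / (1 + height p)) • p

@[simp] lemma boost_apply_zero (p : Pt d) : boost p 0 = p := by simp [boost]

lemma norm_sq_eq (p : Pt d) : ‖p‖ ^ 2 = (height p - 1) * (1 + height p) := by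
  have := height_sq p; nlinarith

lemma inner_boost (p x : Pt d) :
    inner ℝ p (boost p x) = height p * inner ℝ p x + height x * ‖p‖ ^ 2 := by
  have h : (1 + height p) ≠ 0 := by have := height_pos p; positivity
  simp only [boost, inner_add_right, inner_smul_right, real_inner_self_eq_norm_sq]
  rw [norm_sq_eq]
  field_simp
  ring

lemma inner_boost_boost (p x y : Pt d) :
    inner ℝ (boost p x) (boost p y) =
      (height p * height x + inner ℝ p x) * (height p * height y + inner ℝ p y) - mink x y := by
  have h : (1 + height p) ≠ 0 := by have := height_pos p; positivity
  simp only [boost, inner_add_right, inner_smul_right, inner_add_left, inner_smul_left,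
    real_inner_self_eq_norm_sq, mink, RCLike.conj_to_real]
  rw [norm_sq_eq, real_inner_comm p x]
  field_simp
  ring

lemma height_boost (p x : Pt d) :
    height (boost p x) = height p * height x + inner ℝ p x := by
  apply height_eq_of_sq
  · have h1 := abs_real_inner_le_norm p x
    have h2 := norm_lt_height p
    have h3 := norm_lt_height x
    have h4 : ‖p‖ * ‖x‖ ≤ height p * height x :=
      mul_le_mul h2.le h3.le (norm_nonneg _) (height_pos _).le
    have := neg_abs_le (inner ℝ p x)
    linarith
  · rw [← real_inner_self_eq_norm_sq, inner_boost_boost, mink, real_inner_self_eq_norm_sq]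
    have := height_sq x
    linear_combination this

lemma mink_boost (p x y : Pt d) : mink (boost p x) (boost p y) = mink x y := by
  rw [mink, height_boost, height_boost, inner_boost_boost]; ring

lemma boost_neg_boost (p x : Pt d) : boost (-p) (boost p x) = x := by
  have h : (1 + height p) ≠ 0 := by have := height_pos p; positivity
  have e : height (boost p x) + inner ℝ (-p) (boost p x) / (1 + height (-p)) =
      height x + inner ℝ p x / (1 + height p) := by
    rw [height_boost, inner_neg_left, inner_boost, height_neg, norm_sq_eq]
    field_simp
    ring
  rw [boost, e, boost]
  simp

lemma boost_boost_neg (p x : Pt d) : boost p (boost (-p) x) = x := by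
  have := boost_neg_boost (-p) x
  rwa [neg_neg] at this

lemma hypDist_boost (p x y : Pt d) : hypDist (boost p x) (boost p y) = hypDist x y := by
  rw [hypDist_eq, hypDist_eq, mink_boost]

/-- Moving `p` to the apex. -/
lemma mink_eq_height (p x : Pt d) : mink p x = height (boost (-p) x) := by
  rw [← mink_boost (-p) p x]
  have : boost (-p) p = 0 := by
    conv_lhs => rw [← boost_apply_zero p]
    rw [boost_apply_zero, ← boost_neg_boost p 0, boost_apply_zero]
  rw [this, mink_zero_left]

lemma boost_neg_self (p : Pt d) : boost (-p) p = 0 := by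
  have := boost_neg_boost p 0
  rwa [boost_apply_zero] at this

lemma one_le_mink (x y : Pt d) : 1 ≤ mink x y := by
  rw [mink_eq_height]; exact one_le_height _

lemma hypDist_nonneg (x y : Pt d) : 0 ≤ hypDist x y := Real.arcosh_nonneg (one_le_mink x y)

lemma hypDist_comm (x y : Pt d) : hypDist x y = hypDist y x := by
  rw [hypDist_eq, hypDist_eq, mink_comm]

lemma cosh_hypDist (x y : Pt d) : Real.cosh (hypDist x y) = mink x y :=
  Real.cosh_arcosh (one_le_mink x y)

lemma hypDist_lt_iff {x y z w : Pt d} : hypDist x y < hypDist z w ↔ mink x y < mink z w :=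
  Real.arcosh_lt_arcosh (lt_of_lt_of_le one_pos (one_le_mink _ _))
    (lt_of_lt_of_le one_pos (one_le_mink _ _))

lemma cosh_hypDist_zero (x : Pt d) : Real.cosh (hypDist 0 x) = height x := by
  rw [cosh_hypDist, mink_zero_left]

lemma sinh_hypDist_zero (x : Pt d) : Real.sinh (hypDist 0 x) = ‖x‖ := by
  have h1 := Real.cosh_sq (hypDist 0 x)
  rw [cosh_hypDist_zero, height_sq] at h1
  have h2 : 0 ≤ Real.sinh (hypDist 0 x) := Real.sinh_nonneg_iff.2 (hypDist_nonneg _ _)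
  have h3 : Real.sinh (hypDist 0 x) ^ 2 = ‖x‖ ^ 2 := by linarith
  exact (sq_eq_sq₀ h2 (norm_nonneg _)).1 h3

lemma hypDist_zero (x : Pt d) : hypDist 0 x = Real.arsinh ‖x‖ := by
  rw [← sinh_hypDist_zero, Real.arsinh_sinh]

lemma cosh_add_hypDist_zero (x y : Pt d) :
    Real.cosh (hypDist x 0 + hypDist 0 y) = height x * height y + ‖x‖ * ‖y‖ := by
  rw [Real.cosh_add, hypDist_comm x 0, cosh_hypDist_zero, cosh_hypDist_zero, sinh_hypDist_zero,
    sinh_hypDist_zero]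

lemma hypDist_triangle_zero (x y : Pt d) : hypDist x y ≤ hypDist x 0 + hypDist 0 y := by
  rw [← abs_of_nonneg (hypDist_nonneg x y),
    ← abs_of_nonneg (add_nonneg (hypDist_nonneg x 0) (hypDist_nonneg 0 y)), ← Real.cosh_le_cosh,
    cosh_add_hypDist_zero, cosh_hypDist, mink]
  have := neg_abs_le (inner ℝ x y)
  have := abs_real_inner_le_norm x y
  linarith

lemma hypDist_triangle (x z y : Pt d) : hypDist x y ≤ hypDist x z + hypDist z y := by
  have := hypDist_triangle_zero (boost (-z) x) (boost (-z) y)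
  rw [← boost_neg_self z] at this
  simpa only [hypDist_boost] using this

lemma hypDist_eq_zero {x y : Pt d} : hypDist x y = 0 ↔ x = y := by
  constructor
  · intro h
    have h1 : hypDist 0 (boost (-x) y) = 0 := by
      rw [← boost_neg_self x, hypDist_boost, h]
    have h2 := sinh_hypDist_zero (boost (-x) y)
    rw [h1, Real.sinh_zero] at h2
    have h3 : boost (-x) y = 0 := norm_eq_zero.1 h2.symm
    rw [← boost_boost_neg x y, h3, boost_apply_zero]
  · rintro rfl
    rw [hypDist_eq, Real.arcosh_eq_zero_iff (one_le_mink _ _), mink_eq_height, boost_neg_self,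
      height_zero]

lemma continuous_mink : Continuous fun q : Pt d × Pt d => mink q.1 q.2 := by
  unfold mink
  have := continuous_height (d := d)
  fun_prop

lemma continuous_hypDist : Continuous fun q : Pt d × Pt d => hypDist q.1 q.2 := by
  simp only [hypDist_eq]
  exact Real.continuousOn_arcosh.comp_continuous continuous_mink fun q => one_le_mink _ _

lemma continuous_boost : Continuous fun q : Pt d × Pt d => boost q.1 q.2 := by
  have := continuous_height (d := d)
  have h : ∀ q : Pt d × Pt d, 1 + height q.1 ≠ 0 := fun q => by
    have := height_pos q.1; positivity
  unfold boost
  fun_prop (disch := exact h _)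

/-- A segment passes through the apex if and only if its end points are antiparallel. -/
lemma zero_mem_hypSegment_iff (x y : Pt d) :
    0 ∈ hypSegment x y ↔ ‖y‖ • x + ‖x‖ • y = 0 := by
  rw [hypSegment, Set.mem_ofPred_eq]
  have h1 : hypDist x 0 + hypDist 0 y = hypDist x y ↔
      Real.cosh (hypDist x 0 + hypDist 0 y) = Real.cosh (hypDist x y) := by
    constructor
    · intro h; rw [h]
    · intro h
      exact Real.cosh_injOn (Set.mem_Ici.2 (add_nonneg (hypDist_nonneg x 0) (hypDist_nonneg 0 y)))
        (Set.mem_Ici.2 (hypDist_nonneg x y)) h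
  have h2 : ‖‖y‖ • x + ‖x‖ • y‖ ^ 2 = 2 * (‖x‖ * ‖y‖) * (‖x‖ * ‖y‖ + inner ℝ x y) := by
    rw [norm_add_sq_real, norm_smul, norm_smul, inner_smul_left, inner_smul_right, norm_norm,
      norm_norm]
    simp only [RCLike.conj_to_real]
    ring
  rw [h1, cosh_add_hypDist_zero, cosh_hypDist, mink, ← norm_eq_zero, ← sq_eq_zero_iff, h2]
  constructor
  · intro h
    have : ‖x‖ * ‖y‖ + inner ℝ x y = 0 := by linarith
    rw [this, mul_zero]
  · intro h
    rcases mul_eq_zero.1 h with h | h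
    · have h3 : ‖x‖ * ‖y‖ = 0 := by linarith
      have h4 := abs_real_inner_le_norm x y
      rw [h3] at h4
      have h5 := abs_nonpos_iff.1 h4
      rw [h3, h5]; ring
    · linarith

/-- The Klein (projective) coordinates of a point of the hyperboloid, in the open unit ball. -/
noncomputable def klein (x : Pt d) : Pt d := (height x)⁻¹ • x

lemma height_smul_klein (x : Pt d) : height x • klein x = x := by
  rw [klein, smul_smul, mul_inv_cancel₀ (height_pos x).ne', one_smul]

lemma norm_klein (x : Pt d) : ‖klein x‖ = ‖x‖ / height x := by
  rw [klein, norm_smul, norm_inv, Real.norm_of_nonneg (height_pos x).le]; ring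

lemma norm_klein_lt_one (x : Pt d) : ‖klein x‖ < 1 := by
  rw [norm_klein, div_lt_one (height_pos x)]; exact norm_lt_height x

lemma height_sq_mul (x : Pt d) : height x ^ 2 * (1 - ‖klein x‖ ^ 2) = 1 := by
  have h := height_sq x
  have h0 := (height_pos x).ne'
  rw [norm_klein]
  field_simp
  linarith

lemma klein_injective : Function.Injective (klein : Pt d → Pt d) := by
  intro x y h
  have hx := height_sq_mul x
  have hy := height_sq_mul y
  rw [← h] at hy
  have h0 : (1 - ‖klein x‖ ^ 2) ≠ 0 := fun h0 => by rw [h0] at hx; simp at hx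
  have h1 : height x ^ 2 = height y ^ 2 := mul_right_cancel₀ h0 (hx.trans hy.symm)
  have h2 : height x = height y := (sq_eq_sq₀ (height_pos _).le (height_pos _).le).1 h1
  rw [← height_smul_klein x, h, h2, height_smul_klein]

lemma klein_surjOn {k : Pt d} (hk : ‖k‖ < 1) : ∃ x, klein x = k := by
  have h1 : 0 < 1 - ‖k‖ ^ 2 := by nlinarith [norm_nonneg k]
  set s := Real.sqrt (1 - ‖k‖ ^ 2) with hs
  have s0 : 0 < s := Real.sqrt_pos.2 h1
  have s2 : s ^ 2 = 1 - ‖k‖ ^ 2 := Real.sq_sqrt h1.le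
  refine ⟨s⁻¹ • k, ?_⟩
  have h2 : height (s⁻¹ • k) = s⁻¹ := by
    apply height_eq_of_sq (by positivity)
    rw [norm_smul, Real.norm_of_nonneg (by positivity)]
    field_simp
    linarith
  rw [klein, h2, inv_inv, smul_smul, mul_inv_cancel₀ s0.ne', one_smul]

lemma continuous_klein : Continuous (klein : Pt d → Pt d) := by
  unfold klein
  exact (continuous_height.inv₀ fun x => (height_pos x).ne').smul continuous_id

/-- A linear relation between points of the hyperboloid, split into the time coordinate and the
spatial part, is preserved by a boost. -/
lemma boost_linear_relation {p x y z : Pt d} {a b c : ℝ}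
    (h : a • x + b • y = c • z) (h' : a * height x + b * height y = c * height z) :
    a • boost p x + b • boost p y = c • boost p z ∧
      a * height (boost p x) + b * height (boost p y) = c * height (boost p z) := by
  have h2 : a * inner ℝ p x + b * inner ℝ p y = c * inner ℝ p z := by
    have := congrArg (fun v => inner ℝ p v) h
    simpa only [inner_add_right, inner_smul_right] using this
  constructor
  · have e : a • boost p x + b • boost p y =
        (a • x + b • y) + ((a * height x + b * height y) +
          (a * inner ℝ p x + b * inner ℝ p y) / (1 + height p)) • p := by
      simp only [boost]; module
    rw [e, h, h', h2, boost]
    module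
  · rw [height_boost, height_boost, height_boost]
    linear_combination height p * h' + h2

/-- In Klein coordinates, geodesic segments are straight. -/
lemma mem_hypSegment_iff (x y z : Pt d) :
    z ∈ hypSegment x y ↔ klein z ∈ segment ℝ (klein x) (klein y) := by
  have h0 : z ∈ hypSegment x y ↔ 0 ∈ hypSegment (boost (-z) x) (boost (-z) y) := by
    simp only [hypSegment, Set.mem_ofPred_eq]
    rw [← boost_neg_self z]; simp only [hypDist_boost]
  rw [h0, zero_mem_hypSegment_iff]
  have hx := height_pos x
  have hy := height_pos y
  have hz := height_pos z
  constructor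
  · intro h
    set x' := boost (-z) x with hx'
    set y' := boost (-z) y with hy'
    have key : ∃ a b c : ℝ, 0 ≤ a ∧ 0 ≤ b ∧ 0 < a + b ∧ a • x' + b • y' = c • (0 : Pt d) ∧
        a * height x' + b * height y' = c * height (0 : Pt d) := by
      rcases (add_nonneg (norm_nonneg x') (norm_nonneg y')).eq_or_lt with h1 | h1
      · have h2 : ‖x'‖ = 0 := by linarith [norm_nonneg x', norm_nonneg y']
        have h3 : x' = 0 := norm_eq_zero.1 h2
        exact ⟨1, 0, height x', zero_le_one, le_rfl, by norm_num, by simp [h3], by simp⟩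
      · exact ⟨‖y'‖, ‖x'‖, ‖y'‖ * height x' + ‖x'‖ * height y', norm_nonneg _, norm_nonneg _,
          by linarith, by simpa using h, by simp⟩
    obtain ⟨a, b, c, ha, hb, hab, h1, h2⟩ := key
    obtain ⟨h3, h4⟩ := boost_linear_relation (p := z) h1 h2
    rw [hx', hy', boost_boost_neg, boost_boost_neg, boost_apply_zero] at h3 h4
    have hc : 0 < c * height z := by
      rw [← h4]
      rcases ha.eq_or_lt with h5 | h5
      · have : 0 < b := by linarith
        rw [← h5]; positivity
      · positivity
    have hc' : 0 < c := pos_of_mul_pos_left hc hz.le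
    refine ⟨a * height x / (c * height z), b * height y / (c * height z), by positivity,
      by positivity, ?_, ?_⟩
    · rw [← add_div, h4, div_self hc.ne']
    · have : klein z = (c * height z)⁻¹ • (c • z) := by
        rw [klein, smul_smul]; congr 1; field_simp
      rw [this, ← h3, klein, klein, smul_add, smul_smul, smul_smul, smul_smul, smul_smul]
      congr 2 <;> field_simp
  · rintro ⟨l, m, hl, hm, hlm, h⟩
    have h1 : (l / height x) • x + (m / height y) • y = (height z)⁻¹ • z := by
      rw [← klein, ← h, klein, klein, smul_smul, smul_smul, div_eq_mul_inv, div_eq_mul_inv]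
    have h2 : l / height x * height x + m / height y * height y = (height z)⁻¹ * height z := by
      field_simp; linarith
    obtain ⟨h3, h4⟩ := boost_linear_relation (p := -z) h1 h2
    rw [boost_neg_self, smul_zero] at h3
    set x' := boost (-z) x
    set y' := boost (-z) y
    have ha : 0 ≤ l / height x := by positivity
    have hb : 0 ≤ m / height y := by positivity
    generalize l / height x = a at *
    generalize m / height y = b at *
    have h5 : a • x' = -(b • y') := eq_neg_of_add_eq_zero_left h3
    have h6 : a * ‖x'‖ = b * ‖y'‖ := by
      have := congrArg norm h5
      rwa [norm_neg, norm_smul, norm_smul, Real.norm_of_nonneg ha, Real.norm_of_nonneg hb] at this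
    have hab : a + b ≠ 0 := by
      intro h7
      have ha0 : a = 0 := by linarith
      have hb0 : b = 0 := by linarith
      rw [ha0, hb0] at h2
      rw [inv_mul_cancel₀ hz.ne'] at h2
      simp at h2
    have h8 : (a + b) • (‖y'‖ • x' + ‖x'‖ • y') = 0 := by
      have e1 : (a + b) • (‖y'‖ • x' + ‖x'‖ • y') =
          ‖y'‖ • (a • x') + (b * ‖y'‖) • x' + (a * ‖x'‖) • y' + ‖x'‖ • (b • y') := by module
      rw [e1, ← h6]
      rw [h6]
      have e2 : b • y' = -(a • x') := by rw [h5, neg_neg]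
      have e3 : (b * ‖y'‖) • y' = -(‖y'‖ • (a • x')) := by
        rw [mul_comm, mul_smul, e2, smul_neg]
      have e4 : (a * ‖x'‖) • x' = -(‖x'‖ • (b • y')) := by
        rw [mul_comm, mul_smul, h5, smul_neg]
      rw [e3, ← h6, e4]
      abel
    exact (smul_eq_zero.1 h8).resolve_left hab

/-- In Klein coordinates, geodesic convex hulls are the ordinary convex hulls. -/
lemma mem_hypConvexHull_iff (S : Set (Pt d)) (x : Pt d) :
    x ∈ hypConvexHull S ↔ klein x ∈ convexHull ℝ (klein '' S) := by
  constructor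
  · intro h
    refine h (klein ⁻¹' convexHull ℝ (klein '' S)) ⟨fun y hy => subset_convexHull ℝ _ ⟨y, hy, rfl⟩, ?_⟩
    intro y hy z hz w hw
    exact (convex_convexHull ℝ (klein '' S)).segment_subset hy hz ((mem_hypSegment_iff _ _ _).1 hw)
  · rintro h C ⟨hSC, hC⟩
    have h1 : Convex ℝ (klein '' C) := by
      rw [convex_iff_segment_subset]
      rintro _ ⟨y, hy, rfl⟩ _ ⟨z, hz, rfl⟩ k hk
      have hk1 : ‖k‖ < 1 := by
        have := (convex_ball (0 : Pt d) 1).segment_subset (mem_ball_zero_iff.2 (norm_klein_lt_one y))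
          (mem_ball_zero_iff.2 (norm_klein_lt_one z)) hk
        exact mem_ball_zero_iff.1 this
      obtain ⟨w, rfl⟩ := klein_surjOn hk1
      exact ⟨w, hC y hy z hz ((mem_hypSegment_iff _ _ _).2 hk), rfl⟩
    obtain ⟨y, hy, hyx⟩ := convexHull_min (Set.image_mono hSC) h1 h
    rwa [← klein_injective hyx]

end NNE

/-! ### Invariance of the hyperbolic volume -/

namespace NNE

variable {d : ℕ}

lemma hasFDerivAt_height (x : Pt d) :
    HasFDerivAt (height : Pt d → ℝ) ((height x)⁻¹ • innerSL ℝ x) x := by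
  have h1 : HasFDerivAt (fun y : Pt d => 1 + ‖y‖ ^ 2) (2 • innerSL ℝ x) x :=
    (hasStrictFDerivAt_norm_sq x).hasFDerivAt.const_add 1
  have h2 := h1.sqrt (by positivity)
  have e : (1 / (2 * Real.sqrt (1 + ‖x‖ ^ 2))) • (2 • innerSL ℝ x) = (height x)⁻¹ • innerSL ℝ x := by
    rw [← Nat.cast_smul_eq_nsmul ℝ, smul_smul, height]
    congr 1
    push_cast
    have : Real.sqrt (1 + ‖x‖ ^ 2) ≠ 0 := (height_pos x).ne'
    field_simp
  rw [e] at h2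
  exact h2

/-- The linear form whose rank-one perturbation of the identity is the derivative of a boost. -/
noncomputable def boostForm (p x : Pt d) : Pt d →L[ℝ] ℝ :=
  (height x)⁻¹ • innerSL ℝ x + (1 + height p)⁻¹ • innerSL ℝ p

lemma hasFDerivAt_boost (p x : Pt d) :
    HasFDerivAt (boost p) (ContinuousLinearMap.id ℝ (Pt d) + (boostForm p x).smulRight p) x := by
  have h1 : HasFDerivAt (fun y : Pt d => height y + inner ℝ p y / (1 + height p))
      (boostForm p x) x := by
    refine (hasFDerivAt_height x).add ?_
    have h2 : HasFDerivAt (fun y : Pt d => inner ℝ p y) (innerSL ℝ p) x :=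
      (innerSL ℝ p).hasFDerivAt
    have := h2.const_smul ((1 + height p)⁻¹)
    refine this.congr_of_eventuallyEq (Filter.Eventually.of_forall fun y => ?_)
    simp [div_eq_inv_mul]
  exact (hasFDerivAt_id x).add (h1.smul_const p)

lemma det_boost (p x : Pt d) :
    (ContinuousLinearMap.id ℝ (Pt d) + (boostForm p x).smulRight p).det =
      height (boost p x) / height x := by
  have h1 : (ContinuousLinearMap.id ℝ (Pt d) + (boostForm p x).smulRight p).det =
      LinearMap.det (LinearMap.transvection (boostForm p x : Pt d →ₗ[ℝ] ℝ) p) := by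
    rw [ContinuousLinearMap.det]
    congr 1
  rw [h1, LinearMap.transvection.det, height_boost]
  have h2 := height_pos x
  have h3 : 1 + height p ≠ 0 := by have := height_pos p; positivity
  have h4 : (boostForm p x : Pt d →ₗ[ℝ] ℝ) p =
      (height x)⁻¹ * inner ℝ p x + (1 + height p)⁻¹ * ‖p‖ ^ 2 := by
    simp [boostForm, real_inner_comm]
  rw [h4, norm_sq_eq]
  field_simp
  ring

lemma measurePreserving_boost (p : Pt d) : MeasurePreserving (boost p) (hypVol d) (hypVol d) := by
  have hc : Continuous (boost p : Pt d → Pt d) :=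
    continuous_boost.comp (Continuous.prodMk_right p)
  have hm : Measurable (boost p : Pt d → Pt d) := hc.measurable
  refine ⟨hm, ?_⟩
  ext B hB
  rw [Measure.map_apply hm hB, hypVol, withDensity_apply _ hB, withDensity_apply _ (hm hB)]
  have himg : boost p '' (boost p ⁻¹' B) = B :=
    Set.image_preimage_eq B fun x => ⟨boost (-p) x, boost_boost_neg p x⟩
  conv_rhs => rw [← himg]
  rw [lintegral_image_eq_lintegral_abs_det_fderiv_mul volume (hm hB)
    (fun x _ => (hasFDerivAt_boost p x).hasFDerivWithinAt)
    (fun x _ y _ h => by rw [← boost_neg_boost p x, h, boost_neg_boost])]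
  refine lintegral_congr fun x => ?_
  rw [det_boost, ← ENNReal.ofReal_mul (abs_nonneg _)]
  congr 1
  have h1 := height_pos x
  have h2 := height_pos (boost p x)
  rw [abs_of_pos (by positivity)]
  field_simp

/-! ### Common properties of the two spaces -/

namespace SpaceForm

variable (X : SpaceForm)

/-- Coordinates in which geodesic segments are straight: Cartesian coordinates in `ℝ^d`, the Klein
model in `ℍ^d`. -/
noncomputable def chart (x : Pt d) : Pt d :=
  match X with
  | euclidean => x
  | hyperbolic => klein x

/-- The standard isometry taking the origin to `p`: a translation or a boost. -/
noncomputable def move (p x : Pt d) : Pt d :=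
  match X with
  | euclidean => p + x
  | hyperbolic => boost p x

/-- The distance from the origin of a point of coordinate norm `r`. -/
noncomputable def rad (r : ℝ) : ℝ :=
  match X with
  | euclidean => r
  | hyperbolic => Real.arsinh r

/-- The density of the volume with respect to Lebesgue measure, as a function of the coordinate
norm. -/
noncomputable def dens (r : ℝ) : ℝ≥0∞ :=
  match X with
  | euclidean => 1
  | hyperbolic => ENNReal.ofReal (1 / Real.sqrt (1 + r ^ 2))

lemma dist_comm (x y : Pt d) : X.dist x y = X.dist y x := by
  cases X
  exacts [_root_.dist_comm x y, hypDist_comm x y]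

lemma dist_nonneg (x y : Pt d) : 0 ≤ X.dist x y := by
  cases X
  exacts [_root_.dist_nonneg, hypDist_nonneg x y]

lemma dist_triangle (x y z : Pt d) : X.dist x z ≤ X.dist x y + X.dist y z := by
  cases X
  exacts [_root_.dist_triangle x y z, hypDist_triangle x y z]

lemma dist_eq_zero {x y : Pt d} : X.dist x y = 0 ↔ x = y := by
  cases X
  exacts [_root_.dist_eq_zero, hypDist_eq_zero]

@[simp] lemma dist_self (x : Pt d) : X.dist x x = 0 := X.dist_eq_zero.2 rfl

lemma continuous_dist : Continuous fun q : Pt d × Pt d => X.dist q.1 q.2 := by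
  cases X
  exacts [_root_.continuous_dist, continuous_hypDist]

lemma continuous_dist_left (x : Pt d) : Continuous fun y => X.dist x y := by
  have h : Continuous fun y : Pt d => (x, y) := by fun_prop
  have h' := X.continuous_dist.comp h
  simpa only [Function.comp_def] using h'

lemma mem_hull_iff (S : Set (Pt d)) (x : Pt d) :
    x ∈ X.hull S ↔ X.chart x ∈ convexHull ℝ (X.chart '' S) := by
  cases X
  · have : (euclidean.chart : Pt d → Pt d) = id := rfl
    rw [this, Set.image_id]; rfl
  · exact mem_hypConvexHull_iff S x

lemma hull_mono {S T : Set (Pt d)} (h : S ⊆ T) : X.hull S ⊆ X.hull T := fun x hx => by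
  rw [mem_hull_iff] at hx ⊢
  exact convexHull_mono (Set.image_mono h) hx

lemma continuous_chart : Continuous (X.chart : Pt d → Pt d) := by
  cases X
  exacts [continuous_id, continuous_klein]

@[simp] lemma chart_zero : X.chart (0 : Pt d) = 0 := by
  cases X
  · rfl
  · simp [chart, klein]

lemma continuous_move : Continuous fun q : Pt d × Pt d => X.move q.1 q.2 := by
  cases X
  · exact continuous_add
  · exact continuous_boost

@[simp] lemma move_apply_zero (p : Pt d) : X.move p 0 = p := by
  cases X
  exacts [add_zero p, boost_apply_zero p]

@[simp] lemma move_zero (x : Pt d) : X.move 0 x = x := by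
  cases X
  · exact zero_add x
  · simp [move, boost]

lemma move_neg_move (p x : Pt d) : X.move (-p) (X.move p x) = x := by
  cases X
  · simp [move]
  · exact boost_neg_boost p x

lemma move_move_neg (p x : Pt d) : X.move p (X.move (-p) x) = x := by
  cases X
  · simp [move]
  · exact boost_boost_neg p x

lemma dist_move (p x y : Pt d) : X.dist (X.move p x) (X.move p y) = X.dist x y := by
  cases X
  · simp [move, dist]
  · exact hypDist_boost p x y

lemma dist_zero (x : Pt d) : X.dist 0 x = X.rad ‖x‖ := by
  cases X
  · simp [dist, rad]
  · exact hypDist_zero x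

lemma rad_strictMono : StrictMono X.rad := by
  cases X
  exacts [strictMono_id, Real.arsinh_strictMono]

lemma rad_surjective : Function.Surjective X.rad := by
  cases X
  exacts [Function.surjective_id, Real.arsinh_surjective]

@[simp] lemma rad_zero : X.rad 0 = 0 := by
  cases X
  exacts [rfl, Real.arsinh_zero]

lemma vol_eq : X.vol d = (volume : Measure (Pt d)).withDensity fun x => X.dens ‖x‖ := by
  cases X
  · simp [vol, dens]
  · rfl

lemma measurable_dens : Measurable X.dens := by
  cases X
  · exact measurable_const
  · unfold dens; fun_prop

lemma dens_pos (r : ℝ) : 0 < X.dens r := by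
  cases X
  · simp [dens]
  · simp only [dens, ENNReal.ofReal_pos]; positivity

lemma dens_le_one (r : ℝ) : X.dens r ≤ 1 := by
  cases X
  · exact le_rfl
  · simp only [dens]
    rw [ENNReal.ofReal_le_one, div_le_one (by positivity)]
    exact Real.one_le_sqrt.2 (by nlinarith [sq_nonneg r])

lemma vol_le (B : Set (Pt d)) : X.vol d B ≤ volume B := by
  rw [vol_eq]
  calc _ ≤ (volume : Measure (Pt d)).withDensity 1 B :=
        (withDensity_mono (Filter.Eventually.of_forall fun x => X.dens_le_one ‖x‖)) B
    _ = _ := by rw [withDensity_one]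

lemma vol_pos_of_isOpen {U : Set (Pt d)} (hU : IsOpen U) (h : U.Nonempty) : 0 < X.vol d U := by
  have h1 : volume U ≠ 0 := (hU.measure_pos volume h).ne'
  rw [pos_iff_ne_zero, vol_eq]
  intro h2
  rw [withDensity_apply_eq_zero (by have := X.measurable_dens; fun_prop)] at h2
  apply h1
  rw [← h2]
  congr 1
  ext x
  simp [(X.dens_pos ‖x‖).ne']

lemma measurePreserving_move (p : Pt d) :
    MeasurePreserving (X.move p) (X.vol d) (X.vol d) := by
  cases X
  · exact measurePreserving_add_left volume p
  · exact measurePreserving_boost p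

lemma move_mem_hull {p x : Pt d} {S : Set (Pt d)} (h : x ∈ X.hull S) :
    X.move p x ∈ X.hull (X.move p '' S) := by
  cases X
  · have e : (euclidean.move p : Pt d → Pt d) = ⇑(AffineMap.const ℝ (Pt d) p + AffineMap.id ℝ (Pt d)) := by
      ext x; simp [move]
    have := AffineMap.image_convexHull (AffineMap.const ℝ (Pt d) p + AffineMap.id ℝ (Pt d)) S
    rw [← e] at this
    simp only [hull] at h ⊢
    rw [← this]
    exact ⟨x, h, rfl⟩
  · intro C hC
    have hC' : x ∈ boost p ⁻¹' C := by
      refine h _ ⟨fun y hy => hC.1 ⟨y, hy, rfl⟩, ?_⟩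
      intro y hy z hz w hw
      refine hC.2 _ hy _ hz ?_
      simp only [hypSegment, Set.mem_ofPred_eq, hypDist_boost] at hw ⊢
      exact hw
    exact hC'

/-- Points at any smaller distance from the origin lie on the geodesic from the origin. -/
lemma exists_radial (x : Pt d) {s : ℝ} (hs : 0 ≤ s) (hsx : s ≤ X.dist 0 x) :
    ∃ y, X.dist 0 y = s ∧ X.dist y x = X.dist 0 x - s := by
  obtain ⟨r, hr⟩ := X.rad_surjective s
  have hr0 : 0 ≤ r := by
    rw [← X.rad_strictMono.le_iff_le, rad_zero, hr]; exact hs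
  have hrx : r ≤ ‖x‖ := by
    rw [← X.rad_strictMono.le_iff_le, hr, ← dist_zero]; exact hsx
  rcases hr0.eq_or_lt with h0 | h0
  · have hs0 : s = 0 := by rw [← hr, ← h0, rad_zero]
    exact ⟨0, by simp [hs0], by simp [hs0]⟩
  have hx : 0 < ‖x‖ := h0.trans_le hrx
  set y : Pt d := (r / ‖x‖) • x with hy
  have hyn : ‖y‖ = r := by
    rw [hy, norm_smul, Real.norm_of_nonneg (by positivity)]; field_simp
  refine ⟨y, by rw [dist_zero, hyn, hr], ?_⟩
  cases X
  · simp only [dist, rad] at *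
    rw [dist_eq_norm, hy, dist_zero_left, ← hr]
    have : (r / ‖x‖) • x - x = -((1 - r / ‖x‖) • x) := by module
    rw [this, norm_neg, norm_smul, Real.norm_of_nonneg]
    · field_simp
    · rw [sub_nonneg, div_le_one hx]; exact hrx
  · have hi : inner ℝ y x = ‖y‖ * ‖x‖ := by
      rw [hyn, hy, inner_smul_left, real_inner_self_eq_norm_sq]
      simp only [RCLike.conj_to_real]; field_simp
    have h1 : hypDist y x = hypDist 0 x - hypDist 0 y := by
      have h2 : 0 ≤ hypDist 0 x - hypDist 0 y := by
        have : hypDist 0 y = s := by rw [hypDist_zero, hyn]; exact hr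
        rw [this]; exact sub_nonneg.2 hsx
      refine Real.cosh_injOn (Set.mem_Ici.2 (hypDist_nonneg y x)) (Set.mem_Ici.2 h2) ?_
      rw [Real.cosh_sub, cosh_hypDist_zero, cosh_hypDist_zero, sinh_hypDist_zero,
        sinh_hypDist_zero, cosh_hypDist, mink, hi]
      ring
    have h2 : hypDist 0 y = s := by rw [hypDist_zero, hyn]; exact hr
    simp only [dist]
    rw [h1, h2]

lemma mem_ball {x y : Pt d} {r : ℝ} : y ∈ X.ball x r ↔ X.dist x y ≤ r := Iff.rfl

lemma isClosed_ball (x : Pt d) (r : ℝ) : IsClosed (X.ball x r) :=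
  _root_.isClosed_le (X.continuous_dist_left x) continuous_const

lemma measurableSet_ball (x : Pt d) (r : ℝ) : MeasurableSet (X.ball x r) :=
  (X.isClosed_ball x r).measurableSet

lemma ball_zero_eq (r : ℝ) : ∃ ρ : ℝ, X.rad ρ = r ∧
    (X.ball 0 r : Set (Pt d)) = Metric.closedBall 0 ρ := by
  obtain ⟨ρ, hρ⟩ := X.rad_surjective r
  refine ⟨ρ, hρ, ?_⟩
  ext y
  rw [mem_ball, dist_zero, ← hρ, X.rad_strictMono.le_iff_le, mem_closedBall_zero_iff]

lemma isOpen_lt (x : Pt d) (r : ℝ) : IsOpen {y | X.dist x y < r} :=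
  _root_.isOpen_lt (X.continuous_dist_left x) continuous_const

end SpaceForm

/-- An isometry of the space which preserves the volume and geodesic convex hulls. -/
structure Motion (X : SpaceForm) (d : ℕ) extends Pt d ≃ₜ Pt d where
  dist_map : ∀ x y, X.dist (toFun x) (toFun y) = X.dist x y
  measurePreserving : MeasurePreserving toFun (X.vol d) (X.vol d)
  mem_hull : ∀ x S, x ∈ X.hull S → toFun x ∈ X.hull (toFun '' S)
  mem_hull_symm : ∀ x S, x ∈ X.hull S → invFun x ∈ X.hull (invFun '' S)

namespace Motion

variable {X : SpaceForm}

instance : CoeFun (Motion X d) (fun _ => Pt d → Pt d) := ⟨fun g => g.toFun⟩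

/-- The motion `X.move p`, which takes the origin to `p`. -/
noncomputable def ofPoint (X : SpaceForm) (p : Pt d) : Motion X d where
  toFun := X.move p
  invFun := X.move (-p)
  left_inv := X.move_neg_move p
  right_inv := X.move_move_neg p
  continuous_toFun := X.continuous_move.comp (Continuous.prodMk_right p)
  continuous_invFun := X.continuous_move.comp (Continuous.prodMk_right (-p))
  dist_map := X.dist_move p
  measurePreserving := X.measurePreserving_move p
  mem_hull := fun _ _ h => X.move_mem_hull h
  mem_hull_symm := fun _ _ h => X.move_mem_hull h

lemma ofPoint_apply (p x : Pt d) : ofPoint X p x = X.move p x := rfl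

lemma ofPoint_zero (p : Pt d) : ofPoint X p 0 = p := X.move_apply_zero p

/-- The composition of two motions. -/
noncomputable def comp (g h : Motion X d) : Motion X d where
  toHomeomorph := h.toHomeomorph.trans g.toHomeomorph
  dist_map := fun x y => (g.dist_map _ _).trans (h.dist_map x y)
  measurePreserving := g.measurePreserving.comp h.measurePreserving
  mem_hull := fun x S hx => by
    have := g.mem_hull _ _ (h.mem_hull x S hx)
    rwa [Set.image_image] at this
  mem_hull_symm := fun x S hx => by
    have := h.mem_hull_symm _ _ (g.mem_hull_symm x S hx)
    rwa [Set.image_image] at this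

lemma comp_apply (g h : Motion X d) (x : Pt d) : g.comp h x = g (h x) := rfl

lemma injective (g : Motion X d) : Function.Injective g := g.toHomeomorph.injective

lemma surjective (g : Motion X d) : Function.Surjective g := g.toHomeomorph.surjective

lemma dist_eq (g : Motion X d) (x y : Pt d) : X.dist (g x) (g y) = X.dist x y := g.dist_map x y

lemma mem_hull_iff (g : Motion X d) (x : Pt d) (S : Set (Pt d)) :
    g x ∈ X.hull (g '' S) ↔ x ∈ X.hull S := by
  refine ⟨fun h => ?_, g.mem_hull x S⟩
  have := g.mem_hull_symm _ _ h
  rw [Set.image_image] at this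
  have e : (fun x => g.invFun (g x)) = id := funext g.left_inv
  rw [e, Set.image_id] at this
  rwa [g.left_inv] at this

lemma vol_image (g : Motion X d) {B : Set (Pt d)} : X.vol d (g '' B) = X.vol d B := by
  have h := g.measurePreserving.measure_preimage_emb g.toHomeomorph.measurableEmbedding (g '' B)
  rw [← h]
  congr 1
  exact Set.preimage_image_eq B g.injective

lemma measurableSet_image (g : Motion X d) {B : Set (Pt d)} (hB : MeasurableSet B) :
    MeasurableSet (g '' B) := g.toHomeomorph.measurableEmbedding.measurableSet_image.2 hB

lemma image_ball (g : Motion X d) (x : Pt d) (r : ℝ) : g '' X.ball x r = X.ball (g x) r := by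
  ext y
  obtain ⟨z, rfl⟩ := g.surjective y
  rw [g.injective.mem_set_image, X.mem_ball, X.mem_ball, g.dist_eq]

end Motion

namespace SpaceForm

variable (X : SpaceForm)

lemma vol_ball (x : Pt d) (r : ℝ) : X.vol d (X.ball x r) = X.vol d (X.ball 0 r) := by
  have := (Motion.ofPoint X x).image_ball 0 r
  rw [Motion.ofPoint_zero] at this
  rw [← this, Motion.vol_image]

lemma vol_ball_lt_top (x : Pt d) (r : ℝ) : X.vol d (X.ball x r) < ∞ := by
  rw [vol_ball]
  obtain ⟨ρ, _, h⟩ := X.ball_zero_eq (d := d) r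
  rw [h]
  exact (X.vol_le _).trans_lt (isCompact_closedBall _ _).measure_lt_top

lemma vol_ball_pos (x : Pt d) {r : ℝ} (hr : 0 < r) : 0 < X.vol d (X.ball x r) :=
  (X.vol_pos_of_isOpen (X.isOpen_lt x r) ⟨x, by simpa using hr⟩).trans_le
    (measure_mono fun _ hy => X.mem_ball.2 (le_of_lt hy))

end SpaceForm

end NNE

/-! ### Packing, covering and volume growth -/

namespace NNE

variable {d : ℕ}

namespace SpaceForm

variable (X : SpaceForm)

/-- The volume of a ball of radius `r`, as a real number. -/
noncomputable def ballVol (d : ℕ) (r : ℝ) : ℝ := (X.vol d).real (X.ball 0 r)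

lemma ballVol_nonneg (r : ℝ) : 0 ≤ X.ballVol d r := measureReal_nonneg

lemma vol_ball_eq (x : Pt d) (r : ℝ) : X.vol d (X.ball x r) = ENNReal.ofReal (X.ballVol d r) := by
  rw [vol_ball, ballVol, ofReal_measureReal (X.vol_ball_lt_top 0 r).ne]

lemma real_vol_ball (x : Pt d) (r : ℝ) : (X.vol d).real (X.ball x r) = X.ballVol d r := by
  rw [measureReal_def, vol_ball]; rfl

lemma ballVol_pos {r : ℝ} (hr : 0 < r) : 0 < X.ballVol d r :=
  ENNReal.toReal_pos (X.vol_ball_pos 0 hr).ne' (X.vol_ball_lt_top 0 r).ne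

lemma ball_subset_ball {x y : Pt d} {r s : ℝ} (h : X.dist y x + r ≤ s) :
    X.ball x r ⊆ X.ball y s := fun z hz => by
  rw [mem_ball] at hz ⊢
  linarith [X.dist_triangle y x z]

lemma ballVol_mono {r s : ℝ} (h : r ≤ s) : X.ballVol d r ≤ X.ballVol d s :=
  measureReal_mono (X.ball_subset_ball (by simpa using h)) (X.vol_ball_lt_top 0 s).ne

lemma sum_ballVol_le {ι : Type*} (T : Finset ι) (c : ι → Pt d) {δ : ℝ} {x : Pt d} {r : ℝ}
    (hdisj : (T : Set ι).PairwiseDisjoint fun i => X.ball (c i) δ)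
    (hsub : ∀ i ∈ T, X.ball (c i) δ ⊆ X.ball x r) :
    T.card * X.ballVol d δ ≤ X.ballVol d r := by
  have h1 : (X.vol d).real (⋃ i ∈ T, X.ball (c i) δ) = T.card * X.ballVol d δ := by
    rw [measureReal_biUnion_finset hdisj (fun i _ => X.measurableSet_ball _ _)
      (fun i _ => (X.vol_ball_lt_top _ _).ne)]
    simp [real_vol_ball]
  rw [← h1, ← X.real_vol_ball x r]
  exact measureReal_mono (Set.iUnion₂_subset hsub) (X.vol_ball_lt_top _ _).ne

/-- A set of centres is `δ`-separated. -/
def Separated (δ : ℝ) (T : Finset (Pt d)) : Prop :=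
  ∀ x ∈ T, ∀ y ∈ T, x ≠ y → δ < X.dist x y

lemma Separated.disjoint_ball {X : SpaceForm} {δ : ℝ} {T : Finset (Pt d)} (h : X.Separated δ T) :
    (T : Set (Pt d)).PairwiseDisjoint fun c => X.ball c (δ / 2) := by
  intro x hx y hy hxy
  refine Set.disjoint_left.2 fun z hz hz' => ?_
  have h1 := h x hx y hy hxy
  rw [mem_ball] at hz hz'
  have := X.dist_triangle x z y
  rw [X.dist_comm z y] at this
  linarith

lemma Separated.card_mul_le {X : SpaceForm} {δ : ℝ} {T : Finset (Pt d)} (h : X.Separated δ T)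
    {x : Pt d} {r : ℝ} (hT : ∀ c ∈ T, c ∈ X.ball x r) :
    T.card * X.ballVol d (δ / 2) ≤ X.ballVol d (r + δ / 2) :=
  X.sum_ballVol_le T id h.disjoint_ball fun c hc =>
    X.ball_subset_ball (by have := X.mem_ball.1 (hT c hc); simpa using this)

/-- A maximal separated set is a net. -/
lemma exists_separated_net (x : Pt d) (r : ℝ) {δ : ℝ} (hδ : 0 < δ) :
    ∃ T : Finset (Pt d), (∀ c ∈ T, c ∈ X.ball x r) ∧ X.Separated δ T ∧
      ∀ y ∈ X.ball x r, ∃ c ∈ T, X.dist c y ≤ δ := by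
  set N : Set ℕ := {n | ∃ T : Finset (Pt d), (∀ c ∈ T, c ∈ X.ball x r) ∧ X.Separated δ T ∧
    T.card = n} with hN
  have hne : N.Nonempty := ⟨0, ∅, by simp, by simp [Separated], by simp⟩
  have hpos : 0 < X.ballVol d (δ / 2) := X.ballVol_pos (by positivity)
  have hbdd : BddAbove N := by
    refine ⟨⌊X.ballVol d (r + δ / 2) / X.ballVol d (δ / 2)⌋₊, ?_⟩
    rintro n ⟨T, h1, h2, rfl⟩
    apply Nat.le_floor
    rw [le_div_iff₀ hpos]
    exact h2.card_mul_le h1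
  obtain ⟨T, h1, h2, h3⟩ := Nat.sSup_mem hne hbdd
  refine ⟨T, h1, h2, fun y hy => ?_⟩
  by_contra! hcon
  classical
  have hyT : y ∉ T := fun h => by have := hcon y h; rw [dist_self] at this; linarith
  have hmem : (insert y T).card ∈ N := by
    refine ⟨insert y T, ?_, ?_, rfl⟩
    · intro c hc
      rcases Finset.mem_insert.1 hc with rfl | hc
      exacts [hy, h1 c hc]
    · intro a ha b hb hab
      rcases Finset.mem_insert.1 ha with ea | ha' <;> rcases Finset.mem_insert.1 hb with eb | hb'
      · exact absurd (ea.trans eb.symm) hab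
      · rw [ea, X.dist_comm]; exact hcon b hb'
      · rw [eb]; exact hcon a ha'
      · exact h2 a ha' b hb' hab
  have := le_csSup hbdd hmem
  rw [Finset.card_insert_of_notMem hyT, h3] at this
  omega

/-- Balls are doubling at unit scale. -/
lemma exists_ballVol_add_one_le (d : ℕ) :
    ∃ C : ℝ, 0 < C ∧ ∀ r, 1 ≤ r → X.ballVol d (r + 1) ≤ C * X.ballVol d r := by
  have hpos : 0 < X.ballVol d (1 / 2) := X.ballVol_pos (by norm_num)
  refine ⟨X.ballVol d (5 / 2) / X.ballVol d (1 / 2),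
    div_pos (X.ballVol_pos (by norm_num)) hpos, fun r hr => ?_⟩
  obtain ⟨T, h1, h2, h3⟩ := X.exists_separated_net (0 : Pt d) (r - 1 / 2) one_pos
  have hcard := h2.card_mul_le h1
  rw [sub_add_cancel] at hcard
  have hcover : X.ball (0 : Pt d) (r + 1) ⊆ ⋃ c ∈ T, X.ball c (5 / 2) := by
    intro y hy
    rw [mem_ball] at hy
    have : ∃ z : Pt d, X.dist 0 z ≤ r - 1 / 2 ∧ X.dist z y ≤ 3 / 2 := by
      rcases le_total (X.dist 0 y) (r - 1 / 2) with h | h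
      · exact ⟨y, h, by rw [dist_self]; norm_num⟩
      · obtain ⟨z, hz1, hz2⟩ := X.exists_radial y (by linarith) h
        exact ⟨z, hz1.le, by linarith⟩
    obtain ⟨z, hz1, hz2⟩ := this
    obtain ⟨c, hc, hcz⟩ := h3 z hz1
    refine Set.mem_biUnion hc (X.mem_ball.2 ?_)
    linarith [X.dist_triangle c z y]
  have h4 : X.ballVol d (r + 1) ≤ T.card * X.ballVol d (5 / 2) := by
    calc X.ballVol d (r + 1) ≤ (X.vol d).real (⋃ c ∈ T, X.ball c (5 / 2)) := by
          refine measureReal_mono hcover (ne_of_lt ?_)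
          exact (measure_biUnion_finset_le _ _).trans_lt
            (ENNReal.sum_lt_top.2 fun c _ => X.vol_ball_lt_top _ _)
      _ ≤ ∑ c ∈ T, (X.vol d).real (X.ball c (5 / 2)) := measureReal_biUnion_finset_le _ _
      _ = _ := by simp [real_vol_ball]
  rw [div_mul_eq_mul_div, le_div_iff₀ hpos]
  have h5 := X.ballVol_nonneg (d := d) (5 / 2)
  nlinarith

lemma exists_dist_zero_eq (hd : 1 ≤ d) {s : ℝ} (hs : 0 ≤ s) : ∃ x : Pt d, X.dist 0 x = s := by
  obtain ⟨r, hr⟩ := X.rad_surjective s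
  have hr0 : 0 ≤ r := by rw [← X.rad_strictMono.le_iff_le, rad_zero, hr]; exact hs
  refine ⟨r • EuclideanSpace.single ⟨0, hd⟩ 1, ?_⟩
  rw [dist_zero, norm_smul, Real.norm_of_nonneg hr0]
  simp [hr]

/-- Volumes of balls grow at least linearly. -/
lemma exists_mul_le_ballVol (hd : 1 ≤ d) :
    ∃ c : ℝ, 0 < c ∧ ∀ n : ℕ, c * n ≤ X.ballVol d n := by
  refine ⟨X.ballVol d (1 / 3), X.ballVol_pos (by norm_num), fun n => ?_⟩
  choose p hp using fun i : ℕ => X.exists_dist_zero_eq hd (s := i + 1 / 2) (by positivity)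
  have := X.sum_ballVol_le (Finset.range n) p (δ := 1 / 3) (x := 0) (r := n) ?_ ?_
  · rwa [Finset.card_range, mul_comm] at this
  · intro i _ j _ hij
    refine Set.disjoint_left.2 fun z hz hz' => hij ?_
    rw [mem_ball] at hz hz'
    have h1 := X.dist_triangle 0 z (p i)
    have h2 := X.dist_triangle 0 z (p j)
    have h3 := X.dist_triangle 0 (p i) z
    have h4 := X.dist_triangle 0 (p j) z
    rw [X.dist_comm z, hp] at h1 h2
    rw [hp] at h3 h4
    have h5 : (i : ℝ) < j + 1 := by linarith
    have h6 : (j : ℝ) < i + 1 := by linarith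
    have h7 : i < j + 1 := by exact_mod_cast h5
    have h8 : j < i + 1 := by exact_mod_cast h6
    omega
  · intro i hi
    apply X.ball_subset_ball
    rw [hp]
    have : (i : ℝ) + 1 ≤ n := by exact_mod_cast Finset.mem_range.1 hi
    linarith

end SpaceForm

/-! ### Sectors around the origin -/

/-- The sign `±1` encoded by a Boolean. -/
def sgn (b : Bool) : ℝ := if b then 1 else -1

lemma sgn_mul_self (b : Bool) : sgn b * sgn b = 1 := by cases b <;> simp [sgn]

/-- The part of an orthant at a fixed angular distance from the coordinate hyperplanes. -/
def orthantCone (s : Fin d → Bool) : Set (Pt d) :=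
  {z | ∀ i, (2 * Real.sqrt d)⁻¹ * ‖z‖ ≤ sgn (s i) * z i}

lemma isClosed_orthantCone (s : Fin d → Bool) : IsClosed (orthantCone s) := by
  have : orthantCone s = ⋂ i, {z : Pt d | (2 * Real.sqrt d)⁻¹ * ‖z‖ ≤ sgn (s i) * z i} := by
    ext z; simp [orthantCone]
  rw [this]
  exact isClosed_iInter fun i => isClosed_le (by fun_prop) (by fun_prop)

lemma smul_mem_orthantCone {s : Fin d → Bool} {z : Pt d} (hz : z ∈ orthantCone s) {r : ℝ}
    (hr : 0 ≤ r) : r • z ∈ orthantCone s := by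
  intro i
  have := mul_le_mul_of_nonneg_left (hz i) hr
  rw [norm_smul, Real.norm_of_nonneg hr, PiLp.smul_apply, smul_eq_mul]
  linarith

lemma volume_orthantCone_inter_pos (hd : 1 ≤ d) (s : Fin d → Bool) :
    0 < volume (orthantCone s ∩ Metric.closedBall 0 1) := by
  set U : Set (Pt d) := (⋂ i, {z : Pt d | (2 * Real.sqrt d)⁻¹ * ‖z‖ < sgn (s i) * z i}) ∩
    Metric.ball 0 1 with hU
  have hUo : IsOpen U := (isOpen_iInter_of_finite fun i =>
    isOpen_lt (by fun_prop) (by fun_prop)).inter Metric.isOpen_ball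
  set v : Pt d := WithLp.toLp 2 fun i => sgn (s i) with hv
  have hd' : 0 < Real.sqrt d := Real.sqrt_pos.2 (by exact_mod_cast hd)
  have hvn : ‖v‖ = Real.sqrt d := by
    rw [EuclideanSpace.norm_eq]
    congr 1
    simp only [hv, Real.norm_eq_abs, sq_abs]
    simp [pow_two, sgn_mul_self]
  have hUn : U.Nonempty := by
    refine ⟨(2 * Real.sqrt d)⁻¹ • v, ?_, ?_⟩
    · refine Set.mem_iInter.2 fun i => ?_
      rw [Set.mem_ofPred_eq, norm_smul, hvn, Real.norm_of_nonneg (by positivity), PiLp.smul_apply,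
        smul_eq_mul, hv]
      have : sgn (s i) * ((2 * Real.sqrt d)⁻¹ * sgn (s i)) = (2 * Real.sqrt d)⁻¹ := by
        rw [mul_left_comm, sgn_mul_self, mul_one]
      simp only [this]
      have h2 : (2 * Real.sqrt d)⁻¹ * Real.sqrt d = 1 / 2 := by field_simp
      rw [h2]
      have : 0 < (2 * Real.sqrt d)⁻¹ := by positivity
      linarith
    · rw [mem_ball_zero_iff, norm_smul, hvn, Real.norm_of_nonneg (by positivity)]
      have h2 : (2 * Real.sqrt d)⁻¹ * Real.sqrt d = 1 / 2 := by field_simp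
      rw [h2]; norm_num
  refine (hUo.measure_pos volume hUn).trans_le (measure_mono ?_)
  intro z hz
  exact ⟨fun i => (Set.mem_iInter.1 hz.1 i).le, Metric.ball_subset_closedBall hz.2⟩

open scoped Pointwise in
/-- A cone occupies the same fraction of every rotationally invariant measure. -/
lemma setLIntegral_cone {K : Set (Pt d)} (hd : 1 ≤ d)
    (hcone : ∀ z ∈ K, ∀ r : ℝ, 0 ≤ r → r • z ∈ K) (R : ℝ) (f : ℝ → ℝ≥0∞) (hf : Measurable f) :
    ∫⁻ z in K ∩ Metric.closedBall 0 R, f ‖z‖ =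
      volume (K ∩ Metric.closedBall (0 : Pt d) 1) / volume (Metric.closedBall (0 : Pt d) 1) *
        ∫⁻ z in Metric.closedBall (0 : Pt d) R, f ‖z‖ := by
  have : Nonempty (Fin d) := ⟨⟨0, hd⟩⟩
  have : Nontrivial (Pt d) := inferInstance
  set q := volume (K ∩ Metric.closedBall (0 : Pt d) 1) / volume (Metric.closedBall (0 : Pt d) 1)
    with hq
  have hB1 : volume (Metric.closedBall (0 : Pt d) 1) ≠ 0 :=
    (Metric.measure_closedBall_pos volume 0 one_pos).ne'
  have hB1' : volume (Metric.closedBall (0 : Pt d) 1) ≠ ∞ :=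
    (isCompact_closedBall _ _).measure_lt_top.ne
  have hqtop : q ≠ ∞ := by
    rw [hq]
    exact ENNReal.div_ne_top (ne_top_of_le_ne_top hB1' (measure_mono Set.inter_subset_right)) hB1
  have hscale : ∀ a : ℝ, volume (K ∩ Metric.closedBall (0 : Pt d) a) =
      q * volume (Metric.closedBall (0 : Pt d) a) := by
    intro a
    rcases lt_trichotomy a 0 with ha | rfl | ha
    · simp [Metric.closedBall_eq_empty.2 ha]
    · have : volume (Metric.closedBall (0 : Pt d) 0) = 0 := by simp
      rw [this, mul_zero]
      exact measure_mono_null Set.inter_subset_right this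
    · have e1 : K ∩ Metric.closedBall (0 : Pt d) a = a • (K ∩ Metric.closedBall (0 : Pt d) 1) := by
        ext z
        rw [Set.mem_smul_set_iff_inv_smul_mem₀ ha.ne']
        simp only [Set.mem_inter_iff, mem_closedBall_zero_iff, norm_smul, norm_inv,
          Real.norm_of_nonneg ha.le]
        have e : a⁻¹ * ‖z‖ ≤ 1 ↔ ‖z‖ ≤ a := by rw [inv_mul_le_iff₀ ha, mul_one]
        rw [e]
        refine and_congr_left fun _ => ⟨fun h => hcone z h _ (by positivity), fun h => ?_⟩
        have := hcone _ h a ha.le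
        rwa [smul_smul, mul_inv_cancel₀ ha.ne', one_smul] at this
      have e2 : Metric.closedBall (0 : Pt d) a = a • Metric.closedBall (0 : Pt d) 1 := by
        rw [smul_unitClosedBall_of_nonneg ha.le]
      rw [e1, e2, Measure.addHaar_smul, Measure.addHaar_smul, mul_left_comm, hq,
        ENNReal.div_mul_cancel hB1 hB1']
  have hm : Measurable fun z : Pt d => ‖z‖ := measurable_norm
  have hmu : (volume.restrict (K ∩ Metric.closedBall (0 : Pt d) R)).map (fun z => ‖z‖) =
      q • (volume.restrict (Metric.closedBall (0 : Pt d) R)).map (fun z => ‖z‖) := by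
    have : IsFiniteMeasure (volume.restrict (K ∩ Metric.closedBall (0 : Pt d) R)) :=
      ⟨by
        rw [Measure.restrict_apply_univ]
        exact (measure_mono Set.inter_subset_right).trans_lt
          (isCompact_closedBall _ _).measure_lt_top⟩
    apply Measure.ext_of_Iic
    intro a
    have hpre : (fun z : Pt d => ‖z‖) ⁻¹' Set.Iic a = Metric.closedBall 0 a := by
      ext z; simp
    rw [Measure.smul_apply, Measure.map_apply hm measurableSet_Iic,
      Measure.map_apply hm measurableSet_Iic, hpre,
      Measure.restrict_apply Metric.isClosed_closedBall.measurableSet,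
      Measure.restrict_apply Metric.isClosed_closedBall.measurableSet]
    have e : Metric.closedBall (0 : Pt d) a ∩ Metric.closedBall 0 R =
        Metric.closedBall 0 (min a R) := by ext z; simp
    rw [smul_eq_mul, e, ← hscale, ← e]
    congr 1
    ext z; simp only [Set.mem_inter_iff]; tauto
  calc ∫⁻ z in K ∩ Metric.closedBall 0 R, f ‖z‖
      = ∫⁻ r, f r ∂(volume.restrict (K ∩ Metric.closedBall (0 : Pt d) R)).map (fun z => ‖z‖) :=
        (lintegral_map hf hm).symm
    _ = q * ∫⁻ r, f r ∂(volume.restrict (Metric.closedBall (0 : Pt d) R)).map (fun z => ‖z‖) := by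
        rw [hmu, lintegral_smul_measure, smul_eq_mul]
    _ = _ := by rw [lintegral_map hf hm]

/-- Points within distance `r` of the origin in the sector `s`: all the coordinates of the chart
have the signs given by `s` and are at least `(4 √d)⁻¹` in absolute value. -/
def sector (X : SpaceForm) (s : Fin d → Bool) (r : ℝ) : Set (Pt d) :=
  {z | (∀ i, (4 * Real.sqrt d)⁻¹ ≤ sgn (s i) * X.chart z i) ∧ X.dist 0 z ≤ r}

lemma measurableSet_sector (X : SpaceForm) (s : Fin d → Bool) (r : ℝ) :
    MeasurableSet (sector X s r) := by
  have h1 : sector X s r = (⋂ i, {z : Pt d | (4 * Real.sqrt d)⁻¹ ≤ sgn (s i) * X.chart z i}) ∩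
      X.ball 0 r := by
    ext z; simp [sector, SpaceForm.mem_ball]
  rw [h1]
  refine (IsClosed.inter (isClosed_iInter fun i => ?_) (X.isClosed_ball 0 r)).measurableSet
  have := X.continuous_chart (d := d)
  exact isClosed_le continuous_const (by fun_prop)

lemma sector_subset_ball (X : SpaceForm) (s : Fin d → Bool) (r : ℝ) :
    sector X s r ⊆ X.ball 0 r := fun _ hz => hz.2

lemma mem_sector_of_mem_orthantCone (X : SpaceForm) {s : Fin d → Bool} {r : ℝ} {z : Pt d}
    (hz : z ∈ orthantCone s) (h1 : 1 ≤ ‖z‖) (hr : X.dist 0 z ≤ r) : z ∈ sector X s r := by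
  refine ⟨fun i => ?_, hr⟩
  have h2 := hz i
  have hpos : 0 ≤ (2 * Real.sqrt d)⁻¹ := by positivity
  have e : (4 * Real.sqrt d)⁻¹ = (2 * Real.sqrt d)⁻¹ / 2 := by
    rw [show (4 : ℝ) * Real.sqrt d = 2 * Real.sqrt d * 2 by ring, mul_inv]; rfl
  rw [e]
  cases X
  · simp only [SpaceForm.chart]
    nlinarith
  · simp only [SpaceForm.chart, klein, PiLp.smul_apply, smul_eq_mul]
    have h3 : height z ≤ 2 * ‖z‖ := by
      have := height_sq z
      have := height_pos z
      nlinarith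
    have h4 := height_pos z
    rw [mul_left_comm, ← div_eq_inv_mul, le_div_iff₀ h4]
    nlinarith

/-- Each sector takes up a fixed proportion of the volume of a ball, up to an additive constant. -/
lemma exists_mul_sub_le_vol_sector (X : SpaceForm) (hd : 1 ≤ d) (s : Fin d → Bool) :
    ∃ q : ℝ, 0 < q ∧ ∀ r, q * (X.ballVol d r - X.ballVol d (X.rad 1)) ≤
      (X.vol d).real (sector X s r) := by
  have hB1 : volume (Metric.closedBall (0 : Pt d) 1) ≠ 0 :=
    (Metric.measure_closedBall_pos volume 0 one_pos).ne'
  have hB1' : volume (Metric.closedBall (0 : Pt d) 1) ≠ ∞ :=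
    (isCompact_closedBall _ _).measure_lt_top.ne
  have hKtop : volume (orthantCone s ∩ Metric.closedBall (0 : Pt d) 1) ≠ ∞ :=
    ne_top_of_le_ne_top hB1' (measure_mono Set.inter_subset_right)
  set q := volume (orthantCone s ∩ Metric.closedBall (0 : Pt d) 1) /
    volume (Metric.closedBall (0 : Pt d) 1) with hq
  have hq0 : q ≠ 0 := (ENNReal.div_pos (volume_orthantCone_inter_pos hd s).ne' hB1').ne'
  have hqtop : q ≠ ∞ := ENNReal.div_ne_top hKtop hB1
  refine ⟨q.toReal, ENNReal.toReal_pos hq0 hqtop, fun r => ?_⟩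
  obtain ⟨ρ, hρ, hball⟩ := X.ball_zero_eq (d := d) r
  set f : ℝ → ℝ≥0∞ := (Set.Ici 1).indicator X.dens with hf
  have hfm : Measurable f := X.measurable_dens.indicator measurableSet_Ici
  have hdens : Measurable fun z : Pt d => X.dens ‖z‖ := X.measurable_dens.comp measurable_norm
  set A : Set (Pt d) := {z | 1 ≤ ‖z‖} with hA
  have hAm : MeasurableSet A := measurableSet_le measurable_const measurable_norm
  have hint : ∀ B : Set (Pt d), MeasurableSet B →
      ∫⁻ z in B, f ‖z‖ = X.vol d (A ∩ B) := by
    intro B hB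
    have : (fun z : Pt d => f ‖z‖) = A.indicator fun z => X.dens ‖z‖ := by
      ext z; simp [hf, hA, Set.indicator_apply]
    rw [this, setLIntegral_indicator hAm, X.vol_eq, withDensity_apply _ (hAm.inter hB)]
  have hcl : MeasurableSet (Metric.closedBall (0 : Pt d) ρ) :=
    Metric.isClosed_closedBall.measurableSet
  have hKm : MeasurableSet (orthantCone s) := (isClosed_orthantCone s).measurableSet
  have key := setLIntegral_cone (K := orthantCone s) hd
    (fun z hz a ha => smul_mem_orthantCone hz ha) ρ f hfm
  rw [hint _ (hKm.inter hcl), hint _ hcl, ← hball, ← hq] at key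
  have hsub : A ∩ (orthantCone s ∩ X.ball 0 r) ⊆ sector X s r := fun z hz =>
    mem_sector_of_mem_orthantCone X hz.2.1 hz.1 hz.2.2
  have hsecfin : X.vol d (sector X s r) ≠ ∞ :=
    ((measure_mono (sector_subset_ball X s r)).trans_lt (X.vol_ball_lt_top 0 r)).ne
  have h1 : (X.vol d).real (A ∩ (orthantCone s ∩ X.ball 0 r)) ≤ (X.vol d).real (sector X s r) :=
    measureReal_mono hsub hsecfin
  have h2 : (X.vol d).real (A ∩ (orthantCone s ∩ X.ball 0 r)) =
      q.toReal * (X.vol d).real (A ∩ X.ball 0 r) := by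
    rw [measureReal_def, key, ENNReal.toReal_mul]; rfl
  have h3 : X.ballVol d r ≤ (X.vol d).real (A ∩ X.ball 0 r) + X.ballVol d (X.rad 1) := by
    have hfin : X.vol d (A ∩ X.ball 0 r) ≠ ∞ :=
      ((measure_mono Set.inter_subset_right).trans_lt (X.vol_ball_lt_top 0 r)).ne
    calc X.ballVol d r ≤ (X.vol d).real ((A ∩ X.ball 0 r) ∪ X.ball 0 (X.rad 1)) := by
          refine measureReal_mono (fun z hz => ?_)
            (measure_union_lt_top hfin.lt_top (X.vol_ball_lt_top _ _)).ne
          rcases le_total 1 ‖z‖ with h | h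
          · exact Or.inl ⟨h, hz⟩
          · refine Or.inr ?_
            rw [X.mem_ball, X.dist_zero]
            exact X.rad_strictMono.monotone h
      _ ≤ _ := measureReal_union_le _ _
  rw [h2] at h1
  refine le_trans ?_ h1
  exact mul_le_mul_of_nonneg_left (by linarith) ENNReal.toReal_nonneg

/-- A point near the origin lies in the hull of any set which meets all the sectors. -/
lemma mem_hull_of_sectors (X : SpaceForm) {S : Set (Pt d)} {r : ℝ} {y : Pt d}
    (hS : S.Finite) (hy : ‖X.chart y‖ ≤ (4 * Real.sqrt d)⁻¹)
    (h : ∀ s : Fin d → Bool, (S ∩ sector X s r).Nonempty) : y ∈ X.hull S := by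
  rw [X.mem_hull_iff]
  by_contra hcon
  have hcl : IsClosed (convexHull ℝ (X.chart '' S)) := (hS.image _).isClosed_convexHull ℝ
  obtain ⟨l, u, hl1, hl2⟩ := geometric_hahn_banach_point_closed (convex_convexHull ℝ _) hcl hcon
  obtain ⟨v, rfl⟩ := (InnerProductSpace.toDual ℝ (Pt d)).surjective l
  simp only [InnerProductSpace.toDual_apply_apply] at hl1 hl2
  obtain ⟨z, hzS, hz⟩ := h fun i => decide (v i ≤ 0)
  have h1 := hl2 _ (subset_convexHull ℝ _ ⟨z, hzS, rfl⟩)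
  have h2 : inner ℝ v (X.chart z) ≤ inner ℝ v (X.chart y) := by
    rw [PiLp.inner_apply, PiLp.inner_apply]
    refine Finset.sum_le_sum fun i _ => ?_
    simp only [RCLike.inner_apply, conj_trivial]
    have h3 := hz.1 i
    have h4 : |X.chart y i| ≤ (4 * Real.sqrt d)⁻¹ := (PiLp.norm_apply_le (X.chart y) i).trans hy
    rw [abs_le] at h4
    by_cases hv : v i ≤ 0
    · simp only [hv, decide_true, sgn, if_true, one_mul] at h3
      exact mul_le_mul_of_nonpos_right (by linarith) hv
    · simp only [hv, decide_false, sgn] at h3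
      push Not at hv
      simp at h3
      exact mul_le_mul_of_nonneg_right (by simp at h4; linarith) hv.le
  linarith

end NNE

/-! ### Poisson random variables and Poisson processes -/

namespace NNE

open scoped NNReal

lemma lintegral_poissonMeasure (r : ℝ≥0) (f : ℕ → ℝ≥0∞) :
    ∫⁻ n, f n ∂poissonMeasure r =
      ∑' n, f n * ENNReal.ofReal (Real.exp (-r) * r ^ n / n.factorial) := by
  rw [lintegral_countable']
  simp only [poissonMeasure_singleton]

lemma lintegral_mul_poissonMeasure (r : ℝ≥0) (f : ℕ → ℝ≥0∞) :
    ∫⁻ n, n * f n ∂poissonMeasure r = r * ∫⁻ n, f (n + 1) ∂poissonMeasure r := by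
  rw [lintegral_poissonMeasure, lintegral_poissonMeasure, ← ENNReal.tsum_mul_left,
    tsum_eq_zero_add' ENNReal.summable]
  simp only [Nat.cast_zero, zero_mul, zero_add]
  refine tsum_congr fun n => ?_
  have h : ENNReal.ofReal (Real.exp (-r) * r ^ (n + 1) / (n + 1).factorial) * (n + 1 : ℕ) =
      r * ENNReal.ofReal (Real.exp (-r) * r ^ n / n.factorial) := by
    rw [← ENNReal.ofReal_natCast, ← ENNReal.ofReal_coe_nnreal, ← ENNReal.ofReal_mul (by positivity),
      ← ENNReal.ofReal_mul (by positivity)]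
    congr 1
    rw [Nat.factorial_succ]
    push_cast
    field_simp
    ring
  calc _ = f (n + 1) * (ENNReal.ofReal (Real.exp (-r) * r ^ (n + 1) / (n + 1).factorial) *
        (n + 1 : ℕ)) := by ring
    _ = _ := by rw [h]; ring

/-- The moments of the Poisson distribution are bounded by powers of the parameter. -/
lemma exists_poisson_moment_le (k : ℕ) :
    ∃ C : ℝ≥0, ∀ r : ℝ≥0, ∫⁻ n, (n : ℝ≥0∞) ^ k ∂poissonMeasure r ≤ C * (1 + r) ^ k := by
  induction k with
  | zero => exact ⟨1, fun r => by simp⟩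
  | succ k ih =>
    obtain ⟨C, hC⟩ := ih
    refine ⟨2 ^ k * (C + 1), fun r => ?_⟩
    have h1 : ∀ n : ℕ, ((n + 1 : ℕ) : ℝ≥0∞) ^ k ≤ 2 ^ k * ((n : ℝ≥0∞) ^ k + 1) := by
      intro n
      rcases Nat.eq_zero_or_pos n with rfl | hn
      · simp only [zero_add, Nat.cast_one, one_pow, Nat.cast_zero]
        have : (1 : ℝ≥0∞) ≤ 2 ^ k := one_le_pow₀ (by norm_num)
        exact le_trans (by simp) (mul_le_mul' this le_add_self)
      · have : ((n + 1 : ℕ) : ℝ≥0∞) ≤ 2 * n := by exact_mod_cast (by omega : n + 1 ≤ 2 * n)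
        calc ((n + 1 : ℕ) : ℝ≥0∞) ^ k ≤ (2 * n) ^ k := by gcongr
          _ = 2 ^ k * (n : ℝ≥0∞) ^ k := mul_pow _ _ _
          _ ≤ _ := by gcongr; exact le_self_add
    have hr : (1 : ℝ≥0∞) ≤ (1 + r) ^ k := one_le_pow₀ le_self_add
    calc ∫⁻ n, (n : ℝ≥0∞) ^ (k + 1) ∂poissonMeasure r
        = ∫⁻ n, n * (n : ℝ≥0∞) ^ k ∂poissonMeasure r := by simp only [pow_succ, mul_comm]
      _ = r * ∫⁻ n, ((n + 1 : ℕ) : ℝ≥0∞) ^ k ∂poissonMeasure r :=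
          lintegral_mul_poissonMeasure r fun n => (n : ℝ≥0∞) ^ k
      _ ≤ r * ∫⁻ n, 2 ^ k * ((n : ℝ≥0∞) ^ k + 1) ∂poissonMeasure r := by
          gcongr with n; exact h1 n
      _ = r * (2 ^ k * (∫⁻ n, (n : ℝ≥0∞) ^ k ∂poissonMeasure r + 1)) := by
          rw [lintegral_const_mul _ (by fun_prop), lintegral_add_right _ (by fun_prop)]; simp
      _ ≤ (1 + r) * (2 ^ k * (C * (1 + r) ^ k + (1 + r) ^ k)) := by
          gcongr
          · exact le_add_self
          · exact hC r
      _ = _ := by push_cast; ring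

variable {X : SpaceForm} {d : ℕ} {Ω : Type*}

lemma count_iUnion {ι : Type*} [Fintype ι] (η : Ω → Set (Pt d)) (B : ι → Set (Pt d))
    (hB : Pairwise fun i j => Disjoint (B i) (B j)) (ω : Ω) :
    count η (⋃ i, B i) ω = ∑ i, count η (B i) ω := by
  have := Set.encard_iUnion_of_finite (s := fun i => η ω ∩ B i)
    fun i j hij => (hB hij).mono Set.inter_subset_right Set.inter_subset_right
  rw [count, Set.inter_iUnion, this, finsum_eq_sum_of_fintype]
  rfl

/-- The σ-algebra generated by the restriction of `η` to the complement of `I`. -/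
noncomputable abbrev outsideSigma (η : Ω → Set (Pt d)) (I : Set (Pt d)) : MeasurableSpace Ω :=
  ⨆ B : {B : Set (Pt d) // MeasurableSet B ∧ Disjoint B I},
    MeasurableSpace.comap (count η (B : Set (Pt d))) inferInstance

lemma measurable_count_outsideSigma (η : Ω → Set (Pt d)) {I B : Set (Pt d)}
    (hB : MeasurableSet B) (hBI : Disjoint B I) : Measurable[outsideSigma η I] (count η B) := by
  rw [measurable_iff_comap_le]
  exact le_iSup (fun B : {B : Set (Pt d) // MeasurableSet B ∧ Disjoint B I} =>
    MeasurableSpace.comap (count η (B : Set (Pt d))) inferInstance) ⟨B, hB, hBI⟩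

variable [MeasurableSpace Ω] {P : Measure Ω} {η : Ω → Set (Pt d)}

namespace IsPoissonProcess

lemma lintegral_count (h : IsPoissonProcess X d P η) {B : Set (Pt d)} (hB : MeasurableSet B)
    (hfin : X.vol d B ≠ ∞) (f : ℕ∞ → ℝ≥0∞) :
    ∫⁻ ω, f (count η B ω) ∂P = ∫⁻ n : ℕ, f n ∂poissonMeasure (X.vol d B).toNNReal := by
  rw [← lintegral_map (f := f) (measurable_of_countable f) (h.measurable_count B hB),
    h.map_count B hB hfin, lintegral_map (measurable_of_countable f) (measurable_of_countable _)]

lemma prob_count_eq (h : IsPoissonProcess X d P η) {B : Set (Pt d)} (hB : MeasurableSet B)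
    (hfin : X.vol d B ≠ ∞) (k : ℕ) :
    P {ω | count η B ω = k} = ENNReal.ofReal
      (Real.exp (-(X.vol d).real B) * (X.vol d).real B ^ k / k.factorial) := by
  have h1 : {ω | count η B ω = k} = count η B ⁻¹' {(k : ℕ∞)} := rfl
  rw [h1, ← Measure.map_apply (h.measurable_count B hB) (measurableSet_singleton _),
    h.map_count B hB hfin, Measure.map_apply (measurable_of_countable _) (measurableSet_singleton _)]
  have h2 : (Nat.cast : ℕ → ℕ∞) ⁻¹' {(k : ℕ∞)} = {k} := by ext n; simp
  rw [h2, poissonMeasure_singleton]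
  rfl

lemma prob_count_eq_zero (h : IsPoissonProcess X d P η) {B : Set (Pt d)} (hB : MeasurableSet B)
    (hfin : X.vol d B ≠ ∞) :
    P {ω | count η B ω = 0} = ENNReal.ofReal (Real.exp (-(X.vol d).real B)) := by
  have := h.prob_count_eq hB hfin 0
  simpa using this

lemma iIndepFun_count (h : IsPoissonProcess X d P η) {ι : Type*} [Finite ι] (B : ι → Set (Pt d))
    (hB : ∀ i, MeasurableSet (B i)) (hd : Pairwise fun i j => Disjoint (B i) (B j)) :
    iIndepFun (fun i => count η (B i)) P := by
  obtain ⟨n, ⟨e⟩⟩ := Finite.exists_equiv_fin ι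
  refine iIndepFun.of_precomp (g := e.symm) e.symm.surjective ?_
  exact h.indep_count n (fun i => B (e.symm i)) (fun i => hB _)
    fun i j hij => hd fun h => hij (e.symm.injective h)

end IsPoissonProcess

namespace IsPoissonProcess

lemma outsideSigma_le (h : IsPoissonProcess X d P η) (I : Set (Pt d)) :
    outsideSigma η I ≤ ‹MeasurableSpace Ω› :=
  iSup_le fun B => (measurable_iff_comap_le).1 (h.measurable_count B B.2.1)

/-- The number of points in `I` is independent of the process outside `I`. -/
lemma indep_outsideSigma [IsProbabilityMeasure P] (h : IsPoissonProcess X d P η) {I : Set (Pt d)}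
    (hI : MeasurableSet I) :
    Indep (outsideSigma η I) (MeasurableSpace.comap (count η I) inferInstance) P := by
  classical
  set ι := {B : Set (Pt d) // MeasurableSet B ∧ Disjoint B I} with hι
  set m : Finset ι → MeasurableSpace Ω := fun T =>
    ⨆ B ∈ T, MeasurableSpace.comap (count η (B : Set (Pt d))) inferInstance with hm
  have hsup : outsideSigma η I = ⨆ T, m T := by
    apply le_antisymm
    · refine iSup_le fun B => ?_
      refine le_trans ?_ (le_iSup m {B})
      exact le_iSup₂_of_le B (Finset.mem_singleton_self B) le_rfl
    · refine iSup_le fun T => iSup₂_le fun B _ => ?_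
      exact le_iSup (fun B : ι => MeasurableSpace.comap (count η (B : Set (Pt d))) inferInstance) B
  rw [hsup]
  refine indep_iSup_of_directed_le (fun T => ?_) (fun T => ?_)
    (measurable_iff_comap_le.1 (h.measurable_count I hI)) ?_
  · -- the atoms of the algebra generated by the sets in `T`, together with `I`
    set A : Option (T → Bool) → Set (Pt d) := fun o => o.elim I fun σ =>
      {z | z ∉ I ∧ ∀ B : T, decide (z ∈ (B : ι).1) = σ B} with hA
    have hAm : ∀ o, MeasurableSet (A o) := by
      rintro (_ | σ)
      · exact hI
      · have : A (some σ) = Iᶜ ∩ ⋂ B : T, {z | decide (z ∈ (B : ι).1) = σ B} := by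
          ext z; simp [hA]
        rw [this]
        refine hI.compl.inter (MeasurableSet.iInter fun B => ?_)
        cases hσ : σ B
        · have : {z | decide (z ∈ (B : ι).1) = false} = ((B : ι).1)ᶜ := by ext z; simp
          rw [this]; exact (B : ι).2.1.compl
        · have : {z | decide (z ∈ (B : ι).1) = true} = (B : ι).1 := by ext z; simp
          rw [this]; exact (B : ι).2.1
    have hAd : Pairwise fun o o' => Disjoint (A o) (A o') := by
      rintro (_ | σ) (_ | τ) hne
      · exact absurd rfl hne
      · exact Set.disjoint_left.2 fun z hz hz' => hz'.1 hz
      · exact Set.disjoint_left.2 fun z hz hz' => hz.1 hz'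
      · refine Set.disjoint_left.2 fun z hz hz' => hne ?_
        congr 1
        funext B
        rw [← hz.2 B, hz'.2 B]
    have hind := h.iIndepFun_count A hAm hAd
    have h2 := hind.indepFun_finset ({none}ᶜ) {none}
      disjoint_compl_left fun o => h.measurable_count _ (hAm o)
    rw [IndepFun_iff_Indep] at h2
    refine indep_of_indep_of_le_left (indep_of_indep_of_le_right h2 ?_) ?_
    · rw [← measurable_iff_comap_le]
      have : count η I = (fun f : ({none} : Finset (Option (T → Bool))) → ℕ∞ =>
          f ⟨none, Finset.mem_singleton_self _⟩) ∘
          fun ω (o : ({none} : Finset (Option (T → Bool)))) => count η (A o) ω := rfl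
      rw [this]
      exact (measurable_pi_apply _).comp (comap_measurable _)
    · refine iSup₂_le fun B hBT => ?_
      rw [← measurable_iff_comap_le]
      have hunion : (B : Set (Pt d)) = ⋃ σ : {σ : T → Bool // σ ⟨B, hBT⟩ = true}, A (some σ) := by
        ext z
        simp only [Set.mem_iUnion]
        constructor
        · intro hz
          refine ⟨⟨fun C => decide (z ∈ (C : ι).1), by simpa using hz⟩, ?_, fun C => rfl⟩
          exact fun hzI => Set.disjoint_left.1 B.2.2 hz hzI
        · rintro ⟨⟨σ, hσ⟩, hz⟩
          have := hz.2 ⟨B, hBT⟩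
          simpa [hσ] using this
      have hsum : count η (B : Set (Pt d)) =
          fun ω => ∑ σ : {σ : T → Bool // σ ⟨B, hBT⟩ = true}, count η (A (some σ)) ω := by
        funext ω
        conv_lhs => rw [hunion]
        exact count_iUnion η _ (fun σ τ hne => hAd fun he => hne
          (Subtype.ext (Option.some_injective _ he))) ω
      rw [hsum]
      refine Finset.measurable_sum _ fun σ _ => ?_
      have : count η (A (some σ)) = (fun f : ({none}ᶜ : Finset (Option (T → Bool))) → ℕ∞ =>
          f ⟨some σ, by simp⟩) ∘
          fun ω (o : ({none}ᶜ : Finset (Option (T → Bool)))) => count η (A o) ω := rfl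
      rw [this]
      exact (measurable_pi_apply _).comp (comap_measurable _)
  · exact iSup₂_le fun B _ => measurable_iff_comap_le.1 (h.measurable_count B B.2.1)
  · intro T T'
    refine ⟨T ∪ T', ?_, ?_⟩
    · exact iSup₂_le fun B hB => le_iSup₂_of_le B (Finset.mem_union_left _ hB) le_rfl
    · exact iSup₂_le fun B hB => le_iSup₂_of_le B (Finset.mem_union_right _ hB) le_rfl

/-- Factorization of expectations over the number of points in `I` and the process outside. -/
lemma lintegral_mul_outside [IsProbabilityMeasure P] (h : IsPoissonProcess X d P η)
    {I : Set (Pt d)} (hI : MeasurableSet I) {F : Ω → ℝ≥0∞} (hF : Measurable[outsideSigma η I] F)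
    (f : ℕ∞ → ℝ≥0∞) :
    ∫⁻ ω, F ω * f (count η I ω) ∂P = (∫⁻ ω, F ω ∂P) * ∫⁻ ω, f (count η I ω) ∂P :=
  lintegral_mul_eq_lintegral_mul_lintegral_of_independent_measurableSpace (h.outsideSigma_le I)
    (measurable_iff_comap_le.1 (h.measurable_count I hI)) (h.indep_outsideSigma hI) hF
    ((measurable_of_countable f).comp (comap_measurable _))

end IsPoissonProcess

end NNE

/-! ### Measurability of the edge functional -/

namespace NNE

variable {d : ℕ}

/-- Membership in the convex hull of a finite set, tested on countably many linear forms. -/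
lemma mem_convexHull_iff_denseSeq {S : Set (Pt d)} (hS : S.Finite) (x : Pt d) :
    x ∈ convexHull ℝ S ↔ ∀ k : ℕ, ∃ z ∈ S, inner ℝ (TopologicalSpace.denseSeq (Pt d) k) x ≤
      inner ℝ (TopologicalSpace.denseSeq (Pt d) k) z := by
  constructor
  · intro h k
    by_contra! hcon
    set v := TopologicalSpace.denseSeq (Pt d) k
    have hconv : Convex ℝ {w : Pt d | inner ℝ v w < inner ℝ v x} :=
      convex_halfSpace_lt (IsLinearMap.mk (fun a b => inner_add_right _ _ _)
        fun c a => inner_smul_right _ _ _) _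
    have h' : inner ℝ v x < inner ℝ v x := convexHull_min hcon hconv h
    exact lt_irrefl _ h'
  · intro h
    by_contra hcon
    have hcl : IsClosed (convexHull ℝ S) := hS.isClosed_convexHull ℝ
    obtain ⟨l, u, hl1, hl2⟩ := geometric_hahn_banach_closed_point (convex_convexHull ℝ _) hcl hcon
    obtain ⟨v, rfl⟩ := (InnerProductSpace.toDual ℝ (Pt d)).surjective l
    simp only [InnerProductSpace.toDual_apply_apply] at hl1 hl2
    have hopen : IsOpen (⋂ z ∈ S, {w : Pt d | inner ℝ w z < inner ℝ w x}) :=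
      hS.isOpen_biInter fun z _ => isOpen_lt (by fun_prop) (by fun_prop)
    obtain ⟨k, hw⟩ := (TopologicalSpace.denseRange_denseSeq (Pt d)).exists_mem_open hopen
      ⟨v, Set.mem_iInter₂.2 fun z hz => (hl1 z (subset_convexHull ℝ _ hz)).trans hl2⟩
    obtain ⟨z, hz, hzx⟩ := h k
    exact absurd (Set.mem_iInter₂.1 hw z hz) (not_lt.2 hzx)

lemma SpaceForm.mem_hull_iff_exists_finset (X : SpaceForm) {S : Set (Pt d)} {x : Pt d}
    {ι : Type*} {f : ι → Pt d} {T : Set ι} (hS : S = f '' T) :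
    x ∈ X.hull S ↔ ∃ K : Finset ι, (∀ i ∈ K, i ∈ T) ∧ x ∈ X.hull (f '' K) := by
  constructor
  · intro h
    rw [X.mem_hull_iff, convexHull_eq_union_convexHull_finite_subsets] at h
    obtain ⟨t, ht, hx⟩ := Set.mem_iUnion₂.1 h
    rw [hS, Set.image_image] at ht
    classical
    obtain ⟨K, hK, hKt⟩ := Finset.subset_set_image_iff.1 ht
    refine ⟨K, hK, ?_⟩
    rw [X.mem_hull_iff, Set.image_image]
    rwa [← hKt, Finset.coe_image] at hx
  · rintro ⟨K, hK, hx⟩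
    exact X.hull_mono (hS ▸ Set.image_mono hK) hx

/-- A countable base of the topology. -/
lemma exists_seq_basis (d : ℕ) : ∃ U : ℕ → Set (Pt d), (∀ n, IsOpen (U n)) ∧
    ∀ x V, IsOpen V → x ∈ V → ∃ n, x ∈ U n ∧ U n ⊆ V := by
  obtain ⟨U, hU⟩ := (TopologicalSpace.countable_countableBasis (Pt d)).exists_eq_range
    ((TopologicalSpace.isBasis_countableBasis (Pt d)).exists_subset_of_mem_open
      (Set.mem_univ (0 : Pt d)) isOpen_univ |>.imp fun _ h => h.1)
  refine ⟨U, fun n => ?_, fun x V hV hx => ?_⟩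
  · exact TopologicalSpace.isOpen_of_mem_countableBasis (by rw [hU]; exact ⟨n, rfl⟩)
  · obtain ⟨v, hv, hxv, hvV⟩ := (TopologicalSpace.isBasis_countableBasis
      (Pt d)).exists_subset_of_mem_open hx hV
    rw [hU] at hv
    obtain ⟨n, rfl⟩ := hv
    exact ⟨n, hxv, hvV⟩

/-- The base of the topology used to enumerate the points of a locally finite set. -/
noncomputable def baseSet (d n : ℕ) : Set (Pt d) := (exists_seq_basis d).choose n

lemma isOpen_baseSet (n : ℕ) : IsOpen (baseSet d n) := (exists_seq_basis d).choose_spec.1 n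

lemma exists_baseSet_subset {x : Pt d} {V : Set (Pt d)} (hV : IsOpen V) (hx : x ∈ V) :
    ∃ n, x ∈ baseSet d n ∧ baseSet d n ⊆ V := (exists_seq_basis d).choose_spec.2 x V hV hx

open Classical in
/-- The point of `φ` in the `n`-th base set, if there is exactly one. -/
noncomputable def basePoint (n : ℕ) (φ : Set (Pt d)) : Pt d :=
  if h : ∃ x, φ ∩ baseSet d n = {x} then h.choose else 0

lemma basePoint_eq {n : ℕ} {φ : Set (Pt d)} {x : Pt d} (h : φ ∩ baseSet d n = {x}) :
    basePoint n φ = x := by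
  have h' : ∃ x, φ ∩ baseSet d n = {x} := ⟨x, h⟩
  rw [basePoint, dif_pos h']
  exact Set.singleton_injective (h'.choose_spec.symm.trans h)

/-- The `n`-th base set isolates a point of `φ` which no earlier one isolates. -/
def IsFirst (n : ℕ) (φ : Set (Pt d)) : Prop :=
  (φ ∩ baseSet d n).encard = 1 ∧
    ∀ m < n, ¬ ((φ ∩ baseSet d m).encard = 1 ∧ basePoint m φ = basePoint n φ)

lemma inter_eq_basePoint {n : ℕ} {φ : Set (Pt d)} (h : (φ ∩ baseSet d n).encard = 1) :
    φ ∩ baseSet d n = {basePoint n φ} := by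
  obtain ⟨x, hx⟩ := Set.encard_eq_one.1 h
  rw [basePoint_eq hx, hx]

lemma basePoint_mem {n : ℕ} {φ : Set (Pt d)} (h : (φ ∩ baseSet d n).encard = 1) :
    basePoint n φ ∈ φ := by
  have : basePoint n φ ∈ φ ∩ baseSet d n := by rw [inter_eq_basePoint h]; rfl
  exact this.1

/-- Local finiteness of a set of points. -/
def LocFinite (X : SpaceForm) (φ : Set (Pt d)) : Prop := ∀ x r, (φ ∩ X.ball x r).Finite

lemma LocFinite.exists_basePoint {X : SpaceForm} {φ : Set (Pt d)} (hφ : LocFinite X φ) {y : Pt d}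
    (hy : y ∈ φ) : ∃ n, (φ ∩ baseSet d n).encard = 1 ∧ basePoint n φ = y := by
  have hF : ((φ ∩ X.ball y 1) \ {y}).Finite := (hφ y 1).subset Set.sdiff_subset
  have hV : IsOpen ({z | X.dist y z < 1} \ ((φ ∩ X.ball y 1) \ {y})) :=
    (X.isOpen_lt y 1).sdiff hF.isClosed
  obtain ⟨n, hn, hnV⟩ := exists_baseSet_subset hV ⟨by simp, fun h => h.2 rfl⟩
  have h1 : φ ∩ baseSet d n = {y} := by
    ext z
    constructor
    · rintro ⟨hz, hzn⟩
      by_contra hne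
      exact (hnV hzn).2 ⟨⟨hz, X.mem_ball.2 (le_of_lt (hnV hzn).1)⟩, hne⟩
    · rintro rfl; exact ⟨hy, hn⟩
  exact ⟨n, by rw [h1]; simp, basePoint_eq h1⟩

lemma LocFinite.mem_iff {X : SpaceForm} {φ : Set (Pt d)} (hφ : LocFinite X φ) {y : Pt d} :
    y ∈ φ ↔ ∃ n, (φ ∩ baseSet d n).encard = 1 ∧ basePoint n φ = y :=
  ⟨hφ.exists_basePoint, fun ⟨_, h, h'⟩ => h' ▸ basePoint_mem h⟩

open Classical in
lemma LocFinite.tsum_eq {X : SpaceForm} {φ : Set (Pt d)} (hφ : LocFinite X φ)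
    (f : Pt d → ℝ≥0∞) :
    ∑' x : φ, f x = ∑' n, if IsFirst n φ then f (basePoint n φ) else 0 := by
  have hbij : Function.Bijective fun n : {n | IsFirst n φ} =>
      (⟨basePoint (n : ℕ) φ, basePoint_mem n.2.1⟩ : φ) := by
    constructor
    · rintro ⟨n, hn⟩ ⟨m, hm⟩ h
      have h' : basePoint n φ = basePoint m φ := congrArg Subtype.val h
      rcases lt_trichotomy n m with hlt | rfl | hlt
      · exact absurd ⟨hn.1, h'⟩ (hm.2 n hlt)
      · rfl
      · exact absurd ⟨hm.1, h'.symm⟩ (hn.2 m hlt)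
    · rintro ⟨y, hy⟩
      have hex := hφ.exists_basePoint hy
      refine ⟨⟨Nat.find hex, (Nat.find_spec hex).1, fun m hm => ?_⟩,
        Subtype.ext (Nat.find_spec hex).2⟩
      rw [(Nat.find_spec hex).2]
      exact Nat.find_min hex hm
  have h1 := (Equiv.ofBijective _ hbij).tsum_eq fun x : φ => f x
  rw [← h1]
  have h2 := tsum_subtype {n | IsFirst n φ} fun n => f (basePoint n φ)
  simp only [Equiv.ofBijective_apply]
  rw [h2]
  rfl

section Measurable

variable {Ω : Type*} [MeasurableSpace Ω] {X : SpaceForm} {ψ : Ω → Set (Pt d)}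

/-- The numbers of points of a random set in measurable sets are measurable. -/
def HasMeasurableCount (ψ : Ω → Set (Pt d)) : Prop :=
  ∀ B, MeasurableSet B → Measurable (count ψ B)

lemma HasMeasurableCount.measurableSet_encard (hψ : HasMeasurableCount ψ) (n : ℕ) :
    MeasurableSet {ω | (ψ ω ∩ baseSet d n).encard = 1} :=
  hψ _ (isOpen_baseSet n).measurableSet (measurableSet_singleton 1)

lemma HasMeasurableCount.measurable_basePoint (hψ : HasMeasurableCount ψ) (n : ℕ) :
    Measurable fun ω => basePoint n (ψ ω) := by
  intro B hB
  have h1 := hψ.measurableSet_encard n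
  have h2 : MeasurableSet {ω | (ψ ω ∩ (baseSet d n ∩ B)).encard = 1} :=
    hψ _ ((isOpen_baseSet n).measurableSet.inter hB) (measurableSet_singleton 1)
  have e : (fun ω => basePoint n (ψ ω)) ⁻¹' B =
      ({ω | (ψ ω ∩ baseSet d n).encard = 1} ∩ {ω | (ψ ω ∩ (baseSet d n ∩ B)).encard = 1}) ∪
      ({ω | (ψ ω ∩ baseSet d n).encard = 1}ᶜ ∩ {_ω | (0 : Pt d) ∈ B}) := by
    ext ω
    by_cases h : (ψ ω ∩ baseSet d n).encard = 1
    · simp only [Set.mem_preimage, Set.mem_union, Set.mem_inter_iff, Set.mem_compl_iff,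
        Set.mem_ofPred_eq, h, not_true, false_and, or_false, true_and]
      rw [← Set.inter_assoc, inter_eq_basePoint h]
      by_cases hB' : basePoint n (ψ ω) ∈ B
      · rw [Set.inter_eq_left.2 (Set.singleton_subset_iff.2 hB')]; simp [hB']
      · rw [Set.singleton_inter_eq_empty.2 hB']; simp [hB']
    · have : basePoint n (ψ ω) = 0 := by
        rw [basePoint, dif_neg]
        rintro ⟨x, hx⟩
        exact h (by rw [hx]; simp)
      simp [h, this]
  rw [e]
  exact (h1.inter h2).union (h1.compl.inter (MeasurableSet.const _))

lemma HasMeasurableCount.measurableSet_isFirst (hψ : HasMeasurableCount ψ) (n : ℕ) :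
    MeasurableSet {ω | IsFirst n (ψ ω)} := by
  have : {ω | IsFirst n (ψ ω)} = {ω | (ψ ω ∩ baseSet d n).encard = 1} ∩
      ⋂ m ∈ Set.Iio n, ({ω | (ψ ω ∩ baseSet d m).encard = 1} ∩
        {ω | basePoint m (ψ ω) = basePoint n (ψ ω)})ᶜ := by
    ext ω; simp [IsFirst]
  rw [this]
  refine (hψ.measurableSet_encard n).inter (MeasurableSet.biInter (Set.to_countable _) fun m _ => ?_)
  exact ((hψ.measurableSet_encard m).inter (measurableSet_eq_fun (hψ.measurable_basePoint m)
    (hψ.measurable_basePoint n))).compl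

lemma HasMeasurableCount.measurable_tsum (hψ : HasMeasurableCount ψ)
    (hlf : ∀ ω, LocFinite X (ψ ω)) (G : Ω → Pt d → ℝ≥0∞)
    (hG : ∀ x : Ω → Pt d, Measurable x → Measurable fun ω => G ω (x ω)) :
    Measurable fun ω => ∑' x : ψ ω, G ω x := by
  classical
  simp only [fun ω => (hlf ω).tsum_eq (G ω)]
  exact Measurable.tsum fun n => Measurable.ite (hψ.measurableSet_isFirst n)
    (hG _ (hψ.measurable_basePoint n)) measurable_const

lemma measurable_dist {x y : Ω → Pt d} (hx : Measurable x) (hy : Measurable y) :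
    Measurable fun ω => X.dist (x ω) (y ω) := by
  have h := X.continuous_dist.measurable.comp (hx.prodMk hy)
  simpa only [Function.comp_def] using h

lemma measurableSet_mem_hull {x : Ω → Pt d} (hx : Measurable x) (K : Finset ℕ) {z : ℕ → Ω → Pt d}
    (hz : ∀ n, Measurable (z n)) : MeasurableSet {ω | x ω ∈ X.hull ((fun n => z n ω) '' K)} := by
  have hc : Measurable (X.chart : Pt d → Pt d) := X.continuous_chart.measurable
  have : {ω | x ω ∈ X.hull ((fun n => z n ω) '' K)} =
      ⋂ k : ℕ, ⋃ n ∈ K, {ω | inner ℝ (TopologicalSpace.denseSeq (Pt d) k) (X.chart (x ω)) ≤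
        inner ℝ (TopologicalSpace.denseSeq (Pt d) k) (X.chart (z n ω))} := by
    ext ω
    simp only [Set.mem_ofPred_eq, Set.mem_iInter, Set.mem_iUnion]
    rw [X.mem_hull_iff, mem_convexHull_iff_denseSeq ((K.finite_toSet.image _).image _),
      Set.image_image]
    simp only [Set.exists_mem_image, Finset.mem_coe, exists_prop]
  rw [this]
  refine MeasurableSet.iInter fun k => MeasurableSet.biUnion K.countable_toSet fun n _ => ?_
  exact measurableSet_le (measurable_const.inner (hc.comp hx))
    (measurable_const.inner (hc.comp (hz n)))

lemma HasMeasurableCount.measurableSet_mem (hψ : HasMeasurableCount ψ)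
    (hlf : ∀ ω, LocFinite X (ψ ω)) {y : Ω → Pt d} (hy : Measurable y) :
    MeasurableSet {ω | y ω ∈ ψ ω} := by
  have : {ω | y ω ∈ ψ ω} = ⋃ n, ({ω | (ψ ω ∩ baseSet d n).encard = 1} ∩
      {ω | basePoint n (ψ ω) = y ω}) := by
    ext ω; simp [(hlf ω).mem_iff]
  rw [this]
  exact MeasurableSet.iUnion fun n => (hψ.measurableSet_encard n).inter
    (measurableSet_eq_fun (hψ.measurable_basePoint n) hy)

lemma HasMeasurableCount.measurableSet_mem_outNbrs (hψ : HasMeasurableCount ψ)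
    (hlf : ∀ ω, LocFinite X (ψ ω)) {x y : Ω → Pt d} (hx : Measurable x) (hy : Measurable y) :
    MeasurableSet {ω | y ω ∈ outNbrs X (ψ ω) (x ω)} := by
  have e : {ω | y ω ∈ outNbrs X (ψ ω) (x ω)} = {ω | y ω ∈ ψ ω} ∩ {ω | y ω = x ω}ᶜ ∩
      (⋃ K : Finset ℕ, (⋂ n ∈ K, ({ω | (ψ ω ∩ baseSet d n).encard = 1} ∩
        {ω | basePoint n (ψ ω) = x ω}ᶜ ∩
        {ω | X.dist (x ω) (basePoint n (ψ ω)) < X.dist (x ω) (y ω)})) ∩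
        {ω | x ω ∈ X.hull ((fun n => basePoint n (ψ ω)) '' K)})ᶜ := by
    ext ω
    have hS : {z | z ∈ ψ ω ∧ z ≠ x ω ∧ X.dist (x ω) z < X.dist (x ω) (y ω)} =
        (fun n => basePoint n (ψ ω)) '' {n | (ψ ω ∩ baseSet d n).encard = 1 ∧
          basePoint n (ψ ω) ≠ x ω ∧ X.dist (x ω) (basePoint n (ψ ω)) < X.dist (x ω) (y ω)} := by
      ext z
      constructor
      · rintro ⟨h1, h2, h3⟩
        obtain ⟨n, hn, rfl⟩ := (hlf ω).exists_basePoint h1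
        exact ⟨n, ⟨hn, h2, h3⟩, rfl⟩
      · rintro ⟨n, ⟨h1, h2, h3⟩, rfl⟩
        exact ⟨basePoint_mem h1, h2, h3⟩
    rw [Set.mem_ofPred_eq, outNbrs, Set.mem_ofPred_eq, X.mem_hull_iff_exists_finset hS]
    simp only [Set.mem_inter_iff, Set.mem_compl_iff, Set.mem_iUnion, Set.mem_iInter,
      Set.mem_ofPred_eq, and_assoc]
  rw [e]
  refine ((hψ.measurableSet_mem hlf hy).inter (measurableSet_eq_fun hy hx).compl).inter
    (MeasurableSet.iUnion fun K => ?_).compl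
  refine (MeasurableSet.biInter K.countable_toSet fun n _ => ?_).inter
    (measurableSet_mem_hull hx K hψ.measurable_basePoint)
  exact ((hψ.measurableSet_encard n).inter
    (measurableSet_eq_fun (hψ.measurable_basePoint n) hx).compl).inter
    (measurableSet_lt (measurable_dist hx (hψ.measurable_basePoint n)) (measurable_dist hx hy))

end Measurable

lemma tsum_inter_eq_tsum_indicator (A B : Set (Pt d)) (f : Pt d → ℝ≥0∞) :
    ∑' x : ↥(A ∩ B), f x = ∑' x : A, B.indicator f x := by
  rw [tsum_subtype, tsum_subtype, Set.inter_comm, Set.indicator_indicator, Set.inter_comm]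

lemma edgeSum_eq (X : SpaceForm) (α : ℝ) (p : Pt d) (t : ℝ) (φ : Set (Pt d)) :
    edgeSum X α p t φ = 2⁻¹ * ∑' x : φ, (X.ball p t).indicator (fun x => ∑' y : φ,
      {y | y ∈ outNbrs X φ x ∨ x ∈ outNbrs X φ y}.indicator
        (fun y => ENNReal.ofReal (X.dist x y ^ α)) y) x := by
  rw [edgeSum, tsum_inter_eq_tsum_indicator φ (X.ball p t)
    fun x => ∑' y : ↥(allNbrs X φ x), ENNReal.ofReal (X.dist x y ^ α)]
  congr 1
  refine tsum_congr fun x => ?_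
  congr 1
  funext x
  exact tsum_inter_eq_tsum_indicator φ {y | y ∈ outNbrs X φ x ∨ x ∈ outNbrs X φ y}
    fun y => ENNReal.ofReal (X.dist x y ^ α)

/-- The edge functional of a random locally finite set is measurable with respect to the counts. -/
lemma measurable_edgeSum {Ω : Type*} [MeasurableSpace Ω] {X : SpaceForm} {ψ : Ω → Set (Pt d)}
    (hψ : HasMeasurableCount ψ) (hlf : ∀ ω, LocFinite X (ψ ω)) (α : ℝ) (p : Pt d) (t : ℝ) :
    Measurable fun ω => edgeSum X α p t (ψ ω) := by
  classical
  simp only [edgeSum_eq]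
  refine Measurable.const_mul ?_ _
  refine hψ.measurable_tsum hlf (fun ω x => (X.ball p t).indicator (fun x => ∑' y : ψ ω,
      {y | y ∈ outNbrs X (ψ ω) x ∨ x ∈ outNbrs X (ψ ω) y}.indicator
        (fun y => ENNReal.ofReal (X.dist x y ^ α)) y) x) fun x hx => ?_
  simp only [Set.indicator_apply]
  refine Measurable.ite (hx (X.measurableSet_ball p t)) ?_ measurable_const
  refine hψ.measurable_tsum hlf (fun ω y => if y ∈ {y | y ∈ outNbrs X (ψ ω) (x ω) ∨
      x ω ∈ outNbrs X (ψ ω) y} then ENNReal.ofReal (X.dist (x ω) y ^ α) else 0) fun y hy => ?_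
  refine Measurable.ite ((hψ.measurableSet_mem_outNbrs hlf hx hy).union
    (hψ.measurableSet_mem_outNbrs hlf hy hx)) ?_ measurable_const
  exact ((measurable_dist hx hy).pow_const α).ennreal_ofReal

end NNE

/-! ### Square-integrability -/

namespace NNE

variable {d : ℕ} {X : SpaceForm}

lemma exists_norm_chart_lt (X : SpaceForm) (d : ℕ) {κ : ℝ} (hκ : 0 < κ) :
    ∃ ε : ℝ, 0 < ε ∧ ε ≤ 1 ∧ ∀ y : Pt d, X.dist 0 y ≤ ε → ‖X.chart y‖ < κ := by
  have h0 : 0 < X.rad (κ / 2) := by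
    rw [← X.rad_zero]; exact X.rad_strictMono (by positivity)
  refine ⟨min 1 (X.rad (κ / 2)), lt_min one_pos h0, min_le_left _ _, fun y hy => ?_⟩
  have h1 : ‖y‖ ≤ κ / 2 := by
    rw [← X.rad_strictMono.le_iff_le, ← X.dist_zero]
    exact hy.trans (min_le_right _ _)
  have h2 : ‖X.chart y‖ ≤ ‖y‖ := by
    cases X
    · exact le_rfl
    · simp only [SpaceForm.chart, norm_klein]
      exact div_le_self (norm_nonneg _) (one_le_height y)
  linarith

/-- If all the sectors around a centre contain points, then out-edges starting close to this
centre are short. -/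
lemma dist_le_of_sectors {φ : Set (Pt d)} (hφ : LocFinite X φ) (g : Motion X d) {r ε : ℝ}
    (hε : ∀ y : Pt d, X.dist 0 y ≤ ε → ‖X.chart y‖ < (4 * Real.sqrt d)⁻¹) (hd : 1 ≤ d)
    (h : ∀ s : Fin d → Bool, (φ ∩ g '' sector X s r).Nonempty)
    {u v : Pt d} (hu : X.dist (g 0) u ≤ ε) (hv : v ∈ outNbrs X φ u) : X.dist u v ≤ r + ε := by
  by_contra! hcon
  obtain ⟨u', rfl⟩ := g.surjective u
  rw [g.dist_eq] at hu
  refine hv.2.2 ?_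
  set S : Set (Pt d) := {z | g z ∈ φ ∧ ∃ s, z ∈ sector X s r} with hS
  have hSfin : S.Finite := by
    refine Set.Finite.of_finite_image ((hφ (g 0) r).subset ?_) g.injective.injOn
    rintro _ ⟨z, ⟨hz, s, hzs⟩, rfl⟩
    exact ⟨hz, by rw [X.mem_ball, g.dist_eq]; exact hzs.2⟩
  have h1 : u' ∈ X.hull S := by
    refine mem_hull_of_sectors X (r := r) hSfin (hε u' hu).le fun s => ?_
    obtain ⟨_, hz, ⟨z, hzs, rfl⟩⟩ := h s
    exact ⟨z, ⟨hz, s, hzs⟩, hzs⟩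
  refine X.hull_mono ?_ (g.mem_hull _ _ h1)
  rintro _ ⟨z, ⟨hz, s, hzs⟩, rfl⟩
  refine ⟨hz, fun he => ?_, ?_⟩
  · have he' : z = u' := g.injective he
    have h2 := hzs.1 ⟨0, hd⟩
    have h3 := (PiLp.norm_apply_le (X.chart u') ⟨0, hd⟩).trans_lt (hε u' hu)
    rw [he'] at h2
    have h4 : sgn (s ⟨0, hd⟩) * X.chart u' ⟨0, hd⟩ ≤ ‖X.chart u' ⟨0, hd⟩‖ := by
      rw [Real.norm_eq_abs]
      cases s ⟨0, hd⟩
      · simp only [sgn, Bool.false_eq_true, if_false, neg_one_mul]; exact neg_le_abs _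
      · simp only [sgn, if_true, one_mul]; exact le_abs_self _
    linarith
  · rw [g.dist_eq]
    have := X.dist_triangle u' 0 z
    rw [X.dist_comm u' 0] at this
    have := hzs.2
    linarith

lemma edgeSum_le {φ : Set (Pt d)} {α : ℝ} (hα : 0 ≤ α) {p : Pt d} {t R : ℝ} (htR : t ≤ R)
    (h : ∀ x ∈ φ ∩ X.ball p t, allNbrs X φ x ⊆ X.ball p R) :
    edgeSum X α p t φ ≤ ((φ ∩ X.ball p R).encard : ℝ≥0∞) ^ 2 * ENNReal.ofReal ((2 * R) ^ α) := by
  have h1 : ∀ x : ↥(φ ∩ X.ball p t), ∑' y : ↥(allNbrs X φ (x : Pt d)),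
      ENNReal.ofReal (X.dist (x : Pt d) (y : Pt d) ^ α) ≤
      (φ ∩ X.ball p R).encard * ENNReal.ofReal ((2 * R) ^ α) := by
    intro x
    calc _ ≤ ∑' _ : ↥(allNbrs X φ (x : Pt d)), ENNReal.ofReal ((2 * R) ^ α) := by
          refine ENNReal.tsum_le_tsum fun y => ENNReal.ofReal_le_ofReal ?_
          refine Real.rpow_le_rpow (X.dist_nonneg _ _) ?_ hα
          have h1 := h x x.2 y.2
          have h2 := x.2.2
          rw [X.mem_ball] at h1 h2
          have := X.dist_triangle x p y
          rw [X.dist_comm x p] at this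
          linarith
      _ = (allNbrs X φ (x : Pt d)).encard * ENNReal.ofReal ((2 * R) ^ α) := by
          rw [ENNReal.tsum_set_const]
      _ ≤ _ := by
          gcongr
          exact Set.subset_inter (fun y hy => hy.1) (h x x.2)
  calc edgeSum X α p t φ ≤ 1 * ∑' _ : ↥(φ ∩ X.ball p t),
        ((φ ∩ X.ball p R).encard : ℝ≥0∞) * ENNReal.ofReal ((2 * R) ^ α) := by
        rw [edgeSum]
        gcongr with x
        · simp
        · exact h1 x
    _ = (φ ∩ X.ball p t).encard *
        (((φ ∩ X.ball p R).encard : ℝ≥0∞) * ENNReal.ofReal ((2 * R) ^ α)) := by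
        rw [one_mul, ENNReal.tsum_set_const]
    _ ≤ (φ ∩ X.ball p R).encard *
        (((φ ∩ X.ball p R).encard : ℝ≥0∞) * ENNReal.ofReal ((2 * R) ^ α)) := by
        gcongr
        exact X.ball_subset_ball (by simpa using htR)
    _ = _ := by ring

/-- A power is dominated by an exponential of arbitrarily small rate. -/
lemma pow_le_factorial_div_mul_exp (m : ℕ) {β u : ℝ} (hβ : 0 < β) (hu : 0 ≤ u) :
    u ^ m ≤ m.factorial / β ^ m * Real.exp (β * u) := by
  have h := Real.pow_div_factorial_le_exp (β * u) (by positivity) m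
  rw [mul_pow] at h
  have hf : (0 : ℝ) < m.factorial := by positivity
  rw [div_le_iff₀ hf] at h
  rw [div_mul_eq_mul_div, le_div_iff₀ (by positivity)]
  nlinarith

lemma ballVol_add_nat_le (X : SpaceForm) {C : ℝ} (hC : 0 < C)
    (h : ∀ r, 1 ≤ r → X.ballVol d (r + 1) ≤ C * X.ballVol d r) {r : ℝ} (hr : 1 ≤ r) (n : ℕ) :
    X.ballVol d (r + n) ≤ C ^ n * X.ballVol d r := by
  induction n with
  | zero => simp
  | succ n ih =>
    have h1 := h (r + n) (by have : (0 : ℝ) ≤ n := by positivity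
                             linarith)
    rw [add_assoc] at h1
    push_cast
    calc _ ≤ C * X.ballVol d (r + n) := h1
      _ ≤ C * (C ^ n * X.ballVol d r) := by gcongr
      _ = _ := by ring

/-- The tail sums in the second moment bound converge. -/
lemma summable_rpow_mul_exp {α γ b : ℝ} (hα : 0 ≤ α) (hγ : 0 < γ) (hb : 0 ≤ b) :
    Summable fun k : ℕ => (1 + (2 * (k + b)) ^ α) ^ 2 * Real.exp (-(γ * (k + 1))) := by
  obtain ⟨m, hm⟩ := exists_nat_ge α
  set K : ℝ := 4 * ((2 * m).factorial / (γ / 4) ^ (2 * m)) * Real.exp (γ / 4 * (1 + 2 * b)) with hK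
  refine Summable.of_nonneg_of_le (fun k => by positivity) (fun k => ?_)
    (((summable_geometric_of_lt_one (Real.exp_pos (-(γ / 2))).le
      (by rw [Real.exp_lt_one_iff]; linarith))).mul_left K)
  have hk : (0 : ℝ) ≤ k := Nat.cast_nonneg k
  set u : ℝ := 1 + 2 * (k + b) with hu
  have hu1 : 1 ≤ u := by rw [hu]; nlinarith
  have h1 : (2 * ((k : ℝ) + b)) ^ α ≤ u ^ m := by
    calc (2 * ((k : ℝ) + b)) ^ α ≤ u ^ α := Real.rpow_le_rpow (by positivity) (by linarith) hα
      _ ≤ u ^ (m : ℝ) := Real.rpow_le_rpow_of_exponent_le hu1 hm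
      _ = u ^ m := Real.rpow_natCast u m
  have h2 : (1 : ℝ) ≤ u ^ m := one_le_pow₀ hu1
  have h0 : 0 ≤ (2 * ((k : ℝ) + b)) ^ α := by positivity
  have h3 : (1 + (2 * ((k : ℝ) + b)) ^ α) ^ 2 ≤ 4 * u ^ (2 * m) := by
    calc (1 + (2 * ((k : ℝ) + b)) ^ α) ^ 2 ≤ (2 * u ^ m) ^ 2 := by gcongr; linarith
      _ = 4 * u ^ (2 * m) := by rw [mul_comm 2 m, pow_mul]; ring
  have h4 := pow_le_factorial_div_mul_exp (2 * m) (β := γ / 4) (u := u) (by positivity) (by linarith)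
  have h5 : Real.exp (γ / 4 * u) * Real.exp (-(γ * (k + 1))) ≤
      Real.exp (γ / 4 * (1 + 2 * b)) * Real.exp (-(γ / 2)) ^ k := by
    rw [← Real.exp_nat_mul, ← Real.exp_add, ← Real.exp_add]
    apply Real.exp_le_exp.2
    rw [hu]
    nlinarith
  calc _ ≤ (4 * ((2 * m).factorial / (γ / 4) ^ (2 * m) * Real.exp (γ / 4 * u))) *
        Real.exp (-(γ * (k + 1))) := by
        gcongr
        exact h3.trans (by gcongr)
    _ = 4 * ((2 * m).factorial / (γ / 4) ^ (2 * m)) *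
        (Real.exp (γ / 4 * u) * Real.exp (-(γ * (k + 1)))) := by ring
    _ ≤ 4 * ((2 * m).factorial / (γ / 4) ^ (2 * m)) *
        (Real.exp (γ / 4 * (1 + 2 * b)) * Real.exp (-(γ / 2)) ^ k) := by gcongr
    _ = _ := by rw [hK]; ring

section

variable {Ω : Type*} [MeasurableSpace Ω] {P : Measure Ω} {η : Ω → Set (Pt d)}

lemma sq_le_tsum_of_bad {f : ℝ≥0∞} {G : ℕ → ℝ≥0∞} (hG : ∀ k, 1 ≤ G k) (bad : Set ℕ)
    (h : ∀ n, (∀ m ≥ n, m ∉ bad) → f ≤ G n) :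
    f ^ 2 ≤ G 0 ^ 2 + ∑' k, bad.indicator (fun k => G (k + 1) ^ 2) k := by
  by_cases hfin : bad.Finite
  · rcases bad.eq_empty_or_nonempty with rfl | hne
    · exact le_add_right (by gcongr; exact h 0 (by simp))
    · obtain ⟨n, hn, hmax⟩ := hfin.exists_maximal hne
      have h1 : f ≤ G (n + 1) := h (n + 1) fun m hm hmb => by
        have := hmax hmb (by omega : n ≤ m)
        omega
      calc f ^ 2 ≤ G (n + 1) ^ 2 := by gcongr
        _ = bad.indicator (fun k => G (k + 1) ^ 2) n := by rw [Set.indicator_of_mem hn]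
        _ ≤ ∑' k, bad.indicator (fun k => G (k + 1) ^ 2) k := ENNReal.le_tsum n
        _ ≤ _ := le_add_self
  · have h1 : ∑' k, bad.indicator (fun k => G (k + 1) ^ 2) k = ∞ := by
      by_contra hne
      refine hfin ((ENNReal.finite_const_le_of_tsum_ne_top hne one_ne_zero).subset fun k hk => ?_)
      rw [Set.mem_ofPred_eq, Set.indicator_of_mem hk]
      exact one_le_pow₀ (hG _)
    rw [h1]
    simp

/-- The Cauchy-Schwarz inequality for the integral over an event. -/
lemma lintegral_indicator_sq_le {A : Set Ω} (hA : MeasurableSet A) {G : Ω → ℝ≥0∞}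
    (hG : Measurable G) {a b : ℝ} (ha : P A ≤ ENNReal.ofReal a)
    (hb : ∫⁻ ω, G ω ^ 4 ∂P ≤ ENNReal.ofReal b) {c : ℝ} (hc : 0 ≤ c) (ha0 : 0 ≤ a)
    (hab : a * b ≤ c ^ 2) :
    ∫⁻ ω, A.indicator (fun ω => G ω ^ 2) ω ∂P ≤ ENNReal.ofReal c := by
  have h1 := ENNReal.lintegral_mul_le_Lp_mul_Lq P Real.HolderConjugate.two_two
    (f := A.indicator 1) (g := fun ω => G ω ^ 2)
    ((measurable_one.indicator hA).aemeasurable) (hG.pow_const 2).aemeasurable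
  have e1 : (A.indicator 1 * fun ω => G ω ^ 2) = A.indicator fun ω => G ω ^ 2 := by
    ext ω; by_cases h : ω ∈ A <;> simp [h]
  have e2 : (fun ω => A.indicator (1 : Ω → ℝ≥0∞) ω ^ (2 : ℝ)) = A.indicator 1 := by
    ext ω; by_cases h : ω ∈ A <;> simp [h]
  have e3 : (fun ω => (G ω ^ 2) ^ (2 : ℝ)) = fun ω => G ω ^ 4 := by
    ext ω
    rw [show (2 : ℝ) = ((2 : ℕ) : ℝ) by norm_num, ENNReal.rpow_natCast, ← pow_mul]
  rw [e1, e2, e3, lintegral_indicator_one hA, ← ENNReal.mul_rpow_of_nonneg _ _ (by norm_num)] at h1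
  refine h1.trans ?_
  calc (P A * ∫⁻ ω, G ω ^ 4 ∂P) ^ (1 / (2 : ℝ))
      ≤ (ENNReal.ofReal a * ENNReal.ofReal b) ^ (1 / (2 : ℝ)) := by gcongr
    _ ≤ (ENNReal.ofReal (c ^ 2)) ^ (1 / (2 : ℝ)) := by
        rw [← ENNReal.ofReal_mul ha0]; gcongr
    _ = ENNReal.ofReal c := by
        rw [ENNReal.ofReal_rpow_of_nonneg (by positivity) (by norm_num), ← Real.sqrt_eq_rpow,
          Real.sqrt_sq hc]

end

end NNE

namespace NNE

variable {d : ℕ} {X : SpaceForm} {Ω : Type*} [MeasurableSpace Ω] {P : Measure Ω}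
  {η : Ω → Set (Pt d)}

lemma exists_uniform_vol_sector (X : SpaceForm) (hd : 1 ≤ d) :
    ∃ q : ℝ, 0 < q ∧ ∀ (s : Fin d → Bool) (r : ℝ),
      q * (X.ballVol d r - X.ballVol d (X.rad 1)) ≤ (X.vol d).real (sector X s r) := by
  choose q hq0 hq using fun s : Fin d → Bool => exists_mul_sub_le_vol_sector X hd s
  obtain ⟨s₀, _, hs₀⟩ := Finset.univ.exists_min_image q ⟨fun _ => true, Finset.mem_univ _⟩
  refine ⟨q s₀, hq0 s₀, fun s r => ?_⟩
  rcases le_total 0 (X.ballVol d r - X.ballVol d (X.rad 1)) with h | h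
  · exact (mul_le_mul_of_nonneg_right (hs₀ s (Finset.mem_univ _)) h).trans (hq s r)
  · exact (mul_nonpos_of_nonneg_of_nonpos (hq0 s₀).le h).trans measureReal_nonneg

/-- Some sector of radius `r` around some centre in `T` contains no point. -/
def missEvent (X : SpaceForm) (η : Ω → Set (Pt d)) (T : Finset (Pt d)) (r : ℝ) : Set Ω :=
  ⋃ c ∈ T, ⋃ s : Fin d → Bool, {ω | count η (Motion.ofPoint X c '' sector X s r) ω = 0}

lemma measurableSet_missEvent (h : IsPoissonProcess X d P η) (T : Finset (Pt d)) (r : ℝ) :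
    MeasurableSet (missEvent X η T r) :=
  MeasurableSet.biUnion T.countable_toSet fun c _ => MeasurableSet.iUnion fun s =>
    h.measurable_count _ ((Motion.ofPoint X c).measurableSet_image (measurableSet_sector X s r))
      (measurableSet_singleton 0)

lemma prob_missEvent_le (h : IsPoissonProcess X d P η) (T : Finset (Pt d)) {q r : ℝ}
    (hq : ∀ (s : Fin d → Bool), q * (X.ballVol d r - X.ballVol d (X.rad 1)) ≤
      (X.vol d).real (sector X s r)) :
    P (missEvent X η T r) ≤ ENNReal.ofReal
      (T.card * 2 ^ d * Real.exp (-(q * (X.ballVol d r - X.ballVol d (X.rad 1))))) := by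
  set e := Real.exp (-(q * (X.ballVol d r - X.ballVol d (X.rad 1)))) with he
  have h1 : ∀ c s, P {ω | count η (Motion.ofPoint X c '' sector X s r) ω = 0} ≤
      ENNReal.ofReal e := by
    intro c s
    have hvol : X.vol d (Motion.ofPoint X c '' sector X s r) = X.vol d (sector X s r) :=
      Motion.vol_image _
    rw [h.prob_count_eq_zero ((Motion.ofPoint X c).measurableSet_image (measurableSet_sector X s r))
      (by rw [hvol]; exact ((measure_mono (sector_subset_ball X s r)).trans_lt
        (X.vol_ball_lt_top 0 r)).ne), measureReal_def, hvol, ← measureReal_def]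
    apply ENNReal.ofReal_le_ofReal
    rw [he]
    exact Real.exp_le_exp.2 (neg_le_neg (hq s))
  calc P (missEvent X η T r)
      ≤ ∑ c ∈ T, ∑ s : Fin d → Bool,
          P {ω | count η (Motion.ofPoint X c '' sector X s r) ω = 0} :=
        (measure_biUnion_finset_le _ _).trans
          (Finset.sum_le_sum fun c _ => measure_iUnion_fintype_le _ _)
    _ ≤ ∑ c ∈ T, ∑ s : Fin d → Bool, ENNReal.ofReal e :=
        Finset.sum_le_sum fun c _ => Finset.sum_le_sum fun s _ => h1 c s
    _ = ENNReal.ofReal (T.card * 2 ^ d * e) := by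
        simp only [Finset.sum_const, Finset.card_univ, Fintype.card_pi, Fintype.card_bool,
          Finset.prod_const, Fintype.card_fin, nsmul_eq_mul]
        rw [ENNReal.ofReal_mul (by positivity), ENNReal.ofReal_mul (by positivity),
          ENNReal.ofReal_pow (by norm_num)]
        simp
        ring

/-- The square of the number of points times a constant, plus one, has a finite fourth moment. -/
lemma lintegral_one_add_count_le (h : IsPoissonProcess X d P η) [IsProbabilityMeasure P]
    {C : NNReal} (hC : ∀ r : NNReal, ∫⁻ n, (n : ℝ≥0∞) ^ 8 ∂poissonMeasure r ≤ C * (1 + r) ^ 8)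
    (p : Pt d) (R : ℝ) {a : ℝ} (ha : 0 ≤ a) :
    ∫⁻ ω, (1 + (count η (X.ball p R) ω : ℝ≥0∞) ^ 2 * ENNReal.ofReal a) ^ 4 ∂P ≤
      ENNReal.ofReal (16 * (1 + C) * (1 + a) ^ 4 * (1 + X.ballVol d R) ^ 8) := by
  set V := X.ballVol d R with hV
  have hV0 : 0 ≤ V := X.ballVol_nonneg R
  have h1 : ∀ x : ℝ≥0∞, (1 + x) ^ 4 ≤ 16 * (1 + x ^ 4) := by
    intro x
    rcases le_total x 1 with hx | hx
    · calc (1 + x) ^ 4 ≤ (1 + 1) ^ 4 := by gcongr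
        _ = 16 * (1 + 0) := by norm_num
        _ ≤ _ := by gcongr; exact zero_le
    · calc (1 + x) ^ 4 ≤ (x + x) ^ 4 := by gcongr
        _ = 16 * x ^ 4 := by ring
        _ ≤ _ := by gcongr; exact le_add_self
  have hm : Measurable fun ω => (count η (X.ball p R) ω : ℝ≥0∞) :=
    (measurable_of_countable _).comp (h.measurable_count _ (X.measurableSet_ball p R))
  have h2 : ∫⁻ ω, (count η (X.ball p R) ω : ℝ≥0∞) ^ 8 ∂P ≤ ENNReal.ofReal (C * (1 + V) ^ 8) := by
    rw [h.lintegral_count (X.measurableSet_ball p R) (X.vol_ball_lt_top p R).ne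
      fun n => (n : ℝ≥0∞) ^ 8]
    refine (hC _).trans ?_
    rw [ENNReal.ofReal_mul (by positivity), ENNReal.ofReal_pow (by positivity),
      ENNReal.ofReal_add (by norm_num) hV0, ENNReal.ofReal_coe_nnreal, ENNReal.ofReal_one,
      ENNReal.coe_toNNReal (X.vol_ball_lt_top p R).ne, X.vol_ball_eq]
  calc _ ≤ ∫⁻ ω, 16 * (1 + ((count η (X.ball p R) ω : ℝ≥0∞) ^ 8 * ENNReal.ofReal (a ^ 4))) ∂P := by
        refine lintegral_mono fun ω => (h1 _).trans ?_
        rw [mul_pow, ← pow_mul, ENNReal.ofReal_pow ha]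
    _ = 16 * (1 + (∫⁻ ω, (count η (X.ball p R) ω : ℝ≥0∞) ^ 8 ∂P) * ENNReal.ofReal (a ^ 4)) := by
        rw [lintegral_const_mul _ (by fun_prop), lintegral_add_left measurable_const,
          lintegral_mul_const _ (by fun_prop)]
        simp
    _ ≤ 16 * (1 + ENNReal.ofReal (C * (1 + V) ^ 8) * ENNReal.ofReal (a ^ 4)) := by gcongr
    _ = ENNReal.ofReal (16 * (1 + (C * (1 + V) ^ 8) * a ^ 4)) := by
        rw [← ENNReal.ofReal_mul (by positivity), ← ENNReal.ofReal_one,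
          ← ENNReal.ofReal_add (by norm_num) (by positivity),
          show (16 : ℝ≥0∞) = ENNReal.ofReal 16 by simp, ← ENNReal.ofReal_mul (by norm_num)]
    _ ≤ _ := by
        apply ENNReal.ofReal_le_ofReal
        have h3 : (1 : ℝ) ≤ (1 + a) ^ 4 := one_le_pow₀ (by linarith)
        have h4 : a ^ 4 ≤ (1 + a) ^ 4 := by gcongr; linarith
        have h5 : (1 : ℝ) ≤ (1 + V) ^ 8 := one_le_pow₀ (by linarith)
        have h6 : (0 : ℝ) ≤ C := C.2
        have h7 : (1 : ℝ) ≤ (1 + a) ^ 4 * (1 + V) ^ 8 := one_le_mul_of_one_le_of_one_le h3 h5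
        calc 16 * (1 + (C * (1 + V) ^ 8) * a ^ 4)
            ≤ 16 * ((1 + a) ^ 4 * (1 + V) ^ 8 + (C * (1 + V) ^ 8) * (1 + a) ^ 4) := by gcongr
          _ = _ := by ring

lemma allNbrs_subset_ball {φ : Set (Pt d)} {p : Pt d} {t : ℝ} (n₀ n : ℕ) (hn₀ : t + 3 ≤ n₀)
    (hgood : ∀ m ≥ n, ∀ u ∈ X.ball p (n₀ + m + 1), ∀ v ∈ outNbrs X φ u, X.dist u v ≤ m + 2)
    {x : Pt d} (hx : x ∈ φ ∩ X.ball p t) : allNbrs X φ x ⊆ X.ball p (n₀ + n) := by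
  intro y hy
  by_contra hcon
  rw [X.mem_ball, not_le] at hcon
  have h0 : 0 ≤ X.dist p y - n₀ := by
    have : (0 : ℝ) ≤ n := Nat.cast_nonneg n
    linarith
  set m := ⌊X.dist p y - n₀⌋₊ with hm
  have hm1 : (m : ℝ) ≤ X.dist p y - n₀ := Nat.floor_le h0
  have hm2 : X.dist p y - n₀ < m + 1 := Nat.lt_floor_add_one _
  have hmn : m ≥ n := Nat.le_floor (by linarith)
  have hxt : X.dist p x ≤ t := hx.2
  have hm0 : (0 : ℝ) ≤ m := Nat.cast_nonneg m
  have hxm : x ∈ X.ball p (n₀ + m + 1) := by rw [X.mem_ball]; linarith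
  have hym : y ∈ X.ball p (n₀ + m + 1) := by rw [X.mem_ball]; linarith
  have hxy : X.dist x y ≤ m + 2 := by
    rcases hy.2 with h | h
    · exact hgood m hmn x hxm y h
    · rw [X.dist_comm]; exact hgood m hmn y hym x h
  have := X.dist_triangle p x y
  linarith

/-- Exponential decay beats the polynomial factors in the tail bound. -/
lemma tail_term_le {q D U a K B V x : ℝ} (hq : 0 < q) (hD : 0 ≤ D) (hU : 0 ≤ U)
    (ha : 0 ≤ a) (hK : 0 ≤ K) (hB : 0 ≤ B) (hxU : x * 2 ≤ q / 2 * U) :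
    K * U * Real.exp (-(q * (U - V))) * (16 * (1 + B) * (1 + a) ^ 4 * (1 + D * U) ^ 8) ≤
      K * Real.exp (q * V) * (16 * (1 + B) * (1 + D) ^ 8) *
        ((9 : ℕ).factorial / (q / 2) ^ 9 * Real.exp (q / 2)) *
        ((1 + a) ^ 2 * Real.exp (-x)) ^ 2 := by
  have h1 : U ≤ 1 + U := by linarith
  have h2 : 1 + D * U ≤ (1 + D) * (1 + U) := by nlinarith
  have h3 : (1 + U) ^ 9 ≤ (9 : ℕ).factorial / (q / 2) ^ 9 * Real.exp (q / 2 * (1 + U)) :=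
    pow_le_factorial_div_mul_exp 9 (by positivity) (by linarith)
  set K₂ : ℝ := (9 : ℕ).factorial / (q / 2) ^ 9 with hK₂
  have hK₂0 : 0 < K₂ := by positivity
  have h4 : Real.exp (-(q / 2 * U)) ≤ Real.exp (-x) ^ 2 := by
    rw [← Real.exp_nat_mul]
    apply Real.exp_le_exp.2
    push_cast
    linarith
  have e1 : Real.exp (-(q * (U - V))) = Real.exp (q * V) * Real.exp (-(q * U)) := by
    rw [← Real.exp_add]; congr 1; ring
  have e2 : Real.exp (q / 2 * (1 + U)) * Real.exp (-(q * U)) =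
      Real.exp (q / 2) * Real.exp (-(q / 2 * U)) := by
    rw [← Real.exp_add, ← Real.exp_add]; congr 1; ring
  calc K * U * Real.exp (-(q * (U - V))) * (16 * (1 + B) * (1 + a) ^ 4 * (1 + D * U) ^ 8)
      ≤ K * (1 + U) * Real.exp (-(q * (U - V))) *
        (16 * (1 + B) * (1 + a) ^ 4 * ((1 + D) * (1 + U)) ^ 8) := by gcongr
    _ = K * Real.exp (q * V) * (16 * (1 + B) * (1 + D) ^ 8) * (1 + a) ^ 4 *
        ((1 + U) ^ 9 * Real.exp (-(q * U))) := by rw [e1]; ring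
    _ ≤ K * Real.exp (q * V) * (16 * (1 + B) * (1 + D) ^ 8) * (1 + a) ^ 4 *
        ((K₂ * Real.exp (q / 2 * (1 + U))) * Real.exp (-(q * U))) := by gcongr
    _ = K * Real.exp (q * V) * (16 * (1 + B) * (1 + D) ^ 8) * (K₂ * Real.exp (q / 2)) *
        (1 + a) ^ 4 * Real.exp (-(q / 2 * U)) := by
        rw [mul_assoc K₂, e2]; ring
    _ ≤ K * Real.exp (q * V) * (16 * (1 + B) * (1 + D) ^ 8) * (K₂ * Real.exp (q / 2)) *
        (1 + a) ^ 4 * Real.exp (-x) ^ 2 := by gcongr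
    _ = _ := by ring

set_option maxHeartbeats 1600000 in
/-- The edge functional has a finite second moment. -/
theorem lintegral_edgeSum_sq_ne_top (h : IsPoissonProcess X d P η) [IsProbabilityMeasure P]
    (hd : 1 ≤ d) {α : ℝ} (hα : 0 ≤ α) (p : Pt d) (t : ℝ) :
    ∫⁻ ω, edgeSum X α p t (η ω) ^ 2 ∂P ≠ ∞ := by
  have hd' : 0 < Real.sqrt d := Real.sqrt_pos.2 (by exact_mod_cast hd)
  obtain ⟨ε, hε0, hε1, hε⟩ := exists_norm_chart_lt X d (κ := (4 * Real.sqrt d)⁻¹) (by positivity)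
  obtain ⟨q, hq0, hq⟩ := exists_uniform_vol_sector X hd
  obtain ⟨C, hC0, hC⟩ := X.exists_ballVol_add_one_le d
  obtain ⟨c, hc0, hc⟩ := X.exists_mul_le_ballVol hd
  obtain ⟨C₈, hC₈⟩ := exists_poisson_moment_le 8
  have hVε : 0 < X.ballVol d (ε / 2) := X.ballVol_pos (by positivity)
  set n₀ : ℕ := ⌈t⌉₊ + 3 with hn₀
  have htn : t + 3 ≤ n₀ := by
    rw [hn₀]; push_cast; linarith [Nat.le_ceil t]
  choose T hT1 hT2 hT3 using fun k : ℕ => X.exists_separated_net p (n₀ + k + 1) hε0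
  set bad : ℕ → Set Ω := fun k => missEvent X η (T k) (k + 1) with hbad
  set a : ℕ → ℝ := fun k => (2 * (n₀ + k)) ^ α with ha
  have ha0 : ∀ k, 0 ≤ a k := fun k => by simp only [ha]; positivity
  set G : ℕ → Ω → ℝ≥0∞ := fun k ω =>
    1 + (count η (X.ball p (n₀ + k)) ω : ℝ≥0∞) ^ 2 * ENNReal.ofReal (a k) with hG
  have hGm : ∀ k, Measurable (G k) := fun k => by
    have hm : Measurable fun ω => (count η (X.ball p (n₀ + k)) ω : ℝ≥0∞) :=
      (measurable_of_countable _).comp (h.measurable_count _ (X.measurableSet_ball p _))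
    fun_prop
  have hbadm : ∀ k, MeasurableSet (bad k) := fun k => measurableSet_missEvent h _ _
  -- a level without empty sectors has only short out-edges
  have hgood : ∀ ω m, ω ∉ bad m → ∀ u ∈ X.ball p (n₀ + m + 1), ∀ v ∈ outNbrs X (η ω) u,
      X.dist u v ≤ m + 2 := by
    intro ω m hm u hu v hv
    obtain ⟨c, hcT, hcu⟩ := hT3 m u hu
    have h1 := dist_le_of_sectors (h.locallyFinite ω) (Motion.ofPoint X c) (r := m + 1) hε hd
      (fun s => ?_) (by rw [Motion.ofPoint_zero]; exact hcu) hv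
    · linarith
    · by_contra hemp
      refine hm (Set.mem_biUnion hcT (Set.mem_iUnion.2 ⟨s, ?_⟩))
      rw [Set.not_nonempty_iff_eq_empty] at hemp
      rw [Set.mem_ofPred_eq, count, hemp, Set.encard_empty]
  have hpt : ∀ ω, edgeSum X α p t (η ω) ^ 2 ≤
      G 0 ω ^ 2 + ∑' k, (bad k).indicator (fun ω => G (k + 1) ω ^ 2) ω := by
    intro ω
    have := sq_le_tsum_of_bad (f := edgeSum X α p t (η ω)) (G := fun k => G k ω)
      (fun k => le_self_add) {k | ω ∈ bad k} ?_
    · refine this.trans (le_of_eq ?_)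
      congr 1
    · intro n hn
      have hedge := edgeSum_le (φ := η ω) hα (p := p) (t := t) (R := n₀ + n)
        (by have : (0 : ℝ) ≤ n := Nat.cast_nonneg n
            linarith)
        fun x hx => allNbrs_subset_ball n₀ n htn (fun m hm => hgood ω m (hn m hm)) hx
      exact hedge.trans le_add_self
  -- the constants in the tail bound
  set D : ℝ := C ^ (n₀ + 1) with hD
  have hD0 : 0 < D := by positivity
  set U : ℕ → ℝ := fun k => X.ballVol d (k + 1) with hU
  have hU0 : ∀ k, 0 ≤ U k := fun k => X.ballVol_nonneg _
  have hVU : ∀ k : ℕ, X.ballVol d (n₀ + k + 2) ≤ D * U k := by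
    intro k
    have := ballVol_add_nat_le X hC0 hC (r := k + 1)
      (by have : (0 : ℝ) ≤ k := Nat.cast_nonneg k
          linarith) (n₀ + 1)
    refine le_trans (le_of_eq ?_) this
    congr 1; push_cast; ring
  have hUc : ∀ k : ℕ, c * (k + 1) ≤ U k := fun k => by
    have := hc (k + 1); push_cast at this; exact this
  set V₁ := X.ballVol d (X.rad 1) with hV₁
  set K₁ : ℝ := 2 ^ d * D / X.ballVol d (ε / 2) with hK₁
  have hPbad : ∀ k, P (bad k) ≤ ENNReal.ofReal (K₁ * U k * Real.exp (-(q * (U k - V₁)))) := by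
    intro k
    refine (prob_missEvent_le h (T k) (q := q) fun s => hq s _).trans
      (ENNReal.ofReal_le_ofReal ?_)
    refine mul_le_mul_of_nonneg_right ?_ (Real.exp_pos _).le
    have hcard := (hT2 k).card_mul_le (hT1 k)
    have h1 : X.ballVol d (n₀ + k + 1 + ε / 2) ≤ D * U k :=
      (X.ballVol_mono (by linarith)).trans (hVU k)
    have h2 : ((T k).card : ℝ) ≤ D * U k / X.ballVol d (ε / 2) := by
      rw [le_div_iff₀ hVε]; exact hcard.trans h1
    calc ((T k).card : ℝ) * 2 ^ d ≤ D * U k / X.ballVol d (ε / 2) * 2 ^ d := by gcongr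
      _ = K₁ * U k := by rw [hK₁]; ring
  have hG4 : ∀ k, ∫⁻ ω, G (k + 1) ω ^ 4 ∂P ≤
      ENNReal.ofReal (16 * (1 + C₈) * (1 + a (k + 1)) ^ 4 * (1 + D * U k) ^ 8) := by
    intro k
    refine (lintegral_one_add_count_le h hC₈ p _ (ha0 _)).trans (ENNReal.ofReal_le_ofReal ?_)
    have h1 : X.ballVol d (n₀ + (k + 1 : ℕ)) ≤ D * U k := by
      refine (X.ballVol_mono ?_).trans (hVU k)
      push_cast; linarith
    have h2 := X.ballVol_nonneg (d := d) (n₀ + (k + 1 : ℕ))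
    have h3 := ha0 (k + 1)
    gcongr
  have hK₁0 : 0 < K₁ := by positivity
  set K₃ : ℝ := K₁ * Real.exp (q * V₁) * (16 * (1 + C₈) * (1 + D) ^ 8) *
    ((9 : ℕ).factorial / (q / 2) ^ 9 * Real.exp (q / 2)) with hK₃
  have hK₃0 : 0 ≤ K₃ := by positivity
  set S : ℕ → ℝ := fun k => Real.sqrt K₃ * ((1 + a (k + 1)) ^ 2 *
    Real.exp (-(q * c / 4 * (k + 1)))) with hS
  have hS0 : ∀ k, 0 ≤ S k := fun k => by positivity
  have hterm : ∀ k, ∫⁻ ω, (bad k).indicator (fun ω => G (k + 1) ω ^ 2) ω ∂P ≤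
      ENNReal.ofReal (S k) := by
    intro k
    have hUk := hU0 k
    have hak := ha0 (k + 1)
    refine lintegral_indicator_sq_le (hbadm k) (hGm (k + 1)) (hPbad k) (hG4 k) (hS0 k)
      (by positivity) ?_
    have hexp : (q * c / 4 * (k + 1)) * 2 ≤ q / 2 * U k := by
      have := hUc k
      nlinarith
    rw [hS, mul_pow, Real.sq_sqrt hK₃0]
    exact tail_term_le hq0 hD0.le (hU0 k) (ha0 (k + 1)) hK₁0.le C₈.2 hexp
  have hSsum : Summable S := by
    refine Summable.mul_left _ ?_
    refine (summable_rpow_mul_exp (γ := q * c / 4) (b := n₀ + 1) hα (by positivity)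
      (by positivity)).congr fun k => ?_
    simp only [ha]
    push_cast
    congr 4
    ring
  have hfirst : ∫⁻ ω, G 0 ω ^ 2 ∂P ≠ ∞ := by
    have h1 : ∫⁻ ω, G 0 ω ^ 2 ∂P ≤ ∫⁻ ω, G 0 ω ^ 4 ∂P :=
      lintegral_mono fun ω => pow_le_pow_right₀ le_self_add (by norm_num)
    exact ne_top_of_le_ne_top ENNReal.ofReal_ne_top
      (h1.trans (lintegral_one_add_count_le h hC₈ p (n₀ + (0 : ℕ)) (ha0 0)))
  have htail : ∑' k, ∫⁻ ω, (bad k).indicator (fun ω => G (k + 1) ω ^ 2) ω ∂P ≠ ∞ := by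
    refine ne_top_of_le_ne_top ?_ (ENNReal.tsum_le_tsum hterm)
    rw [← ENNReal.ofReal_tsum_of_nonneg hS0 hSsum]
    exact ENNReal.ofReal_ne_top
  refine ne_top_of_le_ne_top ?_ (lintegral_mono hpt)
  rw [lintegral_add_left ((hGm 0).pow_const 2),
    lintegral_tsum fun k => (((hGm (k + 1)).pow_const 2).indicator (hbadm k)).aemeasurable]
  exact ENNReal.add_ne_top.2 ⟨hfirst, htail⟩

end NNE

/-! ### Adding a point inside an isolated cluster -/

namespace NNE

variable {d : ℕ} {X : SpaceForm}

/-- A finite net `n` of the unit sphere, together with a number `ρ` so small that perturbations of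
the points of the net by `ρ` keep them in convex position. -/
structure IsSphereNet {m : ℕ} (n : Fin m → Pt d) (ρ : ℝ) : Prop where
  pos : 0 < ρ
  le : ρ ≤ 1 / 20
  norm_eq : ∀ j, ‖n j‖ = 1
  net : ∀ q : Pt d, ‖q‖ = 1 → ∃ j, ‖n j - q‖ ≤ 1 / 20
  inner_le : ∀ i j, i ≠ j → inner ℝ (n i) (n j) ≤ 1 - 2 * ρ

lemma exists_isSphereNet (d : ℕ) : ∃ (m : ℕ) (n : Fin m → Pt d) (ρ : ℝ), IsSphereNet n ρ := by
  obtain ⟨t, hts, htf, ht⟩ := (isCompact_sphere (0 : Pt d) 1).finite_cover_balls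
    (e := 1 / 20) (by norm_num)
  obtain ⟨m, ⟨e⟩⟩ := htf.to_subtype.exists_equiv_fin
  set n : Fin m → Pt d := fun j => (e.symm j : Pt d) with hn
  have hnorm : ∀ j, ‖n j‖ = 1 := fun j => by simpa using hts (e.symm j).2
  have hinj : ∀ i j, i ≠ j → inner ℝ (n i) (n j) < 1 := fun i j hij => by
    rw [inner_lt_one_iff_real_of_norm_eq_one (hnorm i) (hnorm j)]
    exact fun h => hij (e.symm.injective (Subtype.ext h))
  have h1 : ∀ᶠ ρ : ℝ in nhdsWithin 0 (Set.Ioi 0), ∀ i j, i ≠ j →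
      inner ℝ (n i) (n j) ≤ 1 - 2 * ρ := by
    rw [Filter.eventually_all]
    intro i
    rw [Filter.eventually_all]
    intro j
    by_cases hij : i = j
    · exact Filter.Eventually.of_forall fun ρ h => absurd hij h
    · have hc : Continuous fun ρ : ℝ => 1 - 2 * ρ := by fun_prop
      have h2 : ∀ᶠ ρ : ℝ in nhds 0, inner ℝ (n i) (n j) < 1 - 2 * ρ :=
        hc.continuousAt.eventually_const_lt (by simpa using hinj i j hij)
      exact (h2.filter_mono nhdsWithin_le_nhds).mono fun ρ h _ => h.le
  have h2 : ∀ᶠ ρ : ℝ in nhdsWithin 0 (Set.Ioi 0), ρ ∈ Set.Ioo (0 : ℝ) (1 / 20) :=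
    Ioo_mem_nhdsGT (by norm_num)
  obtain ⟨ρ, h3, h4⟩ := (h1.and h2).exists
  refine ⟨m, n, ρ, h4.1, h4.2.le, hnorm, fun q hq => ?_, h3⟩
  obtain ⟨x, hx, hqx⟩ := Set.mem_iUnion₂.1 (ht (mem_sphere_zero_iff_norm.2 hq))
  refine ⟨e ⟨x, hx⟩, ?_⟩
  rw [mem_ball_iff_norm, norm_sub_rev] at hqx
  simpa [hn] using hqx.le

/-- The points `c` form a cluster: their tenfold blow-up in the chart is close to the net `n`. -/
def IsCluster (X : SpaceForm) {m : ℕ} (n : Fin m → Pt d) (ρ : ℝ) (c : Fin m → Pt d) : Prop :=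
  ∀ j, ‖(10 : ℝ) • X.chart (c j) - n j‖ < ρ

section Cluster

variable {m : ℕ} {n : Fin m → Pt d} {ρ : ℝ} {c : Fin m → Pt d}

lemma IsCluster.exists_near (hn : IsSphereNet n ρ) (hc : IsCluster X n ρ c) {q : Pt d}
    (hq : ‖q‖ = 1) : ∃ j, ‖(10 : ℝ) • X.chart (c j) - q‖ < 1 / 10 := by
  obtain ⟨j, hj⟩ := hn.net q hq
  refine ⟨j, ?_⟩
  have h1 := hc j
  have h2 := hn.le
  calc _ = ‖((10 : ℝ) • X.chart (c j) - n j) + (n j - q)‖ := by congr 1; abel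
    _ ≤ _ := norm_add_le _ _
    _ < _ := by linarith

/-- Every ray from the origin meets the hull of the cluster points near its direction `θ`: a
separating hyperplane would leave out the cluster points near a slightly tilted direction. -/
lemma IsCluster.exists_smul_mem (hn : IsSphereNet n ρ) (hc : IsCluster X n ρ c) {θ : Pt d}
    (hθ : ‖θ‖ = 1) : ∃ s : ℝ, 0 < s ∧ s < 3 / 20 ∧
      s • θ ∈ convexHull ℝ (X.chart '' {z | ∃ j, c j = z ∧ ‖(10 : ℝ) • X.chart z - θ‖ < 1 / 2}) := by
  set A : Set (Pt d) := X.chart '' {z | ∃ j, c j = z ∧ ‖(10 : ℝ) • X.chart z - θ‖ < 1 / 2} with hA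
  have hAfin : A.Finite := by
    refine Set.Finite.image _ ((Set.finite_range c).subset ?_)
    rintro z ⟨j, rfl, _⟩; exact ⟨j, rfl⟩
  have hsub : convexHull ℝ A ⊆ Metric.ball ((1 / 10 : ℝ) • θ) (1 / 20) := by
    refine convexHull_min ?_ (convex_ball _ _)
    rintro _ ⟨z, ⟨j, rfl, hj⟩, rfl⟩
    rw [mem_ball_iff_norm]
    have : X.chart (c j) - (1 / 10 : ℝ) • θ = (1 / 10 : ℝ) • ((10 : ℝ) • X.chart (c j) - θ) := by
      module
    rw [this, norm_smul, Real.norm_of_nonneg (by norm_num)]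
    linarith
  set R : Set (Pt d) := (fun s : ℝ => s • θ) '' Set.Ici 0 with hR
  have hRconv : Convex ℝ R := by
    have := (convex_Ici (0 : ℝ)).linear_image (LinearMap.toSpanSingleton ℝ (Pt d) θ)
    exact this
  have hRclosed : IsClosed R := isClosedMap_smul_left θ _ isClosed_Ici
  by_cases hdis : Disjoint (convexHull ℝ A) R
  · exfalso
    obtain ⟨l, u, v, h1, huv, h2⟩ := geometric_hahn_banach_compact_closed (convex_convexHull ℝ A)
      (hAfin.isCompact_convexHull ℝ) hRconv hRclosed hdis
    obtain ⟨w, rfl⟩ := (InnerProductSpace.toDual ℝ (Pt d)).surjective l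
    simp only [InnerProductSpace.toDual_apply_apply] at h1 h2
    have hv : v < 0 := by simpa using h2 0 ⟨0, Set.mem_Ici.2 le_rfl, by simp⟩
    have hwθ : 0 ≤ inner ℝ w θ := by
      by_contra! hneg
      have := h2 ((v / inner ℝ w θ) • θ) ⟨v / inner ℝ w θ,
        Set.mem_Ici.2 (div_nonneg_of_nonpos hv.le hneg.le), rfl⟩
      rw [inner_smul_right, div_mul_cancel₀ _ hneg.ne] at this
      exact lt_irrefl _ this
    have hw0 : w ≠ 0 := by
      rintro rfl
      obtain ⟨j, hj⟩ := hc.exists_near hn hθ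
      have := h1 _ (subset_convexHull ℝ A ⟨c j, ⟨j, rfl, hj.trans (by norm_num)⟩, rfl⟩)
      rw [inner_zero_left] at this
      linarith
    have hwn : 0 < ‖w‖ := norm_pos_iff.2 hw0
    set e : Pt d := ‖w‖⁻¹ • w with he
    have hen : ‖e‖ = 1 := by
      rw [he, norm_smul, norm_inv, norm_norm, inv_mul_cancel₀ hwn.ne']
    have heθ : 0 ≤ inner ℝ e θ := by
      rw [he, real_inner_smul_left]; positivity
    set q₀ : Pt d := θ + (3 / 20 : ℝ) • e with hq₀
    have hq₀n : ‖q₀‖ ^ 2 = 1 + 3 / 10 * inner ℝ e θ + 9 / 400 := by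
      rw [hq₀, norm_add_sq_real, hθ, norm_smul, hen, inner_smul_right, real_inner_comm,
        Real.norm_of_nonneg (by norm_num)]
      ring
    have hq1 : 1 ≤ ‖q₀‖ := by nlinarith [norm_nonneg q₀]
    have hq2 : ‖q₀‖ ≤ 23 / 20 := by
      calc ‖q₀‖ ≤ ‖θ‖ + ‖(3 / 20 : ℝ) • e‖ := norm_add_le _ _
        _ = _ := by rw [hθ, norm_smul, hen, Real.norm_of_nonneg (by norm_num)]; norm_num
    have hq0 : 0 < ‖q₀‖ := by linarith
    set q : Pt d := ‖q₀‖⁻¹ • q₀ with hq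
    have hqn : ‖q‖ = 1 := by
      rw [hq, norm_smul, norm_inv, norm_norm, inv_mul_cancel₀ hq0.ne']
    have hqq₀ : ‖q - q₀‖ ≤ 3 / 20 := by
      have : q - q₀ = -((1 - ‖q₀‖⁻¹) • q₀) := by rw [hq]; module
      rw [this, norm_neg, norm_smul, Real.norm_of_nonneg]
      · rw [sub_mul, inv_mul_cancel₀ hq0.ne']; linarith
      · rw [sub_nonneg]; exact inv_le_one_of_one_le₀ hq1
    have hq₀θ : ‖q₀ - θ‖ = 3 / 20 := by
      rw [hq₀, add_sub_cancel_left, norm_smul, hen, Real.norm_of_nonneg (by norm_num), mul_one]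
    have heq : 3 / 23 ≤ inner ℝ e q := by
      have h3 : 3 / 20 ≤ inner ℝ e q₀ := by
        rw [hq₀, inner_add_right, inner_smul_right, real_inner_self_eq_norm_sq, hen]
        linarith
      rw [hq, inner_smul_right, ← div_eq_inv_mul, le_div_iff₀ hq0]
      linarith
    obtain ⟨j, hj⟩ := hc.exists_near hn hqn
    set k := (10 : ℝ) • X.chart (c j) with hk
    have hjθ : ‖k - θ‖ < 1 / 2 := by
      calc ‖k - θ‖ = ‖(k - q) + (q - q₀) + (q₀ - θ)‖ := by congr 1; abel
        _ ≤ ‖k - q‖ + ‖q - q₀‖ + ‖q₀ - θ‖ := norm_add₃_le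
        _ < _ := by rw [hq₀θ]; linarith
    have h3 := h1 _ (subset_convexHull ℝ A ⟨c j, ⟨j, rfl, hjθ⟩, rfl⟩)
    have h4 : inner ℝ e k < 0 := by
      rw [he, hk, real_inner_smul_left, inner_smul_right]
      have : 0 < ‖w‖⁻¹ := by positivity
      have h5 : inner ℝ w (X.chart (c j)) < 0 := by linarith
      nlinarith
    have h5 : inner ℝ e q - inner ℝ e k ≤ ‖k - q‖ := by
      rw [← inner_sub_right]
      calc _ ≤ ‖e‖ * ‖q - k‖ := real_inner_le_norm _ _
        _ = _ := by rw [hen, one_mul, norm_sub_rev]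
    linarith
  · obtain ⟨y, hy, ⟨s, hs, rfl⟩⟩ := Set.not_disjoint_iff.1 hdis
    have h1 := hsub hy
    rw [mem_ball_iff_norm, ← sub_smul, norm_smul, hθ, mul_one, Real.norm_eq_abs, abs_lt] at h1
    exact ⟨s, by linarith, by linarith, hy⟩

lemma IsCluster.norm_chart_le (hn : IsSphereNet n ρ) (hc : IsCluster X n ρ c) (j : Fin m) :
    ‖X.chart (c j)‖ ≤ 21 / 200 ∧ 19 / 200 ≤ ‖X.chart (c j)‖ := by
  have h1 := hc j
  have h2 := hn.le
  have h3 : |‖(10 : ℝ) • X.chart (c j)‖ - ‖n j‖| ≤ _ := abs_norm_sub_norm_le _ _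
  rw [hn.norm_eq, norm_smul, Real.norm_of_nonneg (by norm_num), abs_le] at h3
  constructor <;> linarith

lemma dist_zero_le_of_norm_chart {z : Pt d} (hz : ‖X.chart z‖ ≤ 21 / 200) : X.dist 0 z ≤ 1 := by
  rw [X.dist_zero]
  cases X
  · simp only [SpaceForm.chart, SpaceForm.rad] at *; linarith
  · simp only [SpaceForm.chart, SpaceForm.rad] at *
    have h1 := height_sq_mul z
    have h2 := height_pos z
    have h3 : ‖z‖ = height z * ‖klein z‖ := by
      rw [norm_klein]; field_simp
    have hk : ‖klein z‖ ^ 2 ≤ 1 / 2 := by nlinarith [norm_nonneg (klein z)]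
    have h4 : height z ^ 2 ≤ 4 := by nlinarith [sq_nonneg (height z)]
    have h5 : height z ≤ 2 := by nlinarith
    have h6 : ‖z‖ ≤ 1 := by rw [h3]; nlinarith [norm_nonneg (klein z)]
    have h7 : Real.arsinh ‖z‖ ≤ Real.sinh (Real.arsinh ‖z‖) :=
      Real.self_le_sinh_iff.2 (Real.arsinh_nonneg_iff.2 (norm_nonneg z))
    rw [Real.sinh_arsinh] at h7
    linarith

lemma IsCluster.dist_zero_le (hn : IsSphereNet n ρ) (hc : IsCluster X n ρ c) (j : Fin m) :
    X.dist 0 (c j) ≤ 1 := dist_zero_le_of_norm_chart (hc.norm_chart_le hn j).1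

lemma one_half_le_norm_chart {u : Pt d} (hu : 4 < X.dist 0 u) : 1 / 2 ≤ ‖X.chart u‖ := by
  rw [X.dist_zero] at hu
  cases X
  · simp only [SpaceForm.chart, SpaceForm.rad] at *; linarith
  · simp only [SpaceForm.chart, SpaceForm.rad] at *
    have h7 : Real.arsinh ‖u‖ ≤ Real.sinh (Real.arsinh ‖u‖) :=
      Real.self_le_sinh_iff.2 (Real.arsinh_nonneg_iff.2 (norm_nonneg u))
    rw [Real.sinh_arsinh] at h7
    have h8 : 4 < ‖u‖ := by linarith
    have h1 := height_sq u
    have h2 := height_pos u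
    rw [norm_klein, le_div_iff₀ h2]
    nlinarith

/-- Far away points are closer to the cluster points in their direction than to the origin. -/
lemma dist_lt_of_near_direction {u z θ : Pt d} (hu : 4 < X.dist 0 u)
    (hθ : X.chart u = ‖X.chart u‖ • θ) (hθn : ‖θ‖ = 1)
    (hz : ‖(10 : ℝ) • X.chart z - θ‖ < 1 / 2) : X.dist u z < X.dist u 0 := by
  have hR := one_half_le_norm_chart hu
  set κ := X.chart z with hκ
  have h1 : 1 / 20 < inner ℝ θ κ := by
    have h2 : inner ℝ θ θ - inner ℝ θ ((10 : ℝ) • κ) ≤ ‖(10 : ℝ) • κ - θ‖ := by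
      rw [← inner_sub_right]
      calc _ ≤ ‖θ‖ * ‖θ - (10 : ℝ) • κ‖ := real_inner_le_norm _ _
        _ = _ := by rw [hθn, one_mul, norm_sub_rev]
    rw [real_inner_self_eq_norm_sq, hθn, inner_smul_right] at h2
    linarith
  have h2 : ‖κ‖ < 3 / 20 := by
    have : ‖(10 : ℝ) • κ‖ ≤ ‖(10 : ℝ) • κ - θ‖ + ‖θ‖ := by
      calc _ = ‖((10 : ℝ) • κ - θ) + θ‖ := by congr 1; abel
        _ ≤ _ := norm_add_le _ _
    rw [norm_smul, Real.norm_of_nonneg (by norm_num), hθn] at this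
    linarith
  have h3 : ‖X.chart u‖ / 20 < inner ℝ (X.chart u) κ := by
    rw [hθ, real_inner_smul_left, norm_smul, norm_norm, hθn]
    nlinarith
  have hκ0 := norm_nonneg κ
  cases X
  · have hu4 : 4 < ‖u‖ := by rw [SpaceForm.dist_zero] at hu; exact hu
    simp only [SpaceForm.chart, SpaceForm.dist] at *
    rw [dist_eq_norm, dist_zero_right]
    have h4 := norm_sub_sq_real u z
    rw [hκ] at h2 h3 hκ0
    have h5 : ‖u - z‖ ^ 2 < ‖u‖ ^ 2 := by rw [h4]; nlinarith
    exact lt_of_pow_lt_pow_left₀ 2 (norm_nonneg u) h5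
  · simp only [SpaceForm.chart, SpaceForm.dist] at *
    rw [hypDist_lt_iff, mink_zero_right, mink]
    have hz0 := height_pos z
    have hu0 := height_pos u
    have h4 := height_sq_mul z
    rw [← hκ] at h4
    have h5 : inner ℝ u z = height u * height z * inner ℝ (klein u) κ := by
      conv_lhs => rw [← height_smul_klein u, ← height_smul_klein z]
      rw [real_inner_smul_left, inner_smul_right, ← hκ]; ring
    set x := inner ℝ (klein u) κ with hx
    have h6 : 1 / 40 < x := by linarith
    have h7 : x ≤ 3 / 20 := by
      have := real_inner_le_norm (klein u) κ
      have := norm_klein_lt_one u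
      nlinarith [norm_nonneg (klein u)]
    have h8 : height z * (1 - x) < 1 := by
      have h9 : (height z * (1 - x)) ^ 2 < 1 ^ 2 := by
        have : (1 - x) ^ 2 < 1 - ‖κ‖ ^ 2 := by nlinarith
        calc (height z * (1 - x)) ^ 2 = height z ^ 2 * (1 - x) ^ 2 := mul_pow _ _ _
          _ < height z ^ 2 * (1 - ‖κ‖ ^ 2) := mul_lt_mul_of_pos_left this (by positivity)
          _ = 1 ^ 2 := by rw [h4, one_pow]
      exact lt_of_pow_lt_pow_left₀ 2 (by norm_num) h9
    rw [h5]
    calc _ = height u * (height z * (1 - x)) := by ring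
      _ < height u * 1 := mul_lt_mul_of_pos_left h8 hu0
      _ = _ := mul_one _

/-- If the hull of `S` contains a point of the line through `0` and `k` on the same side of `k` as
`0`, then adding `0` to `S` does not bring `k` into the hull. -/
lemma mem_convexHull_of_insert_zero {S : Set (Pt d)} {k : Pt d} (hk : k ≠ 0) {l : ℝ} (hl : l < 1)
    (hw : l • k ∈ convexHull ℝ S) (h : k ∈ convexHull ℝ (insert 0 S)) : k ∈ convexHull ℝ S := by
  have hne : S.Nonempty := convexHull_nonempty_iff.1 ⟨_, hw⟩
  rw [convexHull_insert hne, mem_convexJoin] at h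
  obtain ⟨z, hz, y, hy, a, b, ha, hb, hab, hk'⟩ := h
  rw [Set.mem_singleton_iff.1 hz, smul_zero, zero_add] at hk'
  have hb0 : b ≠ 0 := by rintro rfl; rw [zero_smul] at hk'; exact hk hk'.symm
  have hbpos : 0 < b := lt_of_le_of_ne hb hb0.symm
  have hy' : y = b⁻¹ • k := by rw [← hk', smul_smul, inv_mul_cancel₀ hb0, one_smul]
  have hb1 : 1 ≤ b⁻¹ := (one_le_inv₀ hbpos).2 (by linarith)
  have hden : 0 < b⁻¹ - l := by linarith
  refine (convex_convexHull ℝ S).segment_subset hw hy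
    ⟨(b⁻¹ - 1) / (b⁻¹ - l), (1 - l) / (b⁻¹ - l), div_nonneg (by linarith) hden.le,
      div_nonneg (by linarith) hden.le, ?_, ?_⟩
  · rw [← add_div, div_eq_one_iff_eq hden.ne']; ring
  · rw [hy', smul_smul, smul_smul, ← add_smul]
    have : (b⁻¹ - 1) / (b⁻¹ - l) * l + (1 - l) / (b⁻¹ - l) * b⁻¹ = 1 := by
      rw [div_mul_eq_mul_div, div_mul_eq_mul_div, ← add_div, div_eq_one_iff_eq hden.ne']
      ring
    rw [this, one_smul]

/-- Adding a point at the centre of an isolated cluster does not remove any edge. -/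
lemma outNbrs_subset_insert_zero (hn : IsSphereNet n ρ) (hc : IsCluster X n ρ c) {φ : Set (Pt d)}
    (hφ : φ ∩ X.ball 0 4 = Set.range c) {u : Pt d} (hu : u ∈ φ) :
    outNbrs X φ u ⊆ outNbrs X (insert 0 φ) u := by
  rintro v ⟨hvφ, hvu, hv⟩
  refine ⟨Or.inr hvφ, hvu, fun hcon => ?_⟩
  set S := {z | z ∈ φ ∧ z ≠ u ∧ X.dist u z < X.dist u v} with hS
  set T := {z | z ∈ insert 0 φ ∧ z ≠ u ∧ X.dist u z < X.dist u v} with hT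
  have hTS : T ⊆ insert 0 S := by
    rintro z ⟨rfl | hz, h1, h2⟩
    · exact Or.inl rfl
    · exact Or.inr ⟨hz, h1, h2⟩
  have hcφ : ∀ j, c j ∈ φ := fun j => by
    have : c j ∈ φ ∩ X.ball 0 4 := by rw [hφ]; exact ⟨j, rfl⟩
    exact this.1
  have hc1 := fun j => hc.dist_zero_le hn j
  have hcc : ∀ i j, X.dist (c i) (c j) ≤ 2 := fun i j => by
    have h1 := X.dist_triangle (c i) 0 (c j)
    rw [X.dist_comm (c i) 0] at h1
    have := hc1 i
    have := hc1 j
    linarith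
  have hfar : ∀ z ∈ φ, z ∉ Set.range c → 4 < X.dist 0 z := fun z hz hzc => by
    by_contra! h
    exact hzc (hφ ▸ ⟨hz, h⟩)
  by_cases hlt : X.dist u 0 < X.dist u v
  swap
  · refine hv (X.hull_mono ?_ hcon)
    rintro z ⟨rfl | hz, h1, h2⟩
    · exact absurd h2 hlt
    · exact ⟨hz, h1, h2⟩
  -- it suffices to find a point of the hull of `S` on the appropriate ray
  have key : ∀ l : ℝ, l < 1 → X.chart u ≠ 0 → l • X.chart u ∈ convexHull ℝ (X.chart '' S) →
      False := by
    intro l hl hu0 hw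
    refine hv ((X.mem_hull_iff _ _).2 (mem_convexHull_of_insert_zero hu0 hl hw ?_))
    have := (X.mem_hull_iff _ _).1 (X.hull_mono hTS hcon)
    rwa [Set.image_insert_eq, X.chart_zero] at this
  by_cases huc : u ∈ Set.range c
  · obtain ⟨i, rfl⟩ := huc
    have hk := hc.norm_chart_le hn i
    by_cases hvc : v ∈ Set.range c
    · -- both end points in the cluster: the cluster is in convex position
      obtain ⟨j, rfl⟩ := hvc
      have hmem := (X.mem_hull_iff _ _).1 hcon
      have hconv : Convex ℝ {w : Pt d | inner ℝ (n i) w < inner ℝ (n i) (X.chart (c i))} :=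
        convex_halfSpace_lt (IsLinearMap.mk (fun a b => inner_add_right _ _ _)
          fun c a => inner_smul_right _ _ _) _
      have hcl : ∀ l, |inner ℝ (n i) ((10 : ℝ) • X.chart (c l)) - inner ℝ (n i) (n l)| < ρ := by
        intro l
        rw [← inner_sub_right]
        calc _ ≤ ‖n i‖ * ‖(10 : ℝ) • X.chart (c l) - n l‖ := abs_real_inner_le_norm _ _
          _ < ρ := by rw [hn.norm_eq, one_mul]; exact hc l
      have hi := hcl i
      rw [real_inner_self_eq_norm_sq, hn.norm_eq, inner_smul_right, abs_lt] at hi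
      have hρ := hn.le
      have hρ0 := hn.pos
      refine absurd (convexHull_min ?_ hconv hmem) (lt_irrefl (inner ℝ (n i) (X.chart (c i))))
      rintro _ ⟨z, hz, rfl⟩
      change inner ℝ (n i) (X.chart z) < inner ℝ (n i) (X.chart (c i))
      rcases hTS hz with rfl | hzS
      · rw [X.chart_zero, inner_zero_right]; linarith
      · have hz4 : z ∈ φ ∩ X.ball 0 4 := by
          refine ⟨hzS.1, ?_⟩
          rw [X.mem_ball]
          have h1 := X.dist_triangle 0 (c i) z
          have h2 := hzS.2.2
          have h3 := hcc i j
          have h4 := hc1 i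
          linarith
        rw [hφ] at hz4
        obtain ⟨l, rfl⟩ := hz4
        have hil : i ≠ l := fun h => hzS.2.1 (by rw [h])
        have h1 := hcl l
        have h2 := hn.inner_le i l hil
        rw [inner_smul_right, abs_lt] at h1
        linarith
    · -- a long edge from the cluster
      have hv4 := hfar v hvφ hvc
      have hk0 : 0 < ‖X.chart (c i)‖ := by linarith
      set θ : Pt d := -(‖X.chart (c i)‖⁻¹ • X.chart (c i)) with hθ
      have hθn : ‖θ‖ = 1 := by
        rw [hθ, norm_neg, norm_smul, norm_inv, norm_norm, inv_mul_cancel₀ hk0.ne']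
      obtain ⟨s, hs0, hs1, hs⟩ := hc.exists_smul_mem hn hθn
      refine key (-(s * ‖X.chart (c i)‖⁻¹)) ?_ (norm_pos_iff.1 hk0) ?_
      · have : 0 < s * ‖X.chart (c i)‖⁻¹ := by positivity
        linarith
      · have e : (-(s * ‖X.chart (c i)‖⁻¹)) • X.chart (c i) = s • θ := by rw [hθ]; module
        rw [e]
        refine convexHull_mono (Set.image_mono ?_) hs
        rintro z ⟨j, rfl, hj⟩
        refine ⟨hcφ j, fun heq => ?_, ?_⟩
        · rw [heq] at hj
          have e2 : (10 : ℝ) • X.chart (c i) - θ =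
              (10 + ‖X.chart (c i)‖⁻¹) • X.chart (c i) := by rw [hθ]; module
          rw [e2, norm_smul, Real.norm_of_nonneg (by positivity), add_mul,
            inv_mul_cancel₀ hk0.ne'] at hj
          linarith
        · have h1 := X.dist_triangle 0 (c i) v
          have h2 := hc1 i
          have h3 := hcc i j
          linarith
  · -- the starting point is far away
    have hu4 := hfar u hu huc
    have hR := one_half_le_norm_chart hu4
    have hR0 : 0 < ‖X.chart u‖ := by linarith
    set θ : Pt d := ‖X.chart u‖⁻¹ • X.chart u with hθ
    have hθn : ‖θ‖ = 1 := by
      rw [hθ, norm_smul, norm_inv, norm_norm, inv_mul_cancel₀ hR0.ne']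
    have huθ : X.chart u = ‖X.chart u‖ • θ := by
      rw [hθ, smul_smul, mul_inv_cancel₀ hR0.ne', one_smul]
    obtain ⟨s, hs0, hs1, hs⟩ := hc.exists_smul_mem hn hθn
    refine key (s * ‖X.chart u‖⁻¹) ?_ (norm_pos_iff.1 hR0) ?_
    · rw [← div_eq_mul_inv, div_lt_one hR0]; linarith
    · have e : (s * ‖X.chart u‖⁻¹) • X.chart u = s • θ := by rw [hθ]; module
      rw [e]
      refine convexHull_mono (Set.image_mono ?_) hs
      rintro z ⟨j, rfl, hj⟩
      refine ⟨hcφ j, fun heq => huc ⟨j, heq⟩, ?_⟩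
      exact (dist_lt_of_near_direction hu4 huθ hθn hj).trans hlt

/-- The point added at the centre is joined to a point of the cluster. -/
lemma exists_mem_outNbrs_zero (hm : 0 < m) (hc : IsCluster X n ρ c) (hn : IsSphereNet n ρ)
    {φ : Set (Pt d)} (hφ : φ ∩ X.ball 0 4 = Set.range c) :
    ∃ j, c j ∈ outNbrs X (insert 0 φ) 0 := by
  have : Nonempty (Fin m) := ⟨⟨0, hm⟩⟩
  obtain ⟨j, hj⟩ := Finite.exists_min fun j => X.dist 0 (c j)
  have hcj : c j ∈ φ ∩ X.ball 0 4 := by rw [hφ]; exact ⟨j, rfl⟩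
  refine ⟨j, Or.inr hcj.1, fun h0 => ?_, ?_⟩
  · have := (hc.norm_chart_le hn j).2
    rw [h0, X.chart_zero, norm_zero] at this
    norm_num at this
  · have : {z | z ∈ insert 0 φ ∧ z ≠ 0 ∧ X.dist 0 z < X.dist 0 (c j)} = ∅ := by
      rw [Set.eq_empty_iff_forall_notMem]
      rintro z ⟨rfl | hz, h1, h2⟩
      · exact h1 rfl
      · have hz4 : z ∈ φ ∩ X.ball 0 4 := ⟨hz, X.mem_ball.2 (h2.le.trans hcj.2)⟩
        rw [hφ] at hz4
        obtain ⟨l, rfl⟩ := hz4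
        exact absurd h2 (not_lt.2 (hj l))
    rw [this, X.mem_hull_iff]
    simp

end Cluster

end NNE

/-! ### Gadgets: local configurations in which an additional point increases the functional -/

namespace NNE

variable {d : ℕ} {X : SpaceForm}

lemma Motion.mem_outNbrs_image (g : Motion X d) {φ : Set (Pt d)} {u v : Pt d} :
    g v ∈ outNbrs X (g '' φ) (g u) ↔ v ∈ outNbrs X φ u := by
  have e : {z | z ∈ g '' φ ∧ z ≠ g u ∧ X.dist (g u) z < X.dist (g u) (g v)} =
      g '' {z | z ∈ φ ∧ z ≠ u ∧ X.dist u z < X.dist u v} := by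
    ext z
    obtain ⟨z, rfl⟩ := g.surjective z
    simp only [Set.mem_ofPred_eq, g.injective.mem_set_image, g.dist_eq, g.injective.ne_iff]
  change g v ∈ g '' φ ∧ g v ≠ g u ∧ g u ∉ X.hull _ ↔ v ∈ φ ∧ v ≠ u ∧ u ∉ X.hull _
  rw [e, g.mem_hull_iff, g.injective.mem_set_image, g.injective.ne_iff]

/-- If passing from `φ` to `ψ` removes no edges, and creates an edge at a point `x` of the
window, then the functional increases at least by the contribution of this edge at `x`. -/
lemma edgeSum_add_le {φ ψ : Set (Pt d)} {x y p : Pt d} {t α : ℝ} (hsub : φ ⊆ ψ)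
    (hout : ∀ u ∈ φ, outNbrs X φ u ⊆ outNbrs X ψ u) (hxφ : x ∉ φ) (hxψ : x ∈ ψ)
    (hx : x ∈ X.ball p t) (hy : y ∈ outNbrs X ψ x) :
    edgeSum X α p t φ + 2⁻¹ * ENNReal.ofReal (X.dist x y ^ α) ≤ edgeSum X α p t ψ := by
  classical
  have hall : ∀ u ∈ φ, allNbrs X φ u ⊆ allNbrs X ψ u := fun u hu z hz =>
    ⟨hsub hz.1, hz.2.imp (fun h => hout u hu h) fun h => hout z hz.1 h⟩
  rw [edgeSum, edgeSum, ← mul_add]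
  gcongr
  set s : Set (Pt d) → Pt d → ℝ≥0∞ := fun φ u =>
    ∑' z : ↥(allNbrs X φ u), ENNReal.ofReal (X.dist u z ^ α) with hs
  change ∑' u : ↥(φ ∩ X.ball p t), s φ u + _ ≤ ∑' u : ↥(ψ ∩ X.ball p t), s ψ u
  rw [tsum_subtype, tsum_subtype, ← tsum_ite_eq x (fun _ => ENNReal.ofReal (X.dist x y ^ α)),
    ← ENNReal.tsum_add]
  refine ENNReal.tsum_le_tsum fun u => ?_
  by_cases hux : u = x
  · subst hux
    rw [Set.indicator_of_notMem fun h => hxφ h.1, if_pos rfl, zero_add,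
      Set.indicator_of_mem (Set.mem_inter hxψ hx)]
    have hmem : y ∈ allNbrs X ψ u := ⟨hy.1, Or.inl hy⟩
    exact ENNReal.le_tsum (f := fun z : ↥(allNbrs X ψ u) => ENNReal.ofReal (X.dist u z ^ α))
      ⟨y, hmem⟩
  · rw [if_neg hux, add_zero]
    by_cases hu : u ∈ φ ∩ X.ball p t
    · rw [Set.indicator_of_mem hu,
        Set.indicator_of_mem (Set.mem_inter (hsub hu.1) hu.2)]
      exact ENNReal.tsum_mono_subtype (fun z => ENNReal.ofReal (X.dist u z ^ α)) (hall u hu.1)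
    · rw [Set.indicator_of_notMem hu]; exact zero_le

/-- A gadget with core `I` and cells `B i`: if a configuration `φ` has exactly `k i` points in each
of the cells and none in the core, then the addition of any point of the core removes no edge and
creates an edge of length at least `δ` at the new point. The same is required of all copies of the
gadget under motions. The number `k i = 0` is meant for the region which has to be empty. -/
structure IsGadget {ι : Type*} (X : SpaceForm) (I : Set (Pt d)) (B : ι → Set (Pt d)) (k : ι → ℕ)
    (δ : ℝ) : Prop where
  measurableSet_core : MeasurableSet I
  core_subset : I ⊆ X.ball 0 1
  vol_core_pos : 0 < X.vol d I
  measurableSet_cell : ∀ i, MeasurableSet (B i)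
  cell_subset : ∀ i, B i ⊆ X.ball 0 5
  vol_cell_pos : ∀ i, k i = 0 ∨ 0 < X.vol d (B i)
  disjoint_cell : Pairwise fun i j => Disjoint (B i) (B j)
  disjoint_core : ∀ i, Disjoint (B i) I
  pos : 0 < δ
  gain : ∀ (g : Motion X d) (φ : Set (Pt d)) (x : Pt d), x ∈ g '' I →
    (∀ i, (φ ∩ g '' B i).encard = k i) → Disjoint φ (g '' I) →
      (∀ u ∈ φ, outNbrs X φ u ⊆ outNbrs X (insert x φ) u) ∧
        ∃ y ∈ outNbrs X (insert x φ) x, δ ≤ X.dist x y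

lemma exists_chart_eq (X : SpaceForm) {κ : Pt d} (hκ : ‖κ‖ < 1) : ∃ y, X.chart y = κ := by
  cases X
  · exact ⟨κ, rfl⟩
  · exact klein_surjOn hκ

/-- Around any net of the sphere there are cells such that any choice of one point in each of
them gives a cluster, as seen from any point of a neighbourhood of the origin. -/
lemma exists_radius_isCluster {m : ℕ} {n : Fin m → Pt d} {ρ : ℝ} (hn : IsSphereNet n ρ)
    {c : Fin m → Pt d} (hc : ∀ j, (10 : ℝ) • X.chart (c j) = n j) :
    ∃ r > 0, Metric.ball (0 : Pt d) r ⊆ X.ball 0 1 ∧ ∀ x ∈ Metric.ball (0 : Pt d) r, ∀ j,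
      ∀ z ∈ Metric.ball (c j) r, ‖(10 : ℝ) • X.chart (X.move (-x) z) - n j‖ < ρ := by
  have h1 : ∀ j, ∃ r > 0, ∀ q ∈ Metric.ball ((0 : Pt d), c j) r,
      ‖(10 : ℝ) • X.chart (X.move (-q.1) q.2) - n j‖ < ρ := by
    intro j
    have hcont : Continuous fun q : Pt d × Pt d => X.move (-q.1) q.2 := by
      have h0 : Continuous fun q : Pt d × Pt d => (-q.1, q.2) := by fun_prop
      have h := X.continuous_move.comp h0
      simpa only [Function.comp_def] using h
    have hcont2 : Continuous fun q : Pt d × Pt d => X.chart (X.move (-q.1) q.2) := by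
      have h := X.continuous_chart.comp hcont
      simpa only [Function.comp_def] using h
    have hopen : IsOpen {q : Pt d × Pt d | ‖(10 : ℝ) • X.chart (X.move (-q.1) q.2) - n j‖ < ρ} :=
      isOpen_lt ((hcont2.const_smul (10 : ℝ)).sub continuous_const).norm continuous_const
    obtain ⟨r, hr, h⟩ := Metric.isOpen_iff.1 hopen (0, c j) (by
      simpa [hc j] using hn.pos)
    exact ⟨r, hr, fun q hq => h hq⟩
  choose r hr h1 using h1
  obtain ⟨r₀, hr₀, h2⟩ := Metric.isOpen_iff.1 (X.isOpen_lt (0 : Pt d) 1) 0 (by simp)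
  have h3 : ∀ᶠ s : ℝ in nhdsWithin 0 (Set.Ioi 0), (∀ j, s ∈ Set.Ioo 0 (r j)) ∧ s ∈ Set.Ioo 0 r₀ :=
    (Filter.eventually_all.2 fun j => Ioo_mem_nhdsGT (hr j)).and (Ioo_mem_nhdsGT hr₀)
  obtain ⟨s, hs, hs₀⟩ := h3.exists
  refine ⟨s, hs₀.1, fun z hz => ?_, fun x hx j z hz => h1 j (x, z) ?_⟩
  · exact X.mem_ball.2 (h2 (Metric.ball_subset_ball hs₀.2.le hz)).le
  · rw [← ball_prod_same]
    exact ⟨Metric.ball_subset_ball (hs j).2.le hx, Metric.ball_subset_ball (hs j).2.le hz⟩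

lemma exists_isGadget (X : SpaceForm) (hd : 1 ≤ d) :
    ∃ (m : ℕ) (I : Set (Pt d)) (B : Option (Fin m) → Set (Pt d)) (k : Option (Fin m) → ℕ) (δ : ℝ),
      IsGadget X I B k δ := by
  obtain ⟨m, n, ρ, hn⟩ := exists_isSphereNet d
  have hm : 0 < m := by
    obtain ⟨j, _⟩ := hn.net (EuclideanSpace.single ⟨0, hd⟩ 1) (by simp)
    exact j.pos
  have hex : ∀ j, ∃ y, X.chart y = (1 / 10 : ℝ) • n j := fun j =>
    exists_chart_eq X (by rw [norm_smul, hn.norm_eq]; norm_num)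
  choose c hc using hex
  obtain ⟨r, hr, hr1, hcl⟩ := exists_radius_isCluster (X := X) hn (c := c) fun j => by
    rw [hc, smul_smul]; norm_num
  obtain ⟨δ, hδ, -, hδc⟩ := exists_norm_chart_lt X d (κ := 19 / 200) (by norm_num)
  have hcl0 : ∀ j, ∀ z ∈ Metric.ball (c j) r, ‖(10 : ℝ) • X.chart z - n j‖ < ρ := by
    intro j z hz
    have := hcl 0 (Metric.mem_ball_self hr) j z hz
    rwa [neg_zero, X.move_zero] at this
  have hE1 : ∀ j, Metric.ball (c j) r ⊆ X.ball 0 1 := by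
    intro j z hz
    refine X.mem_ball.2 (dist_zero_le_of_norm_chart ?_)
    have h1 := hcl0 j z hz
    have h2 := hn.le
    have h3 : ‖(10 : ℝ) • X.chart z‖ - ‖n j‖ ≤ _ := norm_sub_norm_le _ _
    rw [hn.norm_eq, norm_smul, Real.norm_of_nonneg (by norm_num)] at h3
    linarith
  have hEdisj : ∀ i j, i ≠ j → Disjoint (Metric.ball (c i) r) (Metric.ball (c j) r) := by
    intro i j hij
    refine Set.disjoint_left.2 fun z hi hj => ?_
    have h1 := hcl0 i z hi
    have h2 := hcl0 j z hj
    have h3 := hn.inner_le i j hij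
    have h4 : 1 - inner ℝ (n i) (n j) ≤ ‖n i - n j‖ := by
      have : inner ℝ (n i) (n i - n j) ≤ ‖n i‖ * ‖n i - n j‖ := real_inner_le_norm _ _
      rwa [inner_sub_right, real_inner_self_eq_norm_sq, hn.norm_eq, one_pow, one_mul] at this
    have h5 : ‖n i - n j‖ ≤ ‖(10 : ℝ) • X.chart z - n i‖ + ‖(10 : ℝ) • X.chart z - n j‖ := by
      calc _ = ‖((10 : ℝ) • X.chart z - n j) - ((10 : ℝ) • X.chart z - n i)‖ := by congr 1; abel
        _ ≤ _ := norm_sub_le _ _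
        _ = _ := add_comm _ _
    linarith
  have hEI : ∀ j, Disjoint (Metric.ball (c j) r) (Metric.ball 0 r) := by
    intro j
    refine Set.disjoint_left.2 fun z hj hz => ?_
    have h1 := hcl z hz j z hj
    have h2 : X.move (-z) z = 0 := by
      conv_lhs => rw [← X.move_apply_zero z, X.move_apply_zero z]
      have := X.move_neg_move z 0
      rwa [X.move_apply_zero] at this
    rw [h2, X.chart_zero, smul_zero, zero_sub, norm_neg, hn.norm_eq] at h1
    have := hn.le
    linarith
  set I : Set (Pt d) := Metric.ball 0 r with hI
  set E : Fin m → Set (Pt d) := fun j => Metric.ball (c j) r with hE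
  set B : Option (Fin m) → Set (Pt d) := fun o => o.elim (X.ball 0 5 \ (I ∪ ⋃ j, E j)) E with hB
  set k : Option (Fin m) → ℕ := fun o => o.elim 0 fun _ => 1 with hk
  refine ⟨m, I, B, k, δ, Metric.isOpen_ball.measurableSet, hr1,
    X.vol_pos_of_isOpen Metric.isOpen_ball ⟨0, Metric.mem_ball_self hr⟩, ?_, ?_, ?_, ?_, ?_, hδ, ?_⟩
  · rintro (_ | j)
    · exact (X.measurableSet_ball 0 5).diff (Metric.isOpen_ball.measurableSet.union
        (MeasurableSet.iUnion fun j => Metric.isOpen_ball.measurableSet))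
    · exact Metric.isOpen_ball.measurableSet
  · rintro (_ | j)
    · exact Set.sdiff_subset
    · exact (hE1 j).trans fun z hz => X.mem_ball.2 (le_trans hz (by norm_num))
  · rintro (_ | j)
    · exact Or.inl rfl
    · exact Or.inr (X.vol_pos_of_isOpen Metric.isOpen_ball ⟨c j, Metric.mem_ball_self hr⟩)
  · have hnone : ∀ j, Disjoint (B none) (B (some j)) := fun j =>
      Set.disjoint_left.2 fun z hz hz' => hz.2 (Or.inr (Set.mem_iUnion.2 ⟨j, hz'⟩))
    rintro (_ | i) (_ | j) hij
    · exact absurd rfl hij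
    · exact hnone j
    · exact (hnone i).symm
    · exact hEdisj i j fun h => hij (by rw [h])
  · rintro (_ | j)
    · exact Set.disjoint_left.2 fun z hz hz' => hz.2 (Or.inl hz')
    · exact hEI j
  · rintro g φ _ ⟨x, hx, rfl⟩ hφ hφI
    have hsome : ∀ j, ∃ e ∈ E j, φ ∩ g '' E j = {g e} := by
      intro j
      obtain ⟨y, hy⟩ := Set.encard_eq_one.1 (hφ (some j))
      have hy' : y ∈ φ ∩ g '' E j := by rw [show E j = B (some j) from rfl, hy]; rfl
      obtain ⟨e, he, rfl⟩ := hy'.2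
      exact ⟨e, he, hy⟩
    choose e heE he using hsome
    have hnone : ∀ z ∈ X.ball 0 5, g z ∈ φ → z ∈ ⋃ j, E j := by
      intro z hz hzφ
      have h0 : φ ∩ g '' B none = ∅ := Set.encard_eq_zero.1 (hφ none)
      by_contra hcon
      have : g z ∈ φ ∩ g '' B none := ⟨hzφ, z, ⟨hz, fun h => h.elim (fun h =>
        Set.disjoint_left.1 hφI hzφ ⟨z, h, rfl⟩) hcon⟩, rfl⟩
      rw [h0] at this
      exact this
    -- in the coordinates centred at the new point the points of the cells form a cluster
    set f := g.comp (Motion.ofPoint X x) with hf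
    set b : Fin m → Pt d := fun j => X.move (-x) (e j) with hb
    have hfb : ∀ j, f (b j) = g (e j) := fun j => by
      rw [hf, Motion.comp_apply, Motion.ofPoint_apply, hb, X.move_move_neg]
    have hf0 : f 0 = g x := by rw [hf, Motion.comp_apply, Motion.ofPoint_zero]
    have hbc : IsCluster X n ρ b := fun j => hcl x hx j (e j) (heE j)
    set ψ : Set (Pt d) := f ⁻¹' φ with hψ
    have hψφ : f '' ψ = φ := Set.image_preimage_eq _ f.surjective
    have hψc : ψ ∩ X.ball 0 4 = Set.range b := by
      ext z
      constructor
      · rintro ⟨hz, hz4⟩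
        have h5 : X.move x z ∈ X.ball 0 5 := by
          have h1 := X.dist_triangle 0 x (X.move x z)
          have h2 : X.dist x (X.move x z) = X.dist 0 z := by
            conv_lhs => rw [← X.move_apply_zero x, X.move_apply_zero x]
            have := X.dist_move x 0 z
            rwa [X.move_apply_zero] at this
          have h3 := X.mem_ball.1 (hr1 hx)
          rw [X.mem_ball] at hz4 ⊢
          linarith
        obtain ⟨j, hj⟩ := Set.mem_iUnion.1 (hnone _ h5 hz)
        have h6 : g (X.move x z) ∈ φ ∩ g '' E j := ⟨hz, _, hj, rfl⟩
        rw [he j] at h6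
        have h7 : X.move x z = e j := g.injective h6
        exact ⟨j, by rw [hb]; simp only; rw [← h7, X.move_neg_move]⟩
      · rintro ⟨j, rfl⟩
        refine ⟨?_, X.mem_ball.2 ((hbc.dist_zero_le hn j).trans (by norm_num))⟩
        have : g (e j) ∈ φ ∩ g '' E j := by rw [he j]; rfl
        rw [hψ, Set.mem_preimage, hfb]
        exact this.1
    have hins : insert (g x) φ = f '' insert 0 ψ := by
      rw [Set.image_insert_eq, hψφ, hf0]
    rw [hins, ← hf0]
    refine ⟨fun u hu v hv => ?_, ?_⟩
    · obtain ⟨u, rfl⟩ := f.surjective u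
      obtain ⟨v, rfl⟩ := f.surjective v
      rw [← hψφ, f.mem_outNbrs_image] at hv
      rw [f.mem_outNbrs_image]
      exact outNbrs_subset_insert_zero hn hbc hψc hu hv
    · obtain ⟨j, hj⟩ := exists_mem_outNbrs_zero hm hbc hn hψc
      refine ⟨f (b j), f.mem_outNbrs_image.2 hj, ?_⟩
      rw [f.dist_eq]
      by_contra! hlt
      have h1 := hδc _ hlt.le
      have h2 := (hbc.norm_chart_le hn j).2
      linarith

end NNE

/-! ### Test variables -/

namespace NNE

/-- A lower bound for the variance by uncorrelated test variables: the variance of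
`f - λ ∑ Z i` is nonnegative for `λ = b / K`. -/
lemma card_mul_le_variance {Ω ι : Type*} [MeasurableSpace Ω] {P : Measure Ω}
    [IsProbabilityMeasure P] {f : Ω → ℝ} (hf : MemLp f 2 P) (s : Finset ι) {Z : ι → Ω → ℝ}
    (hZ : ∀ i ∈ s, MemLp (Z i) 2 P) {b K : ℝ} (hb : 0 ≤ b) (hK : 0 < K)
    (hcov : ∀ i ∈ s, ∀ j ∈ s, i ≠ j → cov[Z i, Z j; P] = 0) (hvar : ∀ i ∈ s, cov[Z i, Z i; P] ≤ K)
    (hfZ : ∀ i ∈ s, b ≤ cov[f, Z i; P]) : s.card * (b ^ 2 / K) ≤ Var[f; P] := by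
  set S : Ω → ℝ := ∑ i ∈ s, Z i with hS
  have hSL : MemLp S 2 P := memLp_finsetSum' s hZ
  set l := b / K with hl
  have hl0 : 0 ≤ l := by positivity
  have hlS : MemLp (l • S) 2 P := hSL.const_smul l
  have h0 : 0 ≤ Var[f - l • S; P] := variance_nonneg _ _
  rw [← covariance_self (hf.sub hlS).1.aemeasurable, covariance_sub_left hf hlS (hf.sub hlS),
    covariance_sub_right hf hf hlS, covariance_sub_right hlS hf hlS, covariance_smul_left,
    covariance_smul_left, covariance_smul_right, covariance_smul_right, covariance_comm S f,
    covariance_self hf.1.aemeasurable] at h0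
  have h1 : s.card * b ≤ cov[f, S; P] := by
    rw [hS, covariance_sum_right' hZ hf, ← nsmul_eq_mul]
    exact Finset.card_nsmul_le_sum _ _ _ hfZ
  have h2 : cov[S, S; P] ≤ s.card * K := by
    rw [hS, covariance_sum_sum' hZ hZ, ← nsmul_eq_mul]
    refine Finset.sum_le_card_nsmul _ _ _ fun i hi => ?_
    rw [Finset.sum_eq_single_of_mem i hi fun j hj hji => hcov i hi j hj hji.symm]
    exact hvar i hi
  have h3 : l * (s.card * b) ≤ l * cov[f, S; P] := mul_le_mul_of_nonneg_left h1 hl0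
  have h4 : l * (l * cov[S, S; P]) ≤ l * (l * (s.card * K)) := by gcongr
  have e1 : l * (s.card * b) = s.card * (b ^ 2 / K) := by rw [hl]; ring
  have e2 : l * (l * (s.card * K)) = s.card * (b ^ 2 / K) := by rw [hl]; field_simp
  rw [e1] at h3
  rw [e2] at h4
  linarith

/-- The function of a Poisson variable with parameter `v` which compares the values `0` and `1`,
normalized to have expectation zero. -/
noncomputable def poissonTest (v : ℝ) (n : ℕ∞) : ℝ :=
  if n = 1 then (v * Real.exp (-v))⁻¹ else if n = 0 then -(Real.exp (-v))⁻¹ else 0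

lemma abs_poissonTest_le {v : ℝ} (hv : 0 < v) (n : ℕ∞) :
    |poissonTest v n| ≤ (v * Real.exp (-v))⁻¹ + (Real.exp (-v))⁻¹ := by
  have h1 : 0 ≤ (v * Real.exp (-v))⁻¹ := by positivity
  have h2 : 0 ≤ (Real.exp (-v))⁻¹ := by positivity
  rw [poissonTest]
  split_ifs
  · rw [abs_of_nonneg h1]; linarith
  · rw [abs_neg, abs_of_nonneg h2]; linarith
  · rw [abs_zero]; positivity

variable {d : ℕ} {X : SpaceForm} {Ω : Type*}

/-- The event that the copy of a gadget under `g` is in its required state. -/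
def gadgetEvent {ι : Type*} (η : Ω → Set (Pt d)) (g : Motion X d) (B : ι → Set (Pt d))
    (k : ι → ℕ) : Set Ω := {ω | ∀ i, count η (g '' B i) ω = k i}

/-- The test variable of the copy of a gadget under `g`: on the event that the gadget is in its
required state, it compares the presence and the absence of a point in the core. -/
noncomputable def gadgetTest {ι : Type*} (η : Ω → Set (Pt d)) (g : Motion X d) (I : Set (Pt d))
    (B : ι → Set (Pt d)) (k : ι → ℕ) (ω : Ω) : ℝ :=
  (gadgetEvent η g B k).indicator 1 ω * poissonTest ((X.vol d).real I) (count η (g '' I) ω)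

variable {ι : Type*} {η : Ω → Set (Pt d)} {I : Set (Pt d)} {B : ι → Set (Pt d)}
  {k : ι → ℕ} {δ : ℝ}

namespace IsGadget

lemma vol_core_ne_top (hG : IsGadget X I B k δ) : X.vol d I ≠ ∞ :=
  ((measure_mono hG.core_subset).trans_lt (X.vol_ball_lt_top 0 1)).ne

lemma vol_cell_ne_top (hG : IsGadget X I B k δ) (i : ι) : X.vol d (B i) ≠ ∞ :=
  ((measure_mono (hG.cell_subset i)).trans_lt (X.vol_ball_lt_top 0 5)).ne

lemma vol_real_core_pos (hG : IsGadget X I B k δ) : 0 < (X.vol d).real I :=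
  ENNReal.toReal_pos hG.vol_core_pos.ne' hG.vol_core_ne_top

lemma abs_gadgetTest_le (hG : IsGadget X I B k δ) (g : Motion X d) (ω : Ω) :
    |gadgetTest η g I B k ω| ≤ ((X.vol d).real I * Real.exp (-(X.vol d).real I))⁻¹ +
      (Real.exp (-(X.vol d).real I))⁻¹ := by
  have h := abs_poissonTest_le hG.vol_real_core_pos (count η (g '' I) ω)
  have h' := (abs_nonneg _).trans h
  rw [gadgetTest, abs_mul]
  by_cases hω : ω ∈ gadgetEvent η g B k
  · rw [Set.indicator_of_mem hω, Pi.one_apply, abs_one, one_mul]; exact h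
  · rw [Set.indicator_of_notMem hω, abs_zero, zero_mul]; exact h'

lemma measurableSet_gadgetEvent [Finite ι] (hG : IsGadget X I B k δ) {g : Motion X d}
    {J : Set (Pt d)} (hJ : ∀ i, Disjoint (g '' B i) J) :
    MeasurableSet[outsideSigma η J] (gadgetEvent η g B k) := by
  have : gadgetEvent η g B k = ⋂ i, count η (g '' B i) ⁻¹' {(k i : ℕ∞)} := by
    ext ω; simp [gadgetEvent]
  rw [this]
  exact MeasurableSet.iInter fun i => measurable_count_outsideSigma η
    (g.measurableSet_image (hG.measurableSet_cell i)) (hJ i) (measurableSet_singleton _)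

lemma disjoint_image_core (hG : IsGadget X I B k δ) (g : Motion X d) (i : ι) :
    Disjoint (g '' B i) (g '' I) :=
  (Set.disjoint_image_iff g.injective).2 (hG.disjoint_core i)

lemma measurable_gadgetTest [Finite ι] (hG : IsGadget X I B k δ) {g : Motion X d}
    {J : Set (Pt d)} (hJ : ∀ i, Disjoint (g '' B i) J) (hJI : Disjoint (g '' I) J) :
    Measurable[outsideSigma η J] (gadgetTest η g I B k) := by
  have h1 : Measurable[outsideSigma η J] ((gadgetEvent η g B k).indicator (1 : Ω → ℝ)) :=
    (@measurable_const _ _ _ (outsideSigma η J) (1 : ℝ)).indicator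
      (hG.measurableSet_gadgetEvent hJ)
  have h2 : Measurable[outsideSigma η J] fun ω =>
      poissonTest ((X.vol d).real I) (count η (g '' I) ω) :=
    (measurable_of_countable (poissonTest ((X.vol d).real I))).comp
      (measurable_count_outsideSigma η (g.measurableSet_image hG.measurableSet_core) hJI)
  exact h1.mul h2

variable [MeasurableSpace Ω] {P : Measure Ω}

lemma prob_gadgetEvent [Fintype ι] (hG : IsGadget X I B k δ) (h : IsPoissonProcess X d P η)
    (g : Motion X d) : P (gadgetEvent η g B k) = ∏ i, ENNReal.ofReal
      (Real.exp (-(X.vol d).real (B i)) * (X.vol d).real (B i) ^ k i / (k i).factorial) := by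
  have hm : ∀ i, MeasurableSet (g '' B i) := fun i =>
    g.measurableSet_image (hG.measurableSet_cell i)
  have hind := h.iIndepFun_count (fun i => g '' B i) hm fun i j hij =>
    (Set.disjoint_image_iff g.injective).2 (hG.disjoint_cell hij)
  have e : gadgetEvent η g B k = ⋂ i ∈ Finset.univ, count η (g '' B i) ⁻¹' {(k i : ℕ∞)} := by
    ext ω; simp [gadgetEvent]
  rw [e, hind.measure_inter_preimage_eq_mul Finset.univ (sets := fun i => {(k i : ℕ∞)})
    fun i _ => measurableSet_singleton _]
  refine Finset.prod_congr rfl fun i _ => ?_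
  have h1 : (X.vol d).real (g '' B i) = (X.vol d).real (B i) := by
    rw [measureReal_def, g.vol_image]; rfl
  rw [← h1]
  exact h.prob_count_eq (hm i) (by rw [g.vol_image]; exact hG.vol_cell_ne_top i) (k i)

lemma prod_pos [Fintype ι] (hG : IsGadget X I B k δ) : 0 < ∏ i, ENNReal.ofReal
    (Real.exp (-(X.vol d).real (B i)) * (X.vol d).real (B i) ^ k i / (k i).factorial) := by
  rw [CanonicallyOrderedAdd.prod_pos]
  intro i _
  rw [ENNReal.ofReal_pos]
  have : 0 < (X.vol d).real (B i) ^ k i := by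
    rcases hG.vol_cell_pos i with h | h
    · rw [h, pow_zero]; exact one_pos
    · exact pow_pos (ENNReal.toReal_pos h.ne' (hG.vol_cell_ne_top i)) _
  positivity

lemma prob_core_eq_zero (hG : IsGadget X I B k δ) (h : IsPoissonProcess X d P η)
    (g : Motion X d) : P {ω | count η (g '' I) ω = 0} =
      ENNReal.ofReal (Real.exp (-(X.vol d).real I)) := by
  rw [h.prob_count_eq_zero (g.measurableSet_image hG.measurableSet_core)
    (by rw [g.vol_image]; exact hG.vol_core_ne_top), measureReal_def, g.vol_image]
  rfl

lemma prob_core_eq_one (hG : IsGadget X I B k δ) (h : IsPoissonProcess X d P η)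
    (g : Motion X d) : P {ω | count η (g '' I) ω = 1} =
      ENNReal.ofReal ((X.vol d).real I * Real.exp (-(X.vol d).real I)) := by
  have := h.prob_count_eq (g.measurableSet_image hG.measurableSet_core)
    (by rw [g.vol_image]; exact hG.vol_core_ne_top) 1
  rw [Nat.cast_one] at this
  rw [this, measureReal_def, g.vol_image, ← measureReal_def, pow_one, Nat.factorial_one,
    Nat.cast_one, div_one, mul_comm]

lemma measurable_core (hG : IsGadget X I B k δ) (h : IsPoissonProcess X d P η)
    (g : Motion X d) : Measurable (count η (g '' I)) :=
  h.measurable_count _ (g.measurableSet_image hG.measurableSet_core)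

variable [IsProbabilityMeasure P]

lemma integral_poissonTest (hG : IsGadget X I B k δ) (h : IsPoissonProcess X d P η)
    (g : Motion X d) :
    ∫ ω, poissonTest ((X.vol d).real I) (count η (g '' I) ω) ∂P = 0 := by
  set v := (X.vol d).real I with hv
  have hv0 : 0 < v := hG.vol_real_core_pos
  have hm := hG.measurable_core h g
  have h1 : MeasurableSet {ω | count η (g '' I) ω = 1} := hm (measurableSet_singleton 1)
  have h0 : MeasurableSet {ω | count η (g '' I) ω = 0} := hm (measurableSet_singleton 0)
  have e : ∀ ω, poissonTest v (count η (g '' I) ω) =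
      {ω | count η (g '' I) ω = 1}.indicator (fun _ => (v * Real.exp (-v))⁻¹) ω -
      {ω | count η (g '' I) ω = 0}.indicator (fun _ => (Real.exp (-v))⁻¹) ω := by
    intro ω
    simp only [poissonTest, Set.indicator_apply, Set.mem_ofPred_eq]
    by_cases h1 : count η (g '' I) ω = 1
    · have h0 : count η (g '' I) ω ≠ 0 := by rw [h1]; exact one_ne_zero
      simp only [if_pos h1, if_neg h0, sub_zero]
    · by_cases h0 : count η (g '' I) ω = 0
      · simp only [if_neg h1, if_pos h0, zero_sub]
      · simp only [if_neg h1, if_neg h0, sub_zero]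
  simp only [e]
  rw [integral_sub ((integrable_const _).indicator h1) ((integrable_const _).indicator h0),
    integral_indicator_const _ h1, integral_indicator_const _ h0, measureReal_def, measureReal_def,
    hG.prob_core_eq_one h, hG.prob_core_eq_zero h, ← hv, ENNReal.toReal_ofReal (by positivity),
    ENNReal.toReal_ofReal (by positivity), smul_eq_mul, smul_eq_mul,
    mul_inv_cancel₀ (by positivity), mul_inv_cancel₀ (by positivity), sub_self]

/-- The comparison of presence and absence of a point in the core is orthogonal to all variables
which depend only on the process outside of the core. -/
lemma integral_mul_poissonTest (hG : IsGadget X I B k δ) (h : IsPoissonProcess X d P η)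
    (g : Motion X d) {U : Ω → ℝ} (hU : Measurable[outsideSigma η (g '' I)] U) :
    ∫ ω, U ω * poissonTest ((X.vol d).real I) (count η (g '' I) ω) ∂P = 0 := by
  have hind : IndepFun U (fun ω => poissonTest ((X.vol d).real I) (count η (g '' I) ω)) P := by
    rw [IndepFun_iff_Indep]
    refine indep_of_indep_of_le_left (indep_of_indep_of_le_right
      (h.indep_outsideSigma (g.measurableSet_image hG.measurableSet_core)) ?_)
      (measurable_iff_comap_le.1 hU)
    rw [← measurable_iff_comap_le]
    exact (measurable_of_countable (poissonTest ((X.vol d).real I))).comp (comap_measurable _)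
  have h1 := hind.integral_mul_eq_mul_integral
    ((hU.mono (h.outsideSigma_le _) le_rfl).aestronglyMeasurable)
    ((measurable_of_countable (poissonTest ((X.vol d).real I))).comp
      (hG.measurable_core h g)).aestronglyMeasurable
  rw [hG.integral_poissonTest h, mul_zero] at h1
  exact h1

end IsGadget

end NNE

/-! ### The lower bound for the variance -/

namespace NNE

variable {d : ℕ} {X : SpaceForm} {Ω : Type*} {ι : Type*} {η : Ω → Set (Pt d)} {I : Set (Pt d)}
  {B : ι → Set (Pt d)} {k : ι → ℕ} {δ : ℝ}

lemma count_sdiff_of_disjoint {J A : Set (Pt d)} (h : Disjoint A J) (ω : Ω) :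
    (η ω \ J ∩ A).encard = count η A ω := by
  rw [count]
  congr 1
  ext z
  exact ⟨fun hz => ⟨hz.1.1, hz.2⟩, fun hz => ⟨⟨hz.1, Set.disjoint_left.1 h hz.2⟩, hz.2⟩⟩

/-- If a gadget inside the window is in its required state and its core contains exactly one
point, then removing this point decreases the functional at least by a fixed amount. -/
lemma IsGadget.edgeSum_add_le (hG : IsGadget X I B k δ) {g : Motion X d} {α t : ℝ} {p : Pt d}
    (hα : 0 ≤ α) (hg : g '' I ⊆ X.ball p t) {ω : Ω} (hω : ω ∈ gadgetEvent η g B k)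
    (h1 : count η (g '' I) ω = 1) :
    edgeSum X α p t (η ω \ g '' I) + ENNReal.ofReal (δ ^ α / 2) ≤ edgeSum X α p t (η ω) := by
  obtain ⟨x, hx⟩ := Set.encard_eq_one.1 h1
  have hx' : x ∈ η ω ∩ g '' I := by rw [hx]; rfl
  have hins : insert x (η ω \ g '' I) = η ω := by
    rw [← Set.singleton_union, ← hx]
    exact Set.inter_union_sdiff _ _
  obtain ⟨h2, y, hy, hδy⟩ := hG.gain g (η ω \ g '' I) x hx'.2
    (fun i => (count_sdiff_of_disjoint (hG.disjoint_image_core g i) ω).trans (hω i))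
    Set.disjoint_sdiff_left
  rw [hins] at h2 hy
  refine le_trans ?_ (NNE.edgeSum_add_le Set.sdiff_subset h2 (fun h => h.2 hx'.2) hx'.1
    (hg hx'.2) hy)
  gcongr
  rw [ENNReal.ofReal_div_of_pos two_pos, div_eq_mul_inv, mul_comm, ENNReal.ofReal_ofNat]
  gcongr
  exact hG.pos.le

variable [MeasurableSpace Ω] {P : Measure Ω}

lemma IsPoissonProcess.hasMeasurableCount (h : IsPoissonProcess X d P η) : HasMeasurableCount η :=
  h.measurable_count

lemma IsPoissonProcess.measurable_edgeSum_sdiff (h : IsPoissonProcess X d P η) {J : Set (Pt d)}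
    (hJ : MeasurableSet J) (α : ℝ) (p : Pt d) (t : ℝ) :
    Measurable[outsideSigma η J] fun ω => edgeSum X α p t (η ω \ J) := by
  refine @measurable_edgeSum d Ω (outsideSigma η J) X (fun ω => η ω \ J) (fun A hA => ?_)
    (fun ω x r => (h.locallyFinite ω x r).subset
      (Set.inter_subset_inter_left _ Set.sdiff_subset)) α p t
  have : count (fun ω => η ω \ J) A = count η (A \ J) := by
    funext ω
    simp only [count]
    congr 1
    ext z
    exact ⟨fun hz => ⟨hz.1.1, hz.2, hz.1.2⟩, fun hz => ⟨⟨hz.1, hz.2.2⟩, hz.2.1⟩⟩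
  rw [this]
  exact measurable_count_outsideSigma η (hA.diff hJ) Set.disjoint_sdiff_left

variable [IsProbabilityMeasure P]

/-- The functional is positively correlated with the test variable of a gadget. -/
lemma IsGadget.le_integral_mul_gadgetTest [Finite ι] (hG : IsGadget X I B k δ)
    (h : IsPoissonProcess X d P η) (g : Motion X d) {α t : ℝ} {p : Pt d} (hα : 0 ≤ α)
    (hg : g '' I ⊆ X.ball p t) (hF : ∫⁻ ω, edgeSum X α p t (η ω) ∂P ≠ ∞) :
    δ ^ α / 2 * P.real (gadgetEvent η g B k) ≤
      ∫ ω, (edgeSum X α p t (η ω)).toReal * gadgetTest η g I B k ω ∂P := by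
  set v := (X.vol d).real I with hv
  have hv0 : 0 < v := hG.vol_real_core_pos
  set A := gadgetEvent η g B k with hA
  have hIm := g.measurableSet_image hG.measurableSet_core
  have hAm' : MeasurableSet[outsideSigma η (g '' I)] A :=
    hG.measurableSet_gadgetEvent (hG.disjoint_image_core g)
  have hAm : MeasurableSet A := h.outsideSigma_le _ _ hAm'
  set F : Ω → ℝ≥0∞ := fun ω => edgeSum X α p t (η ω) with hFdef
  set H : Ω → ℝ≥0∞ := fun ω => edgeSum X α p t (η ω \ g '' I) with hH
  have hFm : Measurable F := measurable_edgeSum h.hasMeasurableCount h.locallyFinite α p t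
  have hHm : Measurable[outsideSigma η (g '' I)] H := h.measurable_edgeSum_sdiff hIm α p t
  set N := count η (g '' I) with hN
  have hNm : Measurable N := hG.measurable_core h g
  have hδ0 : 0 ≤ δ ^ α / 2 := by have := hG.pos; positivity
  -- the expectation on the event that the gadget is ready and its core has `n` points
  set S : ℕ∞ → Set Ω := fun n => A ∩ N ⁻¹' {n} with hS
  have hSm : ∀ n, MeasurableSet (S n) := fun n => hAm.inter (hNm (measurableSet_singleton n))
  have hfac : ∀ (U : Ω → ℝ≥0∞) (n : ℕ∞), Measurable[outsideSigma η (g '' I)] U →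
      ∫⁻ ω in S n, U ω ∂P = (∫⁻ ω in A, U ω ∂P) * P {ω | N ω = n} := by
    intro U n hU
    have h1 := h.lintegral_mul_outside hIm (hU.indicator hAm') (({n} : Set ℕ∞).indicator 1)
    have h2 : ∫⁻ ω, ({n} : Set ℕ∞).indicator 1 (N ω) ∂P = P {ω | N ω = n} := by
      have e : (fun ω => ({n} : Set ℕ∞).indicator (1 : ℕ∞ → ℝ≥0∞) (N ω)) =
          {ω | N ω = n}.indicator 1 := by
        funext ω; simp [Set.indicator_apply]
      have hm : MeasurableSet {ω | N ω = n} := hNm (measurableSet_singleton n)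
      rw [e]
      exact lintegral_indicator_one hm
    rw [h2, lintegral_indicator hAm, ← hN] at h1
    rw [← h1, ← lintegral_indicator (hSm n)]
    refine lintegral_congr fun ω => ?_
    have h3 := Set.inter_indicator_mul (s := A) (t := N ⁻¹' {n}) U 1 ω
    simp only [Pi.one_apply, mul_one] at h3
    exact h3
  set L := ∫⁻ ω in A, H ω ∂P with hL
  set a₀ := Real.exp (-v) with ha₀
  set a₁ := v * Real.exp (-v) with ha₁
  have ha₀0 : 0 < a₀ := by positivity
  have ha₁0 : 0 < a₁ := by positivity
  have hP0 : P {ω | N ω = 0} = ENNReal.ofReal a₀ := hG.prob_core_eq_zero h g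
  have hP1 : P {ω | N ω = 1} = ENNReal.ofReal a₁ := hG.prob_core_eq_one h g
  have hfin : ∀ n, ∫⁻ ω in S n, F ω ∂P ≠ ∞ := fun n =>
    ne_top_of_le_ne_top hF (setLIntegral_le_lintegral _ _)
  have h0 : ∫⁻ ω in S 0, F ω ∂P = L * ENNReal.ofReal a₀ := by
    rw [← hP0, ← hfac H 0 hHm]
    refine setLIntegral_congr_fun (hSm 0) fun ω hω => ?_
    have hdis : η ω \ g '' I = η ω := by
      have : η ω ∩ g '' I = ∅ := Set.encard_eq_zero.1 hω.2
      rw [sdiff_eq_left, Set.disjoint_iff_inter_eq_empty]; exact this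
    simp only [hFdef, hH, hdis]
  have h1 : (L + ENNReal.ofReal (δ ^ α / 2) * P A) * ENNReal.ofReal a₁ ≤ ∫⁻ ω in S 1, F ω ∂P := by
    have e : L + ENNReal.ofReal (δ ^ α / 2) * P A =
        ∫⁻ ω in A, H ω + ENNReal.ofReal (δ ^ α / 2) ∂P := by
      rw [lintegral_add_right _ measurable_const, setLIntegral_const]
    rw [e, ← hP1, ← hfac _ 1 (hHm.add_const _)]
    exact setLIntegral_mono hFm fun ω hω => hG.edgeSum_add_le hα hg hω.1 hω.2
  have hLfin : L ≠ ∞ := by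
    intro hcon
    have := hfin 0
    rw [h0, hcon, ENNReal.top_mul (by simpa using ha₀0)] at this
    exact this rfl
  have hI : Integrable (fun ω => (F ω).toReal) P :=
    integrable_toReal_of_lintegral_ne_top hFm.aemeasurable hF
  have hint : ∀ n, ∫ ω in S n, (F ω).toReal ∂P = (∫⁻ ω in S n, F ω ∂P).toReal := fun n =>
    integral_toReal hFm.aemeasurable (ae_lt_top hFm (hfin n))
  have e : ∀ ω, (F ω).toReal * gadgetTest η g I B k ω =
      a₁⁻¹ * (S 1).indicator (fun ω => (F ω).toReal) ω -
        a₀⁻¹ * (S 0).indicator (fun ω => (F ω).toReal) ω := by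
    intro ω
    rw [gadgetTest, poissonTest, ← hA, ← hN, ← hv, ← ha₀, ← ha₁]
    by_cases hω : ω ∈ A
    · by_cases h1 : N ω = 1
      · have h0 : N ω ≠ 0 := by rw [h1]; exact one_ne_zero
        rw [if_pos h1, Set.indicator_of_mem hω, Set.indicator_of_mem (Set.mem_inter hω h1),
          Set.indicator_of_notMem fun h => h0 h.2, Pi.one_apply]
        ring
      · rw [if_neg h1, Set.indicator_of_notMem (s := S 1) fun h => h1 h.2]
        by_cases h0 : N ω = 0
        · rw [if_pos h0, Set.indicator_of_mem hω, Set.indicator_of_mem (Set.mem_inter hω h0),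
            Pi.one_apply]
          ring
        · rw [if_neg h0, Set.indicator_of_notMem (s := S 0) fun h => h0 h.2]
          ring
    · rw [Set.indicator_of_notMem hω, Set.indicator_of_notMem (s := S 1) fun h => hω h.1,
        Set.indicator_of_notMem (s := S 0) fun h => hω h.1]
      ring
  have h2 : (L.toReal + δ ^ α / 2 * P.real A) * a₁ ≤ (∫⁻ ω in S 1, F ω ∂P).toReal := by
    have := ENNReal.toReal_mono (hfin 1) h1
    rwa [ENNReal.toReal_mul, ENNReal.toReal_add hLfin
      (ENNReal.mul_ne_top ENNReal.ofReal_ne_top (measure_ne_top _ _)), ENNReal.toReal_mul,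
      ENNReal.toReal_ofReal hδ0, ENNReal.toReal_ofReal ha₁0.le] at this
  change _ ≤ ∫ ω, (F ω).toReal * gadgetTest η g I B k ω ∂P
  simp only [e]
  rw [integral_sub ((hI.indicator (hSm 1)).const_mul _) ((hI.indicator (hSm 0)).const_mul _),
    integral_const_mul, integral_const_mul, integral_indicator (hSm 1),
    integral_indicator (hSm 0), hint, hint, h0, ENNReal.toReal_mul, ENNReal.toReal_ofReal ha₀0.le]
  have h3 : L.toReal + δ ^ α / 2 * P.real A ≤ a₁⁻¹ * (∫⁻ ω in S 1, F ω ∂P).toReal := by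
    rw [← div_eq_inv_mul, le_div_iff₀ ha₁0]; exact h2
  have h4 : a₀⁻¹ * (L.toReal * a₀) = L.toReal := by field_simp
  linarith

end NNE

namespace NNE

variable {d : ℕ} {X : SpaceForm} {Ω : Type*} [MeasurableSpace Ω] {P : Measure Ω}
  [IsProbabilityMeasure P] {η : Ω → Set (Pt d)}

lemma memLp_edgeSum (h : IsPoissonProcess X d P η) (hd : 1 ≤ d) {α : ℝ} (hα : 0 ≤ α) (p : Pt d)
    (t : ℝ) : MemLp (fun ω => (edgeSum X α p t (η ω)).toReal) 2 P := by
  have hm := measurable_edgeSum h.hasMeasurableCount h.locallyFinite α p t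
  rw [memLp_two_iff_integrable_sq hm.ennreal_toReal.aestronglyMeasurable]
  simp only [← ENNReal.toReal_pow]
  exact integrable_toReal_of_lintegral_ne_top (hm.pow_const 2).aemeasurable
    (lintegral_edgeSum_sq_ne_top h hd hα p t)

lemma lintegral_edgeSum_ne_top (h : IsPoissonProcess X d P η) (hd : 1 ≤ d) {α : ℝ} (hα : 0 ≤ α)
    (p : Pt d) (t : ℝ) : ∫⁻ ω, edgeSum X α p t (η ω) ∂P ≠ ∞ := by
  have hle : ∀ a : ℝ≥0∞, a ≤ 1 + a ^ 2 := fun a => by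
    rcases le_total a 1 with ha | ha
    · exact ha.trans le_self_add
    · exact le_trans (le_self_pow₀ ha two_ne_zero) le_add_self
  refine ne_top_of_le_ne_top ?_ (lintegral_mono fun ω => hle (edgeSum X α p t (η ω)))
  rw [lintegral_add_left measurable_const]
  exact ENNReal.add_ne_top.2 ⟨by simp, lintegral_edgeSum_sq_ne_top h hd hα p t⟩

lemma disjoint_image_ofPoint {A B : Set (Pt d)} {r s : ℝ} {x y : Pt d} (hA : A ⊆ X.ball 0 r)
    (hB : B ⊆ X.ball 0 s) (h : r + s < X.dist x y) :
    Disjoint (Motion.ofPoint X x '' A) (Motion.ofPoint X y '' B) := by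
  have h1 : ∀ (x : Pt d) (r : ℝ), Motion.ofPoint X x '' X.ball 0 r = X.ball x r := fun x r => by
    rw [Motion.image_ball, Motion.ofPoint_zero]
  refine Set.disjoint_left.2 fun z hz hz' => ?_
  have h2 := (h1 x r).subset (Set.image_mono hA hz)
  have h3 := (h1 y s).subset (Set.image_mono hB hz')
  have h4 := X.dist_triangle x z y
  rw [X.mem_ball] at h2 h3
  rw [X.dist_comm z y] at h4
  linarith

/-- Copies of a gadget at well separated places in the window have uncorrelated test variables,
and each of them makes a fixed contribution to the variance. -/
lemma IsGadget.card_mul_le_variance {ι : Type*} [Finite ι] {I : Set (Pt d)}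
    {B : ι → Set (Pt d)} {k : ι → ℕ} {δ κ π : ℝ} (hG : IsGadget X I B k δ)
    (h : IsPoissonProcess X d P η) (hd : 1 ≤ d) {α : ℝ} (hα : 0 ≤ α) {p : Pt d} {t : ℝ}
    (hκ : κ = ((X.vol d).real I * Real.exp (-(X.vol d).real I))⁻¹ +
      (Real.exp (-(X.vol d).real I))⁻¹)
    (hπ : ∀ g : Motion X d, π = P.real (gadgetEvent η g B k)) {T : Finset (Pt d)}
    (hT : ∀ c ∈ T, c ∈ X.ball p (t - 1)) (hsep : X.Separated 7 T) :
    T.card * ((δ ^ α / 2 * π) ^ 2 / κ ^ 2) ≤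
      Var[fun ω => (edgeSum X α p t (η ω)).toReal; P] := by
  have hv0 := hG.vol_real_core_pos
  have hδ := hG.pos
  have hκ0 : 0 < κ := by rw [hκ]; positivity
  have hπ0 : 0 ≤ π := by rw [hπ (Motion.ofPoint X 0)]; exact measureReal_nonneg
  set Z : Pt d → Ω → ℝ := fun c => gadgetTest η (Motion.ofPoint X c) I B k with hZ
  have hZb : ∀ c ω, |Z c ω| ≤ κ := fun c ω => by rw [hκ]; exact hG.abs_gadgetTest_le _ ω
  have hev : ∀ c, Measurable[outsideSigma η (Motion.ofPoint X c '' I)]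
      ((gadgetEvent η (Motion.ofPoint X c) B k).indicator (1 : Ω → ℝ)) := fun c =>
    (@measurable_const _ _ _ (outsideSigma η (Motion.ofPoint X c '' I)) (1 : ℝ)).indicator
      (hG.measurableSet_gadgetEvent (hG.disjoint_image_core _))
  have hZm : ∀ c, Measurable (Z c) := fun c => by
    have h1 : Measurable fun ω => poissonTest ((X.vol d).real I)
        (count η (Motion.ofPoint X c '' I) ω) :=
      (measurable_of_countable (poissonTest ((X.vol d).real I))).comp (hG.measurable_core h _)
    exact ((hev c).mono (h.outsideSigma_le _) le_rfl).mul h1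
  have hZL : ∀ c, MemLp (Z c) 2 P := fun c =>
    MemLp.of_bound (hZm c).aestronglyMeasurable κ (Filter.Eventually.of_forall (hZb c))
  have hZ0 : ∀ c, ∫ ω, Z c ω ∂P = 0 := fun c => hG.integral_mul_poissonTest h _ (hev c)
  refine NNE.card_mul_le_variance (memLp_edgeSum h hd hα p t) T (fun c _ => hZL c) (by positivity)
    (by positivity) (fun x hx y hy hxy => ?_) (fun c hc => ?_) (fun c hc => ?_)
  · -- the test variable at `y` and the event at `x` depend on the process outside the core at `x`,
    -- as a gadget has its cells within distance `5` and its core within distance `1` of its centre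
    rw [covariance_eq_sub (hZL x) (hZL y), hZ0 x, zero_mul, sub_zero]
    have hdist := hsep y hy x hx hxy.symm
    have h1 : Measurable[outsideSigma η (Motion.ofPoint X x '' I)] (Z y) :=
      hG.measurable_gadgetTest
        (fun i => disjoint_image_ofPoint (hG.cell_subset i) hG.core_subset (by linarith))
        (disjoint_image_ofPoint hG.core_subset hG.core_subset (by linarith))
    rw [← hG.integral_mul_poissonTest h (Motion.ofPoint X x) ((hev x).mul h1)]
    refine integral_congr_ae (Filter.Eventually.of_forall fun ω => ?_)
    simp only [hZ, gadgetTest, Pi.mul_apply]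
    ring
  · rw [covariance_eq_sub (hZL c) (hZL c), hZ0 c, zero_mul, sub_zero]
    have h1 : ∫ ω, (Z c * Z c) ω ∂P ≤ ∫ _, κ ^ 2 ∂P := by
      refine integral_mono ((hZL c).integrable_mul (hZL c)) (integrable_const _) fun ω => ?_
      have := hZb c ω
      rw [Pi.mul_apply, ← sq, ← sq_abs]
      gcongr
    simpa using h1
  · rw [covariance_eq_sub (memLp_edgeSum h hd hα p t) (hZL c), hZ0 c, mul_zero, sub_zero,
      hπ (Motion.ofPoint X c)]
    refine hG.le_integral_mul_gadgetTest h _ hα ?_ (lintegral_edgeSum_ne_top h hd hα p t)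
    refine (Set.image_mono hG.core_subset).trans ?_
    rw [Motion.image_ball, Motion.ofPoint_zero]
    exact X.ball_subset_ball (by have := X.mem_ball.1 (hT c hc); linarith)

lemma rho_le_ballVol (X : SpaceForm) (d : ℕ) {t : ℝ} (ht : 2 ≤ t) :
    rho X d t ≤ X.ballVol d t := by
  cases X
  · have h1 : ∀ s : ℝ, (SpaceForm.euclidean.ball 0 s : Set (Pt d)) = Metric.closedBall 0 s := by
      intro s
      ext z
      change Dist.dist 0 z ≤ s ↔ Dist.dist z 0 ≤ s
      rw [dist_comm]
    have h2 : (SpaceForm.euclidean.vol d) = (volume : Measure (Pt d)) := rfl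
    rw [rho, kappa, SpaceForm.ballVol, h1, h1, h2, measureReal_def, measureReal_def,
      Measure.addHaar_closedBall' _ _ (by linarith : (0 : ℝ) ≤ t), ENNReal.toReal_mul,
      ENNReal.toReal_ofReal (by positivity), finrank_euclideanSpace_fin, mul_comm]
  · have hbdd : BddBelow (Set.range fun r : Set.Ici (2 : ℝ) =>
        (SpaceForm.hyperbolic.vol d).real (SpaceForm.hyperbolic.ball 0 (r : ℝ)) /
          Real.exp ((r : ℝ) * ((d : ℝ) - 1))) := by
      refine ⟨0, ?_⟩
      rintro _ ⟨r, rfl⟩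
      exact div_nonneg measureReal_nonneg (Real.exp_pos _).le
    have h1 : gammaConst d ≤ _ := ciInf_le hbdd ⟨t, ht⟩
    rw [le_div_iff₀ (Real.exp_pos _)] at h1
    rw [rho, if_pos ht]
    exact h1

end NNE

theorem lemma4p2 (X : NNE.SpaceForm) (d : ℕ) (hd : 1 ≤ d) (α : ℝ) (hα : 0 ≤ α) :
    ∃ c : ℝ, 0 < c ∧
      ∀ {Ω : Type*} [MeasurableSpace Ω] (P : Measure Ω) [IsProbabilityMeasure P]
        (η : Ω → Set (NNE.Pt d)), NNE.IsPoissonProcess X d P η →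
      ∀ (p : NNE.Pt d) (t : ℝ), 2 ≤ t →
        (∀ᵐ ω ∂P, NNE.edgeSum X α p t (η ω) ≠ ∞) ∧
        MemLp (fun ω => (NNE.edgeSum X α p t (η ω)).toReal) 2 P ∧
        c * NNE.rho X d t ≤ Var[fun ω => (NNE.edgeSum X α p t (η ω)).toReal; P] ∧
        c * (X.vol d).real (X.ball p t) ≤
          Var[fun ω => (NNE.edgeSum X α p t (η ω)).toReal; P] := by

  obtain ⟨m, I, B, k, δ, hG⟩ := NNE.exists_isGadget X hd
  obtain ⟨C, hC0, hC⟩ := X.exists_ballVol_add_one_le d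
  set v := (X.vol d).real I with hv
  have hv0 : 0 < v := hG.vol_real_core_pos
  have hδ := hG.pos
  set κ := (v * Real.exp (-v))⁻¹ + (Real.exp (-v))⁻¹ with hκ
  have hκ0 : 0 < κ := by positivity
  set π := (∏ i, ENNReal.ofReal (Real.exp (-(X.vol d).real (B i)) * (X.vol d).real (B i) ^ k i /
    (k i).factorial)).toReal with hπ
  have hπ0 : 0 < π := ENNReal.toReal_pos hG.prod_pos.ne'
    (ENNReal.prod_ne_top fun i _ => ENNReal.ofReal_ne_top)
  have hV : 0 < X.ballVol d 7 := X.ballVol_pos (by norm_num)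
  set b := (δ ^ α / 2 * π) ^ 2 / κ ^ 2 with hb
  have hb0 : 0 < b := by positivity
  refine ⟨b / (C * X.ballVol d 7), by positivity, ?_⟩
  intro Ω _ P _ η h p t ht
  have hvar : b / (C * X.ballVol d 7) * X.ballVol d t ≤
      Var[fun ω => (NNE.edgeSum X α p t (η ω)).toReal; P] := by
    obtain ⟨T, hT, hsep, hnet⟩ := X.exists_separated_net p (t - 1) (δ := 7) (by norm_num)
    have h1 := hG.card_mul_le_variance (π := π) h hd hα hκ
      (fun g => by rw [hπ, measureReal_def, hG.prob_gadgetEvent h g]) hT hsep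
    refine le_trans ?_ h1
    have h2 : X.ballVol d (t - 1) ≤ T.card * X.ballVol d 7 := by
      rw [← X.real_vol_ball p]
      have hsub : X.ball p (t - 1) ⊆ ⋃ c ∈ T, X.ball c 7 := fun y hy =>
        let ⟨c, hc, hcy⟩ := hnet y hy
        Set.mem_biUnion hc hcy
      calc (X.vol d).real (X.ball p (t - 1)) ≤ (X.vol d).real (⋃ c ∈ T, X.ball c 7) :=
            measureReal_mono hsub ((measure_biUnion_lt_top T.finite_toSet
              fun c _ => X.vol_ball_lt_top c 7).ne)
        _ ≤ ∑ c ∈ T, (X.vol d).real (X.ball c 7) := measureReal_biUnion_finset_le _ _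
        _ = _ := by simp only [X.real_vol_ball, Finset.sum_const, nsmul_eq_mul]
    have h3 := hC (t - 1) (by linarith)
    rw [sub_add_cancel] at h3
    have h4 : X.ballVol d t ≤ C * (T.card * X.ballVol d 7) :=
      h3.trans (mul_le_mul_of_nonneg_left h2 hC0.le)
    rw [div_mul_eq_mul_div, div_le_iff₀ (by positivity)]
    calc b * X.ballVol d t ≤ b * (C * (T.card * X.ballVol d 7)) :=
          mul_le_mul_of_nonneg_left h4 hb0.le
      _ = _ := by ring
  refine ⟨?_, NNE.memLp_edgeSum h hd hα p t, ?_, ?_⟩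
  · have hm := NNE.measurable_edgeSum h.hasMeasurableCount h.locallyFinite α p t
    exact (ae_lt_top hm (NNE.lintegral_edgeSum_ne_top h hd hα p t)).mono fun ω hω => hω.ne
  · exact le_trans (mul_le_mul_of_nonneg_left (NNE.rho_le_ballVol X d ht) (by positivity)) hvar
  · rw [X.real_vol_ball]; exact hvar
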